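/- **Setting.** Let $\tau,\gamma\in\mathbb C$ with $\operatorname{Im}\tau>0$, $\gamma\neq0$, and $[z]=-\sum_{j\in\mathbb Z+1/2}e^{i\pi j^2\tau+2\pi i j(z+1/2)}$. For $n\ge1$ and a character $\chi:\Gamma=\mathbb Z+\tau\mathbb Z\to\mathbb C^\times$, $\Theta_n(\chi)$ is the space of entire functions $\phi$ with $\phi(y+1)=\chi(1)\phi(y)$ and $\phi(y+\tau)=\chi(\tau)e^{-2\pi i n y-\pi i n\tau}\phi(y)$ (elliptic polynomials). For dynamical variables $\lambda=(\lambda_1,\lambda_2,\dots)$ let $$R(z,w,\lambda)=\sum_i[z-w-\gamma]E_{ii}\otimes E_{ii}+\sum_{i\ne j}\alpha(z-w,\lambda_i-\lambda_j)E_{ii}\otimes E_{jj}+\sum_{i\neq j}\beta(z-w,\lambda_i-\lambda_j)E_{ij}\otimes E_{ji},$$ $\alpha(z,\lambda)=[z][\lambda+\gamma]/[\lambda]$, $\beta(z,\lambda)=-[z+\lambda][\gamma]/[\lambda]$. A vertex at which a horizontal line (parameter $z$) with colours $a$ (left), $a'$ (right) crosses a vertical line (parameter $w$) with colours $b$ (bottom),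 $b'$ (top) has as weight the coefficient of $e_{a'}\otimes e_{b'}$ in $R(z,w,\lambda)(e_a\otimes e_b)$, where $\lambda$ is the dynamical parameter of the face to its upper left. Crossing a line of colour $l$ rightwards or downwards changes the dynamical parameter by $-\gamma\mu_l$, where $\mu_l$ is the $l$-th unit vector. **Lattice.** Let $M\ge1$. There are layers $1,\dots,M$. Layer $p$ has $k_p$ horizontal lines, with parameters $z^{(p)}_1,\dots,z^{(p)}_{k_p}$ from top to bottom. Layer $M$ has $L_M$ vertical lines, with parameters $w^{(M)}_1,\dots,w^{(M)}_{L_M}$ from left to right; layer $p<M$ has, from left to right, vertical lines with parameters $\boldsymbol w^{(p)}_{\mathrm I}$ ($L^{\mathrm I}_p$ of them), $\boldsymbol z^{(p+1)}$ ($k_{p+1}$), $\boldsymbol w^{(p)}_{\mathrm{II}}$ ($L^{\mathrm{II}}_p$). The line $z^{(p+1)}_j$ leaves layer $p$ at the top and enters layer $p+1$ from the left. In layer $p$ the colours are $1,\dots,p+1$; all bottom ends and all right ends in layer $p$ have colour $p+1$; the left ends in layer 1 have colour $1$. The top ends of the lines $\boldsymbol w^{(1)}_{\mathrm I},\dots,\boldsymbol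 w^{(M-1)}_{\mathrm I},\boldsymbol w^{(M)},\boldsymbol w^{(M-1)}_{\mathrm{II}},\dots,\boldsymbol w^{(1)}_{\mathrm{II}}$ are numbered $1,2,3,\dots$ in this order (the coordinates) and carry prescribed colours; $i_x^{(p)}\in\{1,\dots,p+1\}$ is the colour at coordinate $x$ if $x$ lies in layer $p$. For $1\le p\le M$ let $\widehat{\boldsymbol I}^{(p)}$ be the set of coordinates in the layers $p,\dots,M$ and $\boldsymbol I^{(p)}_{k_p}\subseteq\widehat{\boldsymbol I}^{(p)}$ the subset of those with colour $\le p$; the colours are such that $|\boldsymbol I^{(p)}_{k_p}|=k_p$ for all $p$. The colours are determined by $\boldsymbol I=(\boldsymbol I^{(1)}_{k_1},\dots,\boldsymbol I^{(M)}_{k_M})$. The induced set $\widetilde{\boldsymbol I}^{(p)}_{k_p}$ is the image of $\boldsymbol I^{(p)}_{k_p}$ when the coordinates of colour $\ge p+2$ are deleted from $\widehat{\boldsymbol I}^{(p)}$ and the others are relabelled $1,2,\dots$ in order. Put $$\lambda^{[p]}=\lambda+\gamma\sum_{q=p}^{M-1}\ \sum_{x\text{ a coordinate of }\boldsymbol w^{(q)}_{\mathrm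 I}}\mu_{i^{(q)}_x}.$$ The partition function $\psi(\boldsymbol z|\boldsymbol w|k|L|\boldsymbol I|\lambda)$ is the sum, over all colourings of the remaining edges (with colours $1,\dots,p+1$ in layer $p$), of the product of all vertex weights, where $\lambda^{[p]}$ is the dynamical parameter at the northwest corner of layer $p$ (so $\lambda$ itself for $p=M$). For $M=0$ put $\psi=1$. Assume that $\lambda$ is generic: $[\lambda_i-\lambda_j+n\gamma]\ne0$ for all $1\le i\neq j\le M+1$ and $n\in\mathbb Z$. Let $L^{\mathrm I}=L^{\mathrm I}_1+\dots+L^{\mathrm I}_{M-1}+L_M$, $\iota=i^{(M)}_{L^{\mathrm I}}$ (when $L_M\ge1$), $C^{(p)}(x,l)$ the number of coordinates $\le x$ of colour $l$ in the layers $p,\dots,M$, and $C=C^{(M)}(L^{\mathrm I},\iota)$. **Proposition.** (In 1, 3, 4, 5 let $L_M\ge1$.) 1. *Case A.* If $\iota\ne M+1$, then $k_M\ge 1$ and $\psi$, as a function of $y=w^{(M)}_{L_M}$, is an elliptic polynomial in $\Theta_{k_M}(\chi)$ for the character with $\chi(1)=(-1)^{k_M}$, $\chi(\tau)=(-1)^{k_M}\exp\big(2\pi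 i(\sum_{j=1}^{k_M} z^{(M)}_j-\lambda_\iota+\lambda_{M+1}-\gamma(L_M-C))\big)$; that is, $\psi(y+1)=(-1)^{k_M}\psi(y)$ and $$\psi(y+\tau)=(-1)^{k_M}\exp\Big(-2\pi i\Big(k_My-\sum_{j=1}^{k_M}z^{(M)}_j+\lambda_\iota-\lambda_{M+1}+\gamma(L_M-C)\Big)-\pi i k_M\tau\Big)\psi(y).$$ 2. $\psi$ is symmetric in $z^{(M)}_1,\dots,z^{(M)}_{k_M}$. 3. *Case A.* If $\iota\neq M+1$, then $$\psi\big|_{w^{(M)}_{L_M}=z^{(M)}_{k_M}-\gamma}=\prod_{j=1}^{L_M-1}\big[z^{(M)}_{k_M}-w^{(M)}_j\big]\prod_{j=1}^{k_M-1}\big[z^{(M)}_j-z^{(M)}_{k_M}+\gamma\big]\ \frac{[\gamma]\,\big[\lambda_{M+1}-\lambda_\iota+\gamma(k_M-L_M+C)\big]}{\big[\lambda_\iota-\lambda_{M+1}+\gamma(1-C)\big]}\ \psi',$$ where $\psi'$ is the partition function, with the same $\lambda$, obtained by deleting $z^{(M)}_{k_M}$ from $\boldsymbol z^{(M)}$ and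 $w^{(M)}_{L_M}$ from $\boldsymbol w^{(M)}$, replacing $\boldsymbol w^{(M-1)}_{\mathrm{II}}$ by $(z^{(M)}_{k_M},\boldsymbol w^{(M-1)}_{\mathrm{II}})$ (if $M\ge2$), and $k_M,L_M,L^{\mathrm{II}}_{M-1}$ by $k_M-1,L_M-1,L^{\mathrm{II}}_{M-1}+1$, with the label $\boldsymbol J$ given by $\boldsymbol J^{(p)}_{k_p}=\boldsymbol I^{(p)}_{k_p}$ ($1\le p\le M-1$), $\boldsymbol J^{(M)}_{k_M-1}=\boldsymbol I^{(M)}_{k_M}\setminus\{L^{\mathrm I}\}$. This label exists, and $\widetilde{\boldsymbol J}^{(p)}_{k_p}=\widetilde{\boldsymbol I}^{(p)}_{k_p}$ for $1\le p\le M-1$. 4. *Case B.* If $\iota=M+1$, then $\psi=\prod_{j=1}^{k_M}[z^{(M)}_j-w^{(M)}_{L_M}-\gamma]\ \psi'$, where $\psi'$ is obtained, with the same $\lambda$, by deleting $w^{(M)}_{L_M}$ (so $L_M$ becomes $L_M-1$), with the label $\boldsymbol J^{(p)}_{k_p}=\{j\in\boldsymbol I^{(p)}_{k_p}:j\le L^{\mathrm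 I}\}\cup\{j-1: j\in\boldsymbol I^{(p)}_{k_p},\,j>L^{\mathrm I}\}$ ($1\le p\le M-1$), $\boldsymbol J^{(M)}_{k_M}=\boldsymbol I^{(M)}_{k_M}$. This label exists, and $\widetilde{\boldsymbol J}^{(p)}_{k_p}=\widetilde{\boldsymbol I}^{(p)}_{k_p}$ for $1\le p\le M-1$. 5. *Initial condition.* If $k_M=1$ and $\iota\neq M+1$, then $$\psi=\frac{[\gamma]\,\big[z^{(M)}_1-w^{(M)}_{L_M}+\lambda_{M+1}-\lambda_\iota-\gamma(L_M-1)\big]}{[\lambda_\iota-\lambda_{M+1}]}\ \prod_{j=1}^{L_M-1}\big[z^{(M)}_1-w^{(M)}_j\big]\ \psi',$$ where $\psi'$ is the partition function with the $M-1$ layers $1,\dots,M-1$, dynamical variables $\lambda^{[M-1]}$, top-layer vertical parameters $(\boldsymbol w^{(M-1)}_{\mathrm I},z^{(M)}_1,\boldsymbol w^{(M-1)}_{\mathrm{II}})$ ($L^{\mathrm I}_{M-1}+1+L^{\mathrm{II}}_{M-1}$ lines) and the label $\boldsymbol J^{(p)}_{k_p}=\{j\in\boldsymbol I^{(p)}_{k_p}:j<L^{\mathrm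 I}\}\cup\{j-L_M+1:j\in\boldsymbol I^{(p)}_{k_p},\,j\ge L^{\mathrm I}\}$ ($1\le p\le M-1$); $\psi'=1$ if $M=1$. This label exists, and $\widetilde{\boldsymbol J}^{(p)}_{k_p}=\widetilde{\boldsymbol I}^{(p)}_{k_p}$ for $1\le p\le M-1$. -/

import Mathlib

open Finset

noncomputable section

namespace EllipticNested

/-! ### Theta function and elliptic polynomials -/

/-- The odd theta function `[z] = -∑_{j ∈ ℤ + 1/2} exp(iπ j² τ + 2πi j (z + 1/2))`. -/
def theta (τ z : ℂ) : ℂ :=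
  -∑' j : ℤ, Complex.exp
    (Complex.I * Real.pi * ((j : ℂ) + 1 / 2) ^ 2 * τ
      + 2 * Real.pi * Complex.I * ((j : ℂ) + 1 / 2) * (z + 1 / 2))

/-- The group `Γ = ℤ + τ ℤ`. -/
def periodLattice (τ : ℂ) : AddSubgroup ℂ := AddSubgroup.closure {1, τ}

/-- The period `1`, as an element of `Γ`. -/
def periodOne (τ : ℂ) : periodLattice τ :=
  ⟨1, AddSubgroup.subset_closure (by simp)⟩

/-- The period `τ`, as an element of `Γ`. -/
def periodTau (τ : ℂ) : periodLattice τ :=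
  ⟨τ, AddSubgroup.subset_closure (by simp)⟩

/-- Characters of `Γ`: group homomorphisms `Γ → ℂˣ` (the group law of `Γ` is its addition). -/
abbrev PeriodCharacter (τ : ℂ) : Type := Multiplicative (periodLattice τ) →* ℂˣ

/-- The space `Θ_n(χ)` of elliptic polynomials. -/
def thetaSpace (τ : ℂ) (n : ℕ) (χ : PeriodCharacter τ) : Submodule ℂ (ℂ → ℂ) where
  carrier := {φ | Differentiable ℂ φ ∧
    (∀ y, φ (y + 1) = (χ (Multiplicative.ofAdd (periodOne τ)) : ℂ) * φ y) ∧
    (∀ y, φ (y + τ) = (χ (Multiplicative.ofAdd (periodTau τ)) : ℂ)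
      * Complex.exp (-2 * Real.pi * Complex.I * n * y - Real.pi * Complex.I * n * τ) * φ y)}
  add_mem' := by
    rintro f g ⟨hf, hf1, hf2⟩ ⟨hg, hg1, hg2⟩
    refine ⟨hf.add hg, fun y => ?_, fun y => ?_⟩
    · simp only [Pi.add_apply, hf1, hg1]; ring
    · simp only [Pi.add_apply, hf2, hg2]; ring
  zero_mem' := by
    refine ⟨differentiable_const 0, fun y => ?_, fun y => ?_⟩ <;> simp
  smul_mem' := by
    rintro a f ⟨hf, hf1, hf2⟩
    refine ⟨hf.const_smul a, fun y => ?_, fun y => ?_⟩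
    · simp only [Pi.smul_apply, smul_eq_mul, hf1]; ring
    · simp only [Pi.smul_apply, smul_eq_mul, hf2]; ring

/-! ### The dynamical R-matrix -/

def alphaWeight (τ γ z l : ℂ) : ℂ := theta τ z * theta τ (l + γ) / theta τ l

def betaWeight (τ γ z l : ℂ) : ℂ := -(theta τ (z + l) * theta τ γ / theta τ l)

/-- Matrix element of the dynamical R-matrix
`R(z,w,λ) = ∑_i [z-w-γ] E_ii ⊗ E_ii + ∑_{i≠j} α(z-w, λ_i-λ_j) E_ii ⊗ E_jj
  + ∑_{i≠j} β(z-w, λ_i-λ_j) E_ij ⊗ E_ji`,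
namely the coefficient of `e_{a'} ⊗ e_{b'}` in `R(z,w,λ) (e_a ⊗ e_b)`. The first tensor factor is
the auxiliary (horizontal) line, with colour `a` on its left and `a'` on its right edge at the
vertex; the second one is the quantum (vertical) line, with colour `b` on its bottom and `b'` on
its top edge. The dynamical variables `λ_i`, `i = 1, 2, …`, are those of the face at the upper left
of the vertex. Colours are `1, 2, …`. -/
def vertexWeight (τ γ : ℂ) (lam : ℕ → ℂ) (z w : ℂ) (a b a' b' : ℕ) : ℂ :=
  if a = b then
    if a' = a ∧ b' = a then theta τ (z - w - γ) else 0
  else if a' = a ∧ b' = b then alphaWeight τ γ (z - w) (lam a - lam b)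
  else if a' = b ∧ b' = a then betaWeight τ γ (z - w) (lam a' - lam a)
  else 0

/-- `λ + g ∑_{j=1}^{n} μ_{t j}`. Crossing a line of colour `l` rightwards or downwards changes the
dynamical variables by `-γ μ_l`. -/
def shiftDyn (g : ℂ) (lam : ℕ → ℂ) (t : ℕ → ℕ) (n : ℕ) : ℕ → ℂ :=
  fun i => lam i + g * (#{j ∈ Icc 1 n | t j = i} : ℂ)

/-! ### One layer

All families of lines are indexed from `1`, by functions on `ℕ` of which only the entries up to the
number of lines matter. -/

/-- A tuple of `n` colours from `{1, …, N}` as a function on the indices `1, …, n`. -/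
def toColours {n N : ℕ} (u : Fin n → Fin N) : ℕ → ℕ :=
  fun s => if h : s - 1 < n then (u ⟨s - 1, h⟩ : ℕ) + 1 else 0

/-- One horizontal line with spectral parameter `z` crossing vertical lines `1, …, n` (from left to
right) with parameters `w 1, …, w n`, bottom colours `b`, top colours `t`; `a` and `a'` are the
colours at the left and right end. The colours of the inner horizontal edges are summed over
`{1, …, N}`; `lam` belongs to the face at the upper left of the row. -/
def rowWeight (τ γ : ℂ) (N : ℕ) (lam : ℕ → ℂ) (z : ℂ) (w : ℕ → ℂ) (b t : ℕ → ℕ) :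
    ℕ → ℕ → ℕ → ℂ
  | 0, a, a' => if a = a' then 1 else 0
  | n + 1, a, a' => ∑ x ∈ Icc 1 N, rowWeight τ γ N lam z w b t n a x *
      vertexWeight τ γ (shiftDyn (-γ) lam t n) z (w (n + 1)) x (b (n + 1)) a' (t (n + 1))

/-- Partition function of a layer with `n` vertical lines and horizontal lines `1, …, m` (from top
to bottom) with parameters `z 1, …, z m`; `l`, `r`, `t` and the last argument `b` are the colours
at the left, right, top and bottom ends of the lines. The colours of the inner edges are summed
over `{1, …, N}`; `lam` belongs to the northwest corner. -/
def layerWeight (τ γ : ℂ) (N : ℕ) (lam : ℕ → ℂ) (n : ℕ) (z w : ℕ → ℂ) (l r t : ℕ → ℕ) :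
    ℕ → (ℕ → ℕ) → ℂ
  | 0, b => ∏ s ∈ Icc 1 n, if t s = b s then 1 else 0
  | m + 1, b => ∑ u : Fin n → Fin N,
      layerWeight τ γ N lam n z w l r t m (toColours u) *
        rowWeight τ γ N (shiftDyn (-γ) lam l m) (z (m + 1)) w b (toColours u) n
          (l (m + 1)) (r (m + 1))

/-! ### The nested lattice -/

/-- `f 1, …, f p, g 1, …, g q, h 1, h 2, …` -/
def lineUp {α : Type} (p q : ℕ) (f g h : ℕ → α) : ℕ → α :=
  fun s => if s ≤ p then f s else if s ≤ p + q then g (s - p) else h (s - p - q)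

/-- Sizes of a lattice with layers `1, …, M` (from bottom left to top right). Layer `p` has
`k p` horizontal lines. Layer `M` has `L` vertical lines. Layer `p < M` has
`LI p + k (p + 1) + LII p` vertical lines, the middle ones of which continue as the horizontal
lines of layer `p + 1`. Entries for other indices are irrelevant. -/
structure Shape where
  M : ℕ
  k : ℕ → ℕ
  LI : ℕ → ℕ
  LII : ℕ → ℕ
  L : ℕ

/-- Spectral parameters: `z p j = z^{(p)}_j`, `wI p j = w^{(p)}_{I,j}`, `wII p j = w^{(p)}_{II,j}`,
`w j = w^{(M)}_j`. -/
structure Spectral where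
  z : ℕ → ℕ → ℂ
  wI : ℕ → ℕ → ℂ
  wII : ℕ → ℕ → ℂ
  w : ℕ → ℂ

namespace Shape

variable (S : Shape)

/-- `L^I_1 + ⋯ + L^I_{p-1}`: the number of coordinates before the left ones of layer `p`. -/
def offI (p : ℕ) : ℕ := ∑ q ∈ Ico 1 p, S.LI q

/-- `L^I = L^I_1 + ⋯ + L^I_{M-1} + L_M`: the last coordinate of layer `M`. -/
def LTop : ℕ := S.offI S.M + S.L

/-- The number of coordinates before the right ones of layer `p < M`. -/
def offII (p : ℕ) : ℕ := S.LTop + ∑ q ∈ Ico (p + 1) S.M, S.LII q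

/-- The set of all coordinates in the layers `p, …, M`. -/
def hatSet (p : ℕ) : Finset ℕ :=
  Icc (S.offI p + 1) (S.LTop + ∑ q ∈ Ico p S.M, S.LII q)

/-- The coordinates in the layers `p, …, M` with colour in `{1, …, p}`, for the assignment
`c` of colours to coordinates. -/
def labelSet (c : ℕ → ℕ) (p : ℕ) : Finset ℕ := {x ∈ S.hatSet p | c x ≤ p}

/-- The induced label: delete the coordinates coloured `p + 2, …, M + 1` from `hatSet p`, relabel
the remaining ones `1, 2, 3, …` in order, and take the image of `labelSet p`. -/
def inducedSet (c : ℕ → ℕ) (p : ℕ) : Finset ℕ :=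
  (S.labelSet c p).image fun x => #{y ∈ S.hatSet p | c y ≤ p + 1 ∧ y ≤ x}

/-- `C^{(p)}(x, l)`: the number of coordinates `≤ x` in the layers `p, …, M` of colour `l`. -/
def count (c : ℕ → ℕ) (p x l : ℕ) : ℕ := #{y ∈ S.hatSet p | y ≤ x ∧ c y = l}

/-- The colour assignments under consideration: in layer `p` the colours are among
`1, …, p + 1`, and exactly `k p` of the coordinates in the layers `p, …, M` have a colour
`≤ p`. -/
structure IsAdmissible (c : ℕ → ℕ) : Prop where
  top : ∀ j ∈ Icc 1 S.L, c (S.offI S.M + j) ∈ Icc 1 (S.M + 1)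
  left : ∀ p ∈ Ico 1 S.M, ∀ j ∈ Icc 1 (S.LI p), c (S.offI p + j) ∈ Icc 1 (p + 1)
  right : ∀ p ∈ Ico 1 S.M, ∀ j ∈ Icc 1 (S.LII p), c (S.offII p + j) ∈ Icc 1 (p + 1)
  card : ∀ p ∈ Icc 1 S.M, #(S.labelSet c p) = S.k p

/-- `λ^{[p]} = λ + γ ∑ μ_{c x}`, summed over the left coordinates `x` of the layers
`p, …, M - 1`. -/
def dyn (γ : ℂ) (c : ℕ → ℕ) (lam : ℕ → ℂ) (p : ℕ) : ℕ → ℂ :=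
  fun i => lam i +
    γ * ∑ q ∈ Ico p S.M, ∑ j ∈ Icc 1 (S.LI q), if c (S.offI q + j) = i then 1 else 0

/-- The shape after removing the last horizontal and the last vertical line of layer `M`; the part
of the former inside layer `M - 1` (if `2 ≤ M`) becomes the first right vertical line there. -/
def dropCorner : Shape where
  M := S.M
  k := Function.update S.k S.M (S.k S.M - 1)
  LI := S.LI
  LII := Function.update S.LII (S.M - 1) (S.LII (S.M - 1) + 1)
  L := S.L - 1

/-- The shape after removing the last vertical line of layer `M`. -/
def dropColumn : Shape := { S with L := S.L - 1 }

/-- The shape after removing layer `M` when it has one horizontal line. -/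
def dropLayer : Shape where
  M := S.M - 1
  k := S.k
  LI := S.LI
  LII := S.LII
  L := S.LI (S.M - 1) + 1 + S.LII (S.M - 1)

end Shape

/-- The partition function of the layers `1, …, M`, when layer `M` has `n` vertical lines with
parameters `w` and top colours `t`, and its northwest corner carries `lam`; `cI p j`, `cII p j` are
the top colours of the left and right vertical lines of layer `p < M`.
In layer `M` the vertical lines have bottom colour `M + 1` and the horizontal lines have right
colour `M + 1`. The colours `e` of the lines joining layer `M - 1` to layer `M` are summed over
`{1, …, M}`; for `M = 1` this is the single left colour `1` of the first layer. Passing from layer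
`M` to the northwest corner of layer `M - 1` one crosses its left vertical lines leftwards. -/
def nestedSum (τ γ : ℂ) (k LI LII : ℕ → ℕ) (z wI wII : ℕ → ℕ → ℂ) (cI cII : ℕ → ℕ → ℕ) :
    ℕ → ℕ → (ℕ → ℂ) → (ℕ → ℕ) → (ℕ → ℂ) → ℂ
  | 0, _, _, _, _ => 1
  | M + 1, n, w, t, lam => ∑ e : Fin (k (M + 1)) → Fin (M + 1),
      layerWeight τ γ (M + 2) lam n (z (M + 1)) w (toColours e) (fun _ => M + 2) t
          (k (M + 1)) (fun _ => M + 2) *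
        nestedSum τ γ k LI LII z wI wII cI cII M
          (LI M + k (M + 1) + LII M)
          (lineUp (LI M) (k (M + 1)) (wI M) (z (M + 1)) (wII M))
          (lineUp (LI M) (k (M + 1)) (cI M) (toColours e) (cII M))
          (shiftDyn γ lam (cI M) (LI M))

/-- The elliptic partition function `ψ` of shape `S` with spectral parameters `X`, colours `c x` at
the coordinates `x`, and dynamical variables `lam i = λ_i`, `1 ≤ i ≤ M + 1`. -/
def psi (τ γ : ℂ) (S : Shape) (X : Spectral) (c : ℕ → ℕ) (lam : ℕ → ℂ) : ℂ :=
  nestedSum τ γ S.k S.LI S.LII X.z X.wI X.wII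
    (fun p j => c (S.offI p + j)) (fun p j => c (S.offII p + j))
    S.M S.L X.w (fun j => c (S.offI S.M + j)) lam

namespace Spectral

variable (X : Spectral)

/-- The value `y` is given to `w^{(M)}_n`. -/
def setW (n : ℕ) (y : ℂ) : Spectral := { X with w := Function.update X.w n y }

/-- The variables `z^{(p)}_j` are permuted by `σ`. -/
def permZ (p : ℕ) (σ : Equiv.Perm ℕ) : Spectral :=
  { X with z := Function.update X.z p (fun j => X.z p (σ j)) }

/-- `y` is put in front of the variables `w^{(p)}_II`. -/
def consWII (p : ℕ) (y : ℂ) : Spectral :=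
  { X with wII := Function.update X.wII p (fun j => if j = 1 then y else X.wII p (j - 1)) }

/-- The vertical lines of layer `p` become those of the top layer, when layer `p + 1` has one
horizontal line: `w^{(p)}_I, z^{(p+1)}_1, w^{(p)}_II`, where `n = L^I_p`. -/
def dropLayer (p n : ℕ) : Spectral :=
  { X with w := lineUp n 1 (X.wI p) (X.z (p + 1)) (X.wII p) }

end Spectral

end EllipticNested

end

open EllipticNested

/-!
The partition function is a sum over the layers of a product of layer weights, and every assertion
is about the top layer and the way it is attached to the rest of the lattice.

*Symmetry.* The weights satisfy the dynamical Yang–Baxter equation (`yang_baxter`), all of whose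
matrix elements reduce to the three-term identity for the theta function (`theta_three_term`). As in
the train argument for the six-vertex model, a crossing of two adjacent horizontal lines can be moved
through a layer from left to right, and a crossing of two adjacent vertical lines from top to bottom
(`layerWeight_exchange_rows`, `layerWeight_exchange_columns`). Since all right ends and all bottom
ends of a layer have the same colour, the crossing becomes the scalar `[z - z' - γ]` when it leaves
the layer there. Attach a crossing to two horizontal lines of the top layer on the right, and move it
to the left; there it crosses two vertical lines of the layer below, and it leaves the lattice at the
bottom of that layer with the same scalar (`theta_mul_nestedSum_swap`). The scalar is cancelled for
generic parameters, and then for all parameters by continuity.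

*Dependence on the last vertical parameter.* Split off the last column of the top layer
(`layerWeight_succ_column`). As its right and bottom ends have the highest colour, its colours are
almost determined by the ice rule. If its top end has the highest colour too, then the column is
frozen and contributes a product of factors `[z - w - γ]`; this is the factorisation. If its top end
has another colour, this colour leaves the column at exactly one vertex, with weight of type `β`;
vertices above it have type `α` and those below it have weight `[z - w - γ]`. All these products have
the same quasi-periods, because the shifts of the dynamical variables in the argument of `β`
compensate the number of shifts by `γ` below it (`isElliptic_colWeight`). At `w = z - γ`, with `z`
the last horizontal parameter, the last weight `[z - w - γ]` vanishes, so that the colour leaves the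
column at the last vertex. Then the last row is frozen as well, and its weights telescope
(`layerWeight_corner`). The same happens for a single horizontal line, at any value of the
parameters (`layerWeight_one`).

*Labels.* An admissible colouring is determined by its label (`Shape.IsAdmissible.eqOn`), so it
suffices to exhibit one colouring of each of the reduced lattices. It is the old one, restricted along
an increasing injection of coordinates whose image misses only coordinates of the highest colour;
hence the induced labels agree (`Shape.inducedSet_comp`).
-/

namespace EllipticNested

/-! ### The theta function -/

/-- The summand of the series defining `theta`, without the sign. -/
noncomputable def thetaTerm (τ : ℂ) (j : ℤ) (z : ℂ) : ℂ :=
  Complex.exp (Complex.I * Real.pi * ((j : ℂ) + 1 / 2) ^ 2 * τ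
      + 2 * Real.pi * Complex.I * ((j : ℂ) + 1 / 2) * (z + 1 / 2))

theorem thetaTerm_eq (τ : ℂ) (j : ℤ) (z : ℂ) :
    thetaTerm τ j z = Complex.exp (Complex.I * Real.pi * τ / 4 + Real.pi * Complex.I * (z + 1 / 2))
      * jacobiTheta₂_term j (z + 1 / 2 + τ / 2) τ := by
  rw [thetaTerm, jacobiTheta₂_term, ← Complex.exp_add]
  congr 1; ring

theorem theta_eq_jacobiTheta₂ (τ z : ℂ) :
    theta τ z = -(Complex.exp (Complex.I * Real.pi * τ / 4 + Real.pi * Complex.I * (z + 1 / 2))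
      * jacobiTheta₂ (z + 1 / 2 + τ / 2) τ) := by
  rw [theta, jacobiTheta₂, ← tsum_mul_left]
  exact congrArg _ (tsum_congr fun j => thetaTerm_eq τ j z)

theorem hasSum_thetaTerm {τ : ℂ} (hτ : 0 < τ.im) (z : ℂ) :
    HasSum (fun j => thetaTerm τ j z) (-theta τ z) := by
  rw [theta_eq_jacobiTheta₂, neg_neg]
  simp only [thetaTerm_eq]
  exact (hasSum_jacobiTheta₂_term _ hτ).mul_left _

theorem differentiable_theta {τ : ℂ} (hτ : 0 < τ.im) : Differentiable ℂ (theta τ) := by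
  have : theta τ = fun z => -(Complex.exp (Complex.I * Real.pi * τ / 4
      + Real.pi * Complex.I * (z + 1 / 2)) * jacobiTheta₂ (z + 1 / 2 + τ / 2) τ) :=
    funext (theta_eq_jacobiTheta₂ τ)
  rw [this]
  have h : Differentiable ℂ fun z => jacobiTheta₂ (z + 1 / 2 + τ / 2) τ := fun z =>
    DifferentiableAt.comp z (g := fun z => jacobiTheta₂ z τ)
      (differentiableAt_jacobiTheta₂_fst _ hτ) (by fun_prop)
  fun_prop

theorem theta_add_one (τ z : ℂ) : theta τ (z + 1) = -theta τ z := by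
  rw [theta_eq_jacobiTheta₂, theta_eq_jacobiTheta₂,
    show z + 1 + 1 / 2 + τ / 2 = (z + 1 / 2 + τ / 2) + 1 by ring, jacobiTheta₂_add_left,
    show Complex.I * Real.pi * τ / 4 + Real.pi * Complex.I * (z + 1 + 1 / 2)
      = (Complex.I * Real.pi * τ / 4 + Real.pi * Complex.I * (z + 1 / 2)) + Real.pi * Complex.I
      by ring, Complex.exp_add _ (Real.pi * Complex.I), Complex.exp_pi_mul_I]
  ring

theorem theta_add_tau (τ z : ℂ) : theta τ (z + τ)
    = -(Complex.exp (-2 * Real.pi * Complex.I * z - Real.pi * Complex.I * τ) * theta τ z) := by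
  rw [theta_eq_jacobiTheta₂, theta_eq_jacobiTheta₂,
    show z + τ + 1 / 2 + τ / 2 = (z + 1 / 2 + τ / 2) + τ by ring, jacobiTheta₂_add_left',
    mul_neg, ← mul_assoc, ← mul_assoc, ← Complex.exp_add, ← Complex.exp_add, neg_neg,
    show Complex.I * Real.pi * τ / 4 + Real.pi * Complex.I * (z + τ + 1 / 2)
      + -Real.pi * Complex.I * (τ + 2 * (z + 1 / 2 + τ / 2))
      = (-2 * Real.pi * Complex.I * z - Real.pi * Complex.I * τ
      + (Complex.I * Real.pi * τ / 4 + Real.pi * Complex.I * (z + 1 / 2)))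
      - Real.pi * Complex.I by ring, Complex.exp_sub_pi_mul_I]
  ring

theorem theta_neg (τ z : ℂ) : theta τ (-z) = -theta τ z := by
  rw [theta_eq_jacobiTheta₂, theta_eq_jacobiTheta₂, ← jacobiTheta₂_neg_left,
    show -(-z + 1 / 2 + τ / 2) = z - 1 / 2 - τ / 2 by ring,
    show z + 1 / 2 + τ / 2 = (z - 1 / 2 - τ / 2 + τ) + 1 by ring, jacobiTheta₂_add_left,
    jacobiTheta₂_add_left', neg_neg, ← mul_assoc, ← Complex.exp_add,
    show Complex.I * Real.pi * τ / 4 + Real.pi * Complex.I * (z + 1 / 2)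
      + -Real.pi * Complex.I * (τ + 2 * (z - 1 / 2 - τ / 2))
      = (Complex.I * Real.pi * τ / 4 + Real.pi * Complex.I * (-z + 1 / 2)) + Real.pi * Complex.I
      by ring, Complex.exp_add _ (Real.pi * Complex.I), Complex.exp_pi_mul_I]
  ring

theorem theta_zero (τ : ℂ) : theta τ 0 = 0 := by
  have h := theta_neg τ 0
  rw [neg_zero] at h
  linear_combination h / 2

/-- Pairs of integers `(m, n)` according to the parity of `m + n`: writing
`m + n + 1 = 2 p`, `m - n = 2 q + 1` or `m + n + 1 = 2 p + 1`, `m - n = 2 q`. -/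
def parityEquiv : (ℤ × ℤ) ⊕ (ℤ × ℤ) ≃ ℤ × ℤ where
  toFun := Sum.elim (fun x => (x.1 + x.2, x.1 - x.2 - 1)) (fun x => (x.1 + x.2, x.1 - x.2))
  invFun x := if (x.1 + x.2) % 2 = 0 then Sum.inr ((x.1 + x.2) / 2, (x.1 - x.2) / 2)
    else Sum.inl ((x.1 + x.2 + 1) / 2, (x.1 - x.2 - 1) / 2)
  left_inv := by
    rintro (⟨p, q⟩ | ⟨p, q⟩)
    · have h : ¬ (p + q + (p - q - 1)) % 2 = 0 := by omega
      simp only [Sum.elim_inl, h, if_false, Sum.inl.injEq, Prod.mk.injEq]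
      omega
    · have h : (p + q + (p - q)) % 2 = 0 := by omega
      simp only [Sum.elim_inr, h, if_true, Sum.inr.injEq, Prod.mk.injEq]
      omega
  right_inv := by
    rintro ⟨m, n⟩
    by_cases h : (m + n) % 2 = 0
    · simp only [h, if_true, Sum.elim_inr, Prod.mk.injEq]
      omega
    · simp only [h, if_false, Sum.elim_inl, Prod.mk.injEq]
      omega

/-- The even theta function of level two. -/
noncomputable def thetaA (τ y : ℂ) : ℂ := jacobiTheta₂ (2 * y) (2 * τ)

/-- The even theta function of level two with half-integral summation; the exponential factor
shifts the summation index of `jacobiTheta₂` by `1 / 2`. -/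
noncomputable def thetaB (τ y : ℂ) : ℂ :=
  Complex.exp (Real.pi * Complex.I * τ / 2 + 2 * Real.pi * Complex.I * y)
    * jacobiTheta₂ (2 * y + τ) (2 * τ)

/-- The product `[x + y] [x - y]` is a `2 × 2` determinant in theta functions of level two: in the
double series, sum first over half the sum and half the difference of the two indices, one of
which is integral and the other half-integral. -/
theorem theta_add_mul_theta_sub {τ : ℂ} (hτ : 0 < τ.im) (x y : ℂ) :
    theta τ (x + y) * theta τ (x - y)
      = thetaA τ x * thetaB τ y - thetaB τ x * thetaA τ y := by
  have h2 : 0 < (2 * τ).im := by simpa using hτ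
  have hA : ∀ y, HasSum (fun n : ℤ => jacobiTheta₂_term n (2 * y) (2 * τ)) (thetaA τ y) :=
    fun y => hasSum_jacobiTheta₂_term _ h2
  have hB : ∀ y, HasSum (fun n : ℤ => Complex.exp (Real.pi * Complex.I * τ / 2
      + 2 * Real.pi * Complex.I * y) * jacobiTheta₂_term n (2 * y + τ) (2 * τ)) (thetaB τ y) :=
    fun y => (hasSum_jacobiTheta₂_term _ h2).mul_left _
  have hmul : ∀ {f g : ℤ → ℂ} {a b : ℂ}, HasSum f a → HasSum g b →
      HasSum (fun p : ℤ × ℤ => f p.1 * g p.2) (a * b) := fun hf hg =>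
    hf.mul hg (summable_mul_of_summable_norm hf.summable.norm hg.summable.norm)
  have h := hmul (hasSum_thetaTerm hτ (x + y)) (hasSum_thetaTerm hτ (x - y))
  rw [neg_mul_neg] at h
  refine (parityEquiv.hasSum_iff.mpr h).unique ?_
  rw [sub_eq_add_neg (thetaA τ x * thetaB τ y)]
  refine HasSum.sum (M := ℂ) ?_ ?_
  · convert hmul (hA x) (hB y) using 2 with p
    obtain ⟨p, q⟩ := p
    simp only [parityEquiv, Equiv.coe_fn_mk, Function.comp_apply, Sum.elim_inl, thetaTerm,
      jacobiTheta₂_term, ← Complex.exp_add]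
    -- the exponents agree up to a multiple of `2πi`
    rw [Complex.exp_eq_exp_iff_exists_int]
    refine ⟨p, ?_⟩
    push_cast
    ring
  · rw [← neg_one_mul, ← mul_assoc]
    convert hmul ((hB x).mul_left (-1)) (hA y) using 2 with p
    obtain ⟨p, q⟩ := p
    simp only [parityEquiv, Equiv.coe_fn_mk, Function.comp_apply, Sum.elim_inr, thetaTerm,
      jacobiTheta₂_term]
    rw [← Complex.exp_pi_mul_I]
    simp only [← Complex.exp_add]
    rw [Complex.exp_eq_exp_iff_exists_int]
    refine ⟨p, ?_⟩
    push_cast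
    ring

/-- The three-term identity, in a form without halves. By `theta_add_mul_theta_sub` each of its
products of two theta functions is a `2 × 2` minor of a `2 × 4` matrix, and the identity is the
Plücker relation. -/
theorem theta_three_term {τ : ℂ} (hτ : 0 < τ.im) (e p q r : ℂ) :
    theta τ p * theta τ (e + p) * (theta τ (q - r) * theta τ (e + q + r))
      + theta τ q * theta τ (e + q) * (theta τ (r - p) * theta τ (e + r + p))
      + theta τ r * theta τ (e + r) * (theta τ (p - q) * theta τ (e + p + q)) = 0 := by
  have h := theta_add_mul_theta_sub hτ
  have h1 : ∀ p, theta τ p * theta τ (e + p) = theta τ (e / 2 + p + e / 2)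
      * theta τ (e / 2 + p - e / 2) := fun p => by
    rw [mul_comm]; congr 2 <;> ring
  have h2 : ∀ q r, theta τ (q - r) * theta τ (e + q + r) = theta τ (e / 2 + q + (e / 2 + r))
      * theta τ (e / 2 + q - (e / 2 + r)) := fun q r => by
    rw [mul_comm]; congr 2 <;> ring
  simp only [h1, h2, h]
  ring

/-- `[y] ≠ 0` for `y` in a dense set, as soon as `[·]` does not vanish identically. -/
theorem dense_theta_ne_zero {τ : ℂ} (hτ : 0 < τ.im) {x : ℂ} (hx : theta τ x ≠ 0) :
    Dense {y | theta τ y ≠ 0} := by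
  have han : AnalyticOnNhd ℂ (theta τ) Set.univ :=
    (differentiable_theta hτ).differentiableOn.analyticOnNhd isOpen_univ
  rw [← interior_eq_empty_iff_dense_compl.trans (Iff.of_eq (congrArg Dense (Set.compl_ofPred _)))]
  rw [Set.eq_empty_iff_forall_notMem]
  intro y hy
  have hz : theta τ =ᶠ[nhds y] 0 := by
    filter_upwards [mem_interior_iff_mem_nhds.mp hy] with z hz using hz
  exact hx (han.eqOn_zero_of_preconnected_of_eventuallyEq_zero isPreconnected_univ
    (Set.mem_univ y) hz (Set.mem_univ x))

/-! ### Dynamical shifts and vertex weights -/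

/-- `λ + g μ_x`. -/
def stepDyn (g : ℂ) (lam : ℕ → ℂ) (x : ℕ) : ℕ → ℂ :=
  fun i => lam i + g * (if x = i then 1 else 0)

theorem shiftDyn_zero (g : ℂ) (lam : ℕ → ℂ) (t : ℕ → ℕ) : shiftDyn g lam t 0 = lam := by
  funext i; simp [shiftDyn]

theorem shiftDyn_succ (g : ℂ) (lam : ℕ → ℂ) (t : ℕ → ℕ) (n : ℕ) :
    shiftDyn g lam t (n + 1) = stepDyn g (shiftDyn g lam t n) (t (n + 1)) := by
  funext i
  have h : ({j ∈ Icc 1 (n + 1) | t j = i} : Finset ℕ)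
      = if t (n + 1) = i then insert (n + 1) {j ∈ Icc 1 n | t j = i}
        else {j ∈ Icc 1 n | t j = i} := by
    rw [← insert_Icc_right_eq_Icc_add_one (by omega), filter_insert]
  simp only [shiftDyn, stepDyn, h]
  split_ifs
  · rw [card_insert_of_notMem (by simp)]
    push_cast
    ring
  · ring

theorem stepDyn_comm (g h : ℂ) (lam : ℕ → ℂ) (x y : ℕ) :
    stepDyn g (stepDyn h lam x) y = stepDyn h (stepDyn g lam y) x := by
  funext i; simp only [stepDyn]; ring

theorem shiftDyn_congr (g : ℂ) (lam : ℕ → ℂ) {s t : ℕ → ℕ} {n : ℕ}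
    (h : ∀ j ∈ Icc 1 n, s j = t j) : shiftDyn g lam s n = shiftDyn g lam t n := by
  funext i
  simp only [shiftDyn]
  rw [filter_congr fun j hj => by rw [h j hj]]

theorem stepDyn_sub (g : ℂ) (lam : ℕ → ℂ) (x i j : ℕ) : stepDyn g lam x i - stepDyn g lam x j
    = lam i - lam j + g * ((if x = i then 1 else 0) - (if x = j then 1 else 0)) := by
  simp only [stepDyn]; ring

/-- The dynamical variables of the colours `1, …, N` are in general position with respect to the
step `γ`. -/
def IsGeneric (τ γ : ℂ) (N : ℕ) (lam : ℕ → ℂ) : Prop :=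
  ∀ i ∈ Icc 1 N, ∀ j ∈ Icc 1 N, i ≠ j → ∀ n : ℤ, theta τ (lam i - lam j + n * γ) ≠ 0

theorem IsGeneric.mono {τ γ : ℂ} {N N' : ℕ} {lam : ℕ → ℂ} (h : IsGeneric τ γ N lam)
    (hN : N' ≤ N) : IsGeneric τ γ N' lam := fun i hi j hj =>
  h i (Icc_subset_Icc_right hN hi) j (Icc_subset_Icc_right hN hj)

theorem IsGeneric.shiftDyn {τ γ : ℂ} {N : ℕ} {lam : ℕ → ℂ} (h : IsGeneric τ γ N lam)
    (m : ℤ) (t : ℕ → ℕ) (n : ℕ) : IsGeneric τ γ N (shiftDyn (m * γ) lam t n) := by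
  intro i hi j hj hij k
  convert h i hi j hj hij
    (k + m * (#{s ∈ Icc 1 n | t s = i} : ℤ) - m * (#{s ∈ Icc 1 n | t s = j} : ℤ)) using 2
  simp only [EllipticNested.shiftDyn]
  push_cast
  ring

theorem IsGeneric.shiftDyn_neg {τ γ : ℂ} {N : ℕ} {lam : ℕ → ℂ} (h : IsGeneric τ γ N lam)
    (t : ℕ → ℕ) (n : ℕ) : IsGeneric τ γ N (EllipticNested.shiftDyn (-γ) lam t n) := by
  simpa using h.shiftDyn (-1) t n

theorem IsGeneric.shiftDyn_pos {τ γ : ℂ} {N : ℕ} {lam : ℕ → ℂ} (h : IsGeneric τ γ N lam)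
    (t : ℕ → ℕ) (n : ℕ) : IsGeneric τ γ N (EllipticNested.shiftDyn γ lam t n) := by
  simpa using h.shiftDyn 1 t n

section
variable (τ γ : ℂ) (lam : ℕ → ℂ) (z w : ℂ)

theorem vertexWeight_self (a a' b' : ℕ) : vertexWeight τ γ lam z w a a a' b'
    = if a' = a ∧ b' = a then theta τ (z - w - γ) else 0 := by
  simp [vertexWeight]

theorem vertexWeight_of_ne {a b : ℕ} (h : a ≠ b) (a' b' : ℕ) :
    vertexWeight τ γ lam z w a b a' b'
      = (if a' = a ∧ b' = b then alphaWeight τ γ (z - w) (lam a - lam b) else 0)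
        + (if a' = b ∧ b' = a then betaWeight τ γ (z - w) (lam b - lam a) else 0) := by
  simp only [vertexWeight, h, if_false]
  split_ifs with h1 h2 h2
  · exact absurd (h1.1.symm.trans h2.1) h
  · simp
  · rw [h2.1]; simp
  · simp

variable {τ γ lam z w}

/-- The ice rule: the colours leaving a vertex are those entering it. -/
theorem vertexWeight_ne_zero {a b a' b' : ℕ} (h : vertexWeight τ γ lam z w a b a' b' ≠ 0) :
    (a' = a ∧ b' = b) ∨ (a' = b ∧ b' = a) := by
  by_contra hn
  rw [not_or] at hn
  apply h
  by_cases hab : a = b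
  · subst hab; simp [vertexWeight_self, hn.1]
  · simp [vertexWeight_of_ne _ _ _ _ _ hab, hn.1, hn.2]

theorem sum_vertexWeight_mul {N a b : ℕ} (ha : a ∈ Icc 1 N) (hb : b ∈ Icc 1 N)
    (f : ℕ → ℕ → ℂ) :
    ∑ x ∈ Icc 1 N, ∑ y ∈ Icc 1 N, vertexWeight τ γ lam z w a b x y * f x y
      = if a = b then theta τ (z - w - γ) * f a a
        else alphaWeight τ γ (z - w) (lam a - lam b) * f a b
          + betaWeight τ γ (z - w) (lam b - lam a) * f b a := by
  have key : ∀ (p q : ℕ) (A : ℂ), p ∈ Icc 1 N → q ∈ Icc 1 N →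
      ∑ x ∈ Icc 1 N, ∑ y ∈ Icc 1 N, (if x = p ∧ y = q then A else 0) * f x y = A * f p q := by
    intro p q A hp hq
    rw [sum_eq_single_of_mem p hp, sum_eq_single_of_mem q hq]
    · simp
    · intro y _ hy; simp [hy]
    · intro x _ hx; simp [hx]
  split_ifs with h
  · subst h
    simp only [vertexWeight_self]
    exact key a a _ ha ha
  · simp only [vertexWeight_of_ne _ _ _ _ _ h, add_mul, sum_add_distrib]
    rw [key a b _ ha hb, key b a _ hb ha]

theorem sum_vertexWeight_top {N a b : ℕ} (ha : a ∈ Icc 1 N) (hb : b ∈ Icc 1 N) (a' : ℕ)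
    (f : ℕ → ℂ) :
    ∑ y ∈ Icc 1 N, vertexWeight τ γ lam z w a b a' y * f y
      = if a = b then (if a' = a then theta τ (z - w - γ) * f a else 0)
        else (if a' = a then alphaWeight τ γ (z - w) (lam a - lam b) * f b else 0)
          + (if a' = b then betaWeight τ γ (z - w) (lam b - lam a) * f a else 0) := by
  have key : ∀ (p q : ℕ) (A : ℂ), q ∈ Icc 1 N →
      ∑ y ∈ Icc 1 N, (if a' = p ∧ y = q then A else 0) * f y
        = if a' = p then A * f q else 0 := by
    intro p q A hq
    rw [sum_eq_single_of_mem q hq]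
    · simp
    · intro y _ hy; simp [hy]
  by_cases h : a = b
  · subst h
    simp only [vertexWeight_self, key _ _ _ ha, if_true]
  · simp only [vertexWeight_of_ne _ _ _ _ _ h, add_mul, sum_add_distrib, key _ _ _ ha,
      key _ _ _ hb, h, if_false]

theorem sum_vertexWeight_right {N a b : ℕ} (ha : a ∈ Icc 1 N) (hb : b ∈ Icc 1 N) (b' : ℕ)
    (f : ℕ → ℂ) :
    ∑ x ∈ Icc 1 N, vertexWeight τ γ lam z w a b x b' * f x
      = if a = b then (if b' = a then theta τ (z - w - γ) * f a else 0)
        else (if b' = b then alphaWeight τ γ (z - w) (lam a - lam b) * f a else 0)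
          + (if b' = a then betaWeight τ γ (z - w) (lam b - lam a) * f b else 0) := by
  have key : ∀ (p q : ℕ) (A : ℂ), p ∈ Icc 1 N →
      ∑ x ∈ Icc 1 N, (if x = p ∧ b' = q then A else 0) * f x
        = if b' = q then A * f p else 0 := by
    intro p q A hp
    rw [sum_eq_single_of_mem p hp]
    · simp
    · intro y _ hy; simp [hy]
  by_cases h : a = b
  · subst h
    simp only [vertexWeight_self, key _ _ _ ha, if_true]
  · simp only [vertexWeight_of_ne _ _ _ _ _ h, add_mul, sum_add_distrib, key _ _ _ ha,
      key _ _ _ hb, h, if_false]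

end

/-! ### The dynamical Yang–Baxter equation

The nontrivial matrix elements come first. The two words in the name of a lemma are the colours of
the three lines before and after the crossings; `u` and `v` are the differences of the spectral
parameters, `X` is the difference of the dynamical variables of the two colours (in one of the two
orders), and `P`, `Q` are the successive differences of those of the colours after the crossings.
Each lemma is one three-term identity, or a combination of two of them, after the common
denominators are cleared. -/

/-- `theta_three_term` with the twelve arguments as variables, so that they can be matched with the
arguments occurring in an expression. -/
theorem theta_three_term_of {τ : ℂ} (hτ : 0 < τ.im) (e p q r : ℂ)
    {p₁ p₂ p₃ p₄ q₁ q₂ q₃ q₄ r₁ r₂ r₃ r₄ : ℂ}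
    (hp₁ : p = p₁) (hp₂ : e + p = p₂) (hp₃ : q - r = p₃) (hp₄ : e + q + r = p₄)
    (hq₁ : q = q₁) (hq₂ : e + q = q₂) (hq₃ : r - p = q₃) (hq₄ : e + r + p = q₄)
    (hr₁ : r = r₁) (hr₂ : e + r = r₂) (hr₃ : p - q = r₃) (hr₄ : e + p + q = r₄) :
    theta τ p₁ * theta τ p₂ * (theta τ p₃ * theta τ p₄)
      + theta τ q₁ * theta τ q₂ * (theta τ q₃ * theta τ q₄)
      + theta τ r₁ * theta τ r₂ * (theta τ r₃ * theta τ r₄) = 0 := by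
  rw [← hp₁, ← hp₂, ← hp₃, ← hp₄, ← hq₁, ← hq₂, ← hq₃, ← hq₄, ← hr₁, ← hr₂, ← hr₃, ← hr₄]
  exact theta_three_term hτ e p q r

theorem alphaWeight_neg (τ γ z l : ℂ) :
    alphaWeight τ γ z (-l) = theta τ z * theta τ (l - γ) / theta τ l := by
  rw [alphaWeight, theta_neg, show -l + γ = -(l - γ) by ring, theta_neg, mul_neg, neg_div_neg_eq]

theorem betaWeight_neg (τ γ z l : ℂ) :
    betaWeight τ γ z (-l) = theta τ (z - l) * theta τ γ / theta τ l := by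
  rw [betaWeight, theta_neg, ← sub_eq_add_neg, div_neg, neg_neg]

theorem yangBaxter_aab_aba {τ : ℂ} (hτ : 0 < τ.im) {γ X : ℂ}
    (h : ∀ n : ℤ, theta τ (X + n * γ) ≠ 0) (u v : ℂ) :
    theta τ (u - γ) * (alphaWeight τ γ (u + v) (X + -γ) * betaWeight τ γ v (-X))
      = alphaWeight τ γ v (X + -γ) * (betaWeight τ γ (u + v) (-X) * betaWeight τ γ u (X + -γ))
        + betaWeight τ γ v (-X + γ) * (theta τ (u + v - γ) * alphaWeight τ γ u (X + -γ)) := by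
  have h0 : theta τ X ≠ 0 := by simpa using h 0
  have hm : theta τ (X - γ) ≠ 0 := by simpa [sub_eq_add_neg] using h (-1)
  have w1 : alphaWeight τ γ (u + v) (X + -γ) = theta τ (u + v) * theta τ X / theta τ (X - γ) := by
    rw [alphaWeight]; ring_nf
  have w2 : betaWeight τ γ v (-X) = theta τ (v - X) * theta τ γ / theta τ X :=
    betaWeight_neg τ γ v X
  have w3 : alphaWeight τ γ v (X + -γ) = theta τ v * theta τ X / theta τ (X - γ) := by
    rw [alphaWeight]; ring_nf
  have w4 : betaWeight τ γ (u + v) (-X) = theta τ (u + v - X) * theta τ γ / theta τ X :=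
    betaWeight_neg τ γ (u + v) X
  have w5 : betaWeight τ γ u (X + -γ) = -(theta τ (u + X - γ) * theta τ γ / theta τ (X - γ)) := by
    rw [betaWeight]; ring_nf
  have w6 : betaWeight τ γ v (-X + γ) = theta τ (v - X + γ) * theta τ γ / theta τ (X - γ) := by
    rw [show -X + γ = -(X - γ) by ring, betaWeight_neg]; ring_nf
  have w7 : alphaWeight τ γ u (X + -γ) = theta τ u * theta τ X / theta τ (X - γ) := by
    rw [alphaWeight]; ring_nf
  have t0 : theta τ (u - γ) * theta τ (u + v)
      * (theta τ (X - γ) * theta τ (v - X)) + theta τ (-γ) * theta τ v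
      * (theta τ (-(u + X - γ)) * theta τ (u + v - X)) + theta τ (-X) * theta τ (v - X + γ)
      * (theta τ u * theta τ (u + v - γ)) = 0 := by
    apply theta_three_term_of hτ (v + γ) (u - γ) (-γ) (-X) <;> ring
  simp only [theta_neg] at t0
  rw [w1, w2, w3, w4, w5, w6, w7]
  field_simp
  linear_combination theta τ γ * t0

theorem yangBaxter_aab_baa {τ : ℂ} (hτ : 0 < τ.im) {γ X : ℂ}
    (h : ∀ n : ℤ, theta τ (X + n * γ) ≠ 0) (u v : ℂ) :
    theta τ (u - γ) * (betaWeight τ γ (u + v) (-X + γ) * theta τ (v - γ))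
      = alphaWeight τ γ v (X + -γ) * (betaWeight τ γ (u + v) (-X) * alphaWeight τ γ u (-X + γ))
        + betaWeight τ γ v (-X + γ) * (theta τ (u + v - γ) * betaWeight τ γ u (-X + γ)) := by
  have h0 : theta τ X ≠ 0 := by simpa using h 0
  have hm : theta τ (X - γ) ≠ 0 := by simpa [sub_eq_add_neg] using h (-1)
  have w1 : betaWeight τ γ (u + v) (-X + γ)
      = theta τ (u + v - X + γ) * theta τ γ / theta τ (X - γ) := by
    rw [show -X + γ = -(X - γ) by ring, betaWeight_neg]; ring_nf
  have w2 : alphaWeight τ γ v (X + -γ) = theta τ v * theta τ X / theta τ (X - γ) := by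
    rw [alphaWeight]; ring_nf
  have w3 : betaWeight τ γ (u + v) (-X) = theta τ (u + v - X) * theta τ γ / theta τ X :=
    betaWeight_neg τ γ (u + v) X
  have w4 : alphaWeight τ γ u (-X + γ) = theta τ u * theta τ (X - γ * 2) / theta τ (X - γ) := by
    rw [show -X + γ = -(X - γ) by ring, alphaWeight_neg]; ring_nf
  have w5 : betaWeight τ γ v (-X + γ) = theta τ (v - X + γ) * theta τ γ / theta τ (X - γ) := by
    rw [show -X + γ = -(X - γ) by ring, betaWeight_neg]; ring_nf
  have w6 : betaWeight τ γ u (-X + γ) = theta τ (u - X + γ) * theta τ γ / theta τ (X - γ) := by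
    rw [show -X + γ = -(X - γ) by ring, betaWeight_neg]; ring_nf
  have t0 : theta τ (u - γ) * theta τ (v - γ)
      * (theta τ (X - γ) * theta τ (u + v - X + γ)) + theta τ u * theta τ v
      * (theta τ (-(X - γ * 2)) * theta τ (u + v - X)) + theta τ (u - X + γ) * theta τ (v - X + γ)
      * (theta τ (-γ) * theta τ (u + v - γ)) = 0 := by
    apply theta_three_term_of hτ (v - u) (u - γ) u (u - X + γ) <;> ring
  simp only [theta_neg] at t0
  rw [w1, w2, w3, w4, w5, w6]
  field_simp
  linear_combination theta τ γ * t0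

theorem yangBaxter_aba_aab {τ : ℂ} (hτ : 0 < τ.im) {γ X : ℂ}
    (h : ∀ n : ℤ, theta τ (X + n * γ) ≠ 0) (u v : ℂ) :
    alphaWeight τ γ u X * (theta τ (u + v - γ) * betaWeight τ γ v X)
        + betaWeight τ γ u (-X) * (betaWeight τ γ (u + v) (X + -γ) * alphaWeight τ γ v X)
      = betaWeight τ γ v (X + -γ) * (alphaWeight τ γ (u + v) X * theta τ (u - γ)) := by
  have h0 : theta τ X ≠ 0 := by simpa using h 0
  have hm : theta τ (X - γ) ≠ 0 := by simpa [sub_eq_add_neg] using h (-1)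
  have w1 : alphaWeight τ γ u X = theta τ u * theta τ (X + γ) / theta τ X := rfl
  have w2 : betaWeight τ γ v X = -(theta τ (v + X) * theta τ γ / theta τ X) := rfl
  have w3 : betaWeight τ γ u (-X) = theta τ (u - X) * theta τ γ / theta τ X :=
    betaWeight_neg τ γ u X
  have w4 : betaWeight τ γ (u + v) (X + -γ)
      = -(theta τ (u + v + X - γ) * theta τ γ / theta τ (X - γ)) := by
    rw [betaWeight]; ring_nf
  have w5 : alphaWeight τ γ v X = theta τ v * theta τ (X + γ) / theta τ X := rfl
  have w6 : betaWeight τ γ v (X + -γ) = -(theta τ (v + X - γ) * theta τ γ / theta τ (X - γ)) := by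
    rw [betaWeight]; ring_nf
  have w7 : alphaWeight τ γ (u + v) X = theta τ (u + v) * theta τ (X + γ) / theta τ X := rfl
  have t0 : theta τ u * theta τ (u + v - γ)
      * (theta τ (X - γ) * theta τ (v + X)) + theta τ X * theta τ (v + X - γ)
      * (theta τ (-(u - γ)) * theta τ (u + v)) + theta τ γ * theta τ v
      * (theta τ (u - X) * theta τ (u + v + X - γ)) = 0 := by
    apply theta_three_term_of hτ (v - γ) u X γ <;> ring
  simp only [theta_neg] at t0
  rw [w1, w2, w3, w4, w5, w6, w7]
  field_simp
  linear_combination -(theta τ (X + γ) * theta τ γ) * t0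

theorem yangBaxter_aba_aba {τ : ℂ} (hτ : 0 < τ.im) {γ X : ℂ}
    (h : ∀ n : ℤ, theta τ (X + n * γ) ≠ 0) (u v : ℂ) :
    alphaWeight τ γ u (-X) * (theta τ (u + v - γ) * alphaWeight τ γ v X)
        + betaWeight τ γ u X * (betaWeight τ γ (u + v) (-X + -γ) * betaWeight τ γ v X)
      = alphaWeight τ γ v (X + γ) * (theta τ (u + v - γ) * alphaWeight τ γ u (-X + -γ))
        + betaWeight τ γ v (-X + -γ) * (betaWeight τ γ (u + v) X * betaWeight τ γ u (-X + -γ)) := by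
  have h0 : theta τ X ≠ 0 := by simpa using h 0
  have hp : theta τ (X + γ) ≠ 0 := by simpa using h 1
  have w1 : alphaWeight τ γ u (-X) = theta τ u * theta τ (X - γ) / theta τ X :=
    alphaWeight_neg τ γ u X
  have w2 : alphaWeight τ γ v X = theta τ v * theta τ (X + γ) / theta τ X := rfl
  have w3 : betaWeight τ γ u X = -(theta τ (u + X) * theta τ γ / theta τ X) := rfl
  have w4 : betaWeight τ γ (u + v) (-X + -γ)
      = theta τ (u + v - X - γ) * theta τ γ / theta τ (X + γ) := by
    rw [show -X + -γ = -(X + γ) by ring, betaWeight_neg]; ring_nf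
  have w5 : betaWeight τ γ v X = -(theta τ (v + X) * theta τ γ / theta τ X) := rfl
  have w6 : alphaWeight τ γ v (X + γ) = theta τ v * theta τ (X + γ * 2) / theta τ (X + γ) := by
    rw [alphaWeight]; ring_nf
  have w7 : alphaWeight τ γ u (-X + -γ) = theta τ u * theta τ X / theta τ (X + γ) := by
    rw [show -X + -γ = -(X + γ) by ring, alphaWeight_neg]; ring_nf
  have w8 : betaWeight τ γ v (-X + -γ) = theta τ (v - X - γ) * theta τ γ / theta τ (X + γ) := by
    rw [show -X + -γ = -(X + γ) by ring, betaWeight_neg]; ring_nf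
  have w9 : betaWeight τ γ (u + v) X = -(theta τ (u + v + X) * theta τ γ / theta τ X) := rfl
  have w10 : betaWeight τ γ u (-X + -γ) = theta τ (u - X - γ) * theta τ γ / theta τ (X + γ) := by
    rw [show -X + -γ = -(X + γ) by ring, betaWeight_neg]; ring_nf
  have t0 : theta τ (X + γ) * theta τ (X + γ)
      * (theta τ (X - γ) * theta τ (X + γ)) + theta τ X * theta τ X
      * (theta τ (-X) * theta τ (X + γ * 2)) + theta τ γ * theta τ γ
      * (theta τ γ * theta τ (2 * X + γ)) = 0 := by
    apply theta_three_term_of hτ 0 (X + γ) X γ <;> ring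
  simp only [theta_neg] at t0
  have t1 : theta τ u * theta τ v
      * (theta τ (2 * X + γ) * theta τ (u + v - γ)) + theta τ (u + X) * theta τ (v + X)
      * (theta τ (-(X + γ)) * theta τ (u + v - X - γ)) + theta τ (u - X - γ) * theta τ (v - X - γ)
      * (theta τ (-X) * theta τ (u + v + X)) = 0 := by
    apply theta_three_term_of hτ (v - u) u (u + X) (u - X - γ) <;> ring
  simp only [theta_neg] at t1
  rw [w1, w2, w3, w4, w5, w6, w7, w8, w9, w10]
  field_simp
  linear_combination theta τ u * theta τ v * theta τ (u + v - γ) * t0 - theta τ γ ^ 3 * t1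

theorem yangBaxter_aba_baa {τ : ℂ} (hτ : 0 < τ.im) {γ X : ℂ}
    (h : ∀ n : ℤ, theta τ (X + n * γ) ≠ 0) (u v : ℂ) :
    betaWeight τ γ u X * (alphaWeight τ γ (u + v) (X + γ) * theta τ (v - γ))
      = alphaWeight τ γ v (X + γ) * (theta τ (u + v - γ) * betaWeight τ γ u (X + γ))
        + betaWeight τ γ v (-X + -γ) * (betaWeight τ γ (u + v) X * alphaWeight τ γ u (X + γ)) := by
  have h0 : theta τ X ≠ 0 := by simpa using h 0
  have hp : theta τ (X + γ) ≠ 0 := by simpa using h 1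
  have w1 : betaWeight τ γ u X = -(theta τ (u + X) * theta τ γ / theta τ X) := rfl
  have w2 : alphaWeight τ γ (u + v) (X + γ)
      = theta τ (u + v) * theta τ (X + γ * 2) / theta τ (X + γ) := by
    rw [alphaWeight]; ring_nf
  have w3 : alphaWeight τ γ v (X + γ) = theta τ v * theta τ (X + γ * 2) / theta τ (X + γ) := by
    rw [alphaWeight]; ring_nf
  have w4 : betaWeight τ γ u (X + γ) = -(theta τ (u + X + γ) * theta τ γ / theta τ (X + γ)) := by
    rw [betaWeight]; ring_nf
  have w5 : betaWeight τ γ v (-X + -γ) = theta τ (v - X - γ) * theta τ γ / theta τ (X + γ) := by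
    rw [show -X + -γ = -(X + γ) by ring, betaWeight_neg]; ring_nf
  have w6 : betaWeight τ γ (u + v) X = -(theta τ (u + v + X) * theta τ γ / theta τ X) := rfl
  have w7 : alphaWeight τ γ u (X + γ) = theta τ u * theta τ (X + γ * 2) / theta τ (X + γ) := by
    rw [alphaWeight]; ring_nf
  have t0 : theta τ (v - γ) * theta τ (u + v)
      * (theta τ (X + γ) * theta τ (u + X)) + theta τ X * theta τ (u + X + γ)
      * (theta τ (-v) * theta τ (u + v - γ)) + theta τ (-γ) * theta τ u
      * (theta τ (v - X - γ) * theta τ (u + v + X)) = 0 := by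
    apply theta_three_term_of hτ (u + γ) (v - γ) X (-γ) <;> ring
  simp only [theta_neg] at t0
  rw [w1, w2, w3, w4, w5, w6, w7]
  field_simp
  linear_combination -(theta τ γ * theta τ (X + γ * 2)) * t0

theorem yangBaxter_baa_aab {τ : ℂ} (hτ : 0 < τ.im) {γ X : ℂ}
    (h : ∀ n : ℤ, theta τ (X + n * γ) ≠ 0) (u v : ℂ) :
    alphaWeight τ γ u (-X) * (betaWeight τ γ (u + v) (X + -γ) * alphaWeight τ γ v X)
        + betaWeight τ γ u X * (theta τ (u + v - γ) * betaWeight τ γ v X)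
      = theta τ (v - γ) * (betaWeight τ γ (u + v) X * theta τ (u - γ)) := by
  have h0 : theta τ X ≠ 0 := by simpa using h 0
  have hm : theta τ (X - γ) ≠ 0 := by simpa [sub_eq_add_neg] using h (-1)
  have w1 : alphaWeight τ γ u (-X) = theta τ u * theta τ (X - γ) / theta τ X :=
    alphaWeight_neg τ γ u X
  have w2 : betaWeight τ γ (u + v) (X + -γ)
      = -(theta τ (u + v + X - γ) * theta τ γ / theta τ (X - γ)) := by
    rw [betaWeight]; ring_nf
  have w3 : alphaWeight τ γ v X = theta τ v * theta τ (X + γ) / theta τ X := rfl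
  have w4 : betaWeight τ γ u X = -(theta τ (u + X) * theta τ γ / theta τ X) := rfl
  have w5 : betaWeight τ γ v X = -(theta τ (v + X) * theta τ γ / theta τ X) := rfl
  have w6 : betaWeight τ γ (u + v) X = -(theta τ (u + v + X) * theta τ γ / theta τ X) := rfl
  have t0 : theta τ u * theta τ v
      * (theta τ (X + γ) * theta τ (u + v + X - γ)) + theta τ (u + X) * theta τ (v + X)
      * (theta τ (-γ) * theta τ (u + v - γ)) + theta τ (u - γ) * theta τ (v - γ)
      * (theta τ (-X) * theta τ (u + v + X)) = 0 := by
    apply theta_three_term_of hτ (v - u) u (u + X) (u - γ) <;> ring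
  simp only [theta_neg] at t0
  rw [w1, w2, w3, w4, w5, w6]
  field_simp
  linear_combination -theta τ γ * t0

theorem yangBaxter_baa_aba {τ : ℂ} (hτ : 0 < τ.im) {γ X : ℂ}
    (h : ∀ n : ℤ, theta τ (X + n * γ) ≠ 0) (u v : ℂ) :
    alphaWeight τ γ u X * (betaWeight τ γ (u + v) (-X + -γ) * betaWeight τ γ v X)
        + betaWeight τ γ u (-X) * (theta τ (u + v - γ) * alphaWeight τ γ v X)
      = theta τ (v - γ) * (alphaWeight τ γ (u + v) X * betaWeight τ γ u (-X + -γ)) := by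
  have h0 : theta τ X ≠ 0 := by simpa using h 0
  have hp : theta τ (X + γ) ≠ 0 := by simpa using h 1
  have w1 : alphaWeight τ γ u X = theta τ u * theta τ (X + γ) / theta τ X := rfl
  have w2 : betaWeight τ γ (u + v) (-X + -γ)
      = theta τ (u + v - X - γ) * theta τ γ / theta τ (X + γ) := by
    rw [show -X + -γ = -(X + γ) by ring, betaWeight_neg]; ring_nf
  have w3 : betaWeight τ γ v X = -(theta τ (v + X) * theta τ γ / theta τ X) := rfl
  have w4 : betaWeight τ γ u (-X) = theta τ (u - X) * theta τ γ / theta τ X :=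
    betaWeight_neg τ γ u X
  have w5 : alphaWeight τ γ v X = theta τ v * theta τ (X + γ) / theta τ X := rfl
  have w6 : alphaWeight τ γ (u + v) X = theta τ (u + v) * theta τ (X + γ) / theta τ X := rfl
  have w7 : betaWeight τ γ u (-X + -γ) = theta τ (u - X - γ) * theta τ γ / theta τ (X + γ) := by
    rw [show -X + -γ = -(X + γ) by ring, betaWeight_neg]; ring_nf
  have t0 : theta τ v * theta τ (u + v - γ)
      * (theta τ (X + γ) * theta τ (u - X)) + theta τ γ * theta τ u
      * (theta τ (-(v + X)) * theta τ (u + v - X - γ)) + theta τ (-X) * theta τ (u - X - γ)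
      * (theta τ (v - γ) * theta τ (u + v)) = 0 := by
    apply theta_three_term_of hτ (u - γ) v γ (-X) <;> ring
  simp only [theta_neg] at t0
  rw [w1, w2, w3, w4, w5, w6, w7]
  field_simp
  linear_combination theta τ γ * t0

theorem yangBaxter_abc_bca {τ : ℂ} (hτ : 0 < τ.im) {γ P Q : ℂ}
    (hP : theta τ P ≠ 0) (hQ : theta τ Q ≠ 0)
    (hPQ : theta τ (P + Q) ≠ 0) (u v : ℂ) :
    betaWeight τ γ u (P + Q) * (alphaWeight τ γ (u + v) P * betaWeight τ γ v Q)
      = alphaWeight τ γ v P * (betaWeight τ γ (u + v) Q * betaWeight τ γ u P)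
        + betaWeight τ γ v (-P) * (betaWeight τ γ (u + v) (P + Q) * alphaWeight τ γ u P) := by
  have w1 : betaWeight τ γ u (P + Q) = -(theta τ (u + P + Q) * theta τ γ / theta τ (P + Q)) := by
    rw [betaWeight]; ring_nf
  have w2 : alphaWeight τ γ (u + v) P = theta τ (u + v) * theta τ (P + γ) / theta τ P := rfl
  have w3 : betaWeight τ γ v Q = -(theta τ (v + Q) * theta τ γ / theta τ Q) := rfl
  have w4 : alphaWeight τ γ v P = theta τ v * theta τ (P + γ) / theta τ P := rfl
  have w5 : betaWeight τ γ (u + v) Q = -(theta τ (u + v + Q) * theta τ γ / theta τ Q) := rfl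
  have w6 : betaWeight τ γ u P = -(theta τ (u + P) * theta τ γ / theta τ P) := rfl
  have w7 : betaWeight τ γ v (-P) = theta τ (v - P) * theta τ γ / theta τ P :=
    betaWeight_neg τ γ v P
  have w8 : betaWeight τ γ (u + v) (P + Q)
      = -(theta τ (u + v + P + Q) * theta τ γ / theta τ (P + Q)) := by
    rw [betaWeight]; ring_nf
  have w9 : alphaWeight τ γ u P = theta τ u * theta τ (P + γ) / theta τ P := rfl
  have t0 : theta τ P * theta τ (u + P + Q)
      * (theta τ (u + v) * theta τ (v + Q)) + theta τ v * theta τ (u + v + Q)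
      * (theta τ (-(u + P)) * theta τ (P + Q)) + theta τ (-u) * theta τ Q
      * (theta τ (-(v - P)) * theta τ (u + v + P + Q)) = 0 := by
    apply theta_three_term_of hτ (u + Q) P v (-u) <;> ring
  simp only [theta_neg] at t0
  rw [w1, w2, w3, w4, w5, w6, w7, w8, w9]
  field_simp
  linear_combination theta τ γ ^ 2 * theta τ (P + γ) * t0

theorem yangBaxter_abc_cab {τ : ℂ} (hτ : 0 < τ.im) {γ P Q : ℂ}
    (hP : theta τ P ≠ 0) (hQ : theta τ Q ≠ 0)
    (hPQ : theta τ (P + Q) ≠ 0) (u v : ℂ) :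
    alphaWeight τ γ u Q * (betaWeight τ γ (u + v) P * betaWeight τ γ v Q)
        + betaWeight τ γ u (-Q) * (betaWeight τ γ (u + v) (P + Q) * alphaWeight τ γ v Q)
      = betaWeight τ γ v (P + Q) * (alphaWeight τ γ (u + v) Q * betaWeight τ γ u P) := by
  have w1 : alphaWeight τ γ u Q = theta τ u * theta τ (Q + γ) / theta τ Q := rfl
  have w2 : betaWeight τ γ (u + v) P = -(theta τ (u + v + P) * theta τ γ / theta τ P) := rfl
  have w3 : betaWeight τ γ v Q = -(theta τ (v + Q) * theta τ γ / theta τ Q) := rfl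
  have w4 : betaWeight τ γ u (-Q) = theta τ (u - Q) * theta τ γ / theta τ Q :=
    betaWeight_neg τ γ u Q
  have w5 : betaWeight τ γ (u + v) (P + Q)
      = -(theta τ (u + v + P + Q) * theta τ γ / theta τ (P + Q)) := by
    rw [betaWeight]; ring_nf
  have w6 : alphaWeight τ γ v Q = theta τ v * theta τ (Q + γ) / theta τ Q := rfl
  have w7 : betaWeight τ γ v (P + Q) = -(theta τ (v + P + Q) * theta τ γ / theta τ (P + Q)) := by
    rw [betaWeight]; ring_nf
  have w8 : alphaWeight τ γ (u + v) Q = theta τ (u + v) * theta τ (Q + γ) / theta τ Q := rfl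
  have w9 : betaWeight τ γ u P = -(theta τ (u + P) * theta τ γ / theta τ P) := rfl
  have t0 : theta τ u * theta τ (u + v + P)
      * (theta τ (P + Q) * theta τ (v + Q)) + theta τ Q * theta τ (v + P + Q)
      * (theta τ (-(u + P)) * theta τ (u + v)) + theta τ (-P) * theta τ v
      * (theta τ (u - Q) * theta τ (u + v + P + Q)) = 0 := by
    apply theta_three_term_of hτ (v + P) u Q (-P) <;> ring
  simp only [theta_neg] at t0
  rw [w1, w2, w3, w4, w5, w6, w7, w8, w9]
  field_simp
  linear_combination theta τ γ ^ 2 * theta τ (Q + γ) * t0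

theorem yangBaxter_abc_cba {τ : ℂ} (hτ : 0 < τ.im) {γ P Q : ℂ}
    (hP : theta τ P ≠ 0) (hQ : theta τ Q ≠ 0)
    (hPQ : theta τ (P + Q) ≠ 0) (u v : ℂ) :
    alphaWeight τ γ u (-Q) * (betaWeight τ γ (u + v) (P + Q) * alphaWeight τ γ v Q)
        + betaWeight τ γ u Q * (betaWeight τ γ (u + v) P * betaWeight τ γ v Q)
      = alphaWeight τ γ v (-P) * (betaWeight τ γ (u + v) (P + Q) * alphaWeight τ γ u P)
        + betaWeight τ γ v P * (betaWeight τ γ (u + v) Q * betaWeight τ γ u P) := by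
  have w1 : alphaWeight τ γ u (-Q) = theta τ u * theta τ (Q - γ) / theta τ Q :=
    alphaWeight_neg τ γ u Q
  have w2 : betaWeight τ γ (u + v) (P + Q)
      = -(theta τ (u + v + P + Q) * theta τ γ / theta τ (P + Q)) := by
    rw [betaWeight]; ring_nf
  have w3 : alphaWeight τ γ v Q = theta τ v * theta τ (Q + γ) / theta τ Q := rfl
  have w4 : betaWeight τ γ u Q = -(theta τ (u + Q) * theta τ γ / theta τ Q) := rfl
  have w5 : betaWeight τ γ (u + v) P = -(theta τ (u + v + P) * theta τ γ / theta τ P) := rfl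
  have w6 : betaWeight τ γ v Q = -(theta τ (v + Q) * theta τ γ / theta τ Q) := rfl
  have w7 : alphaWeight τ γ v (-P) = theta τ v * theta τ (P - γ) / theta τ P :=
    alphaWeight_neg τ γ v P
  have w8 : alphaWeight τ γ u P = theta τ u * theta τ (P + γ) / theta τ P := rfl
  have w9 : betaWeight τ γ v P = -(theta τ (v + P) * theta τ γ / theta τ P) := rfl
  have w10 : betaWeight τ γ (u + v) Q = -(theta τ (u + v + Q) * theta τ γ / theta τ Q) := rfl
  have w11 : betaWeight τ γ u P = -(theta τ (u + P) * theta τ γ / theta τ P) := rfl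
  have t0 : theta τ P * theta τ P
      * (theta τ (Q - γ) * theta τ (Q + γ)) + theta τ Q * theta τ Q
      * (theta τ (-(P - γ)) * theta τ (P + γ)) + theta τ γ * theta τ γ
      * (theta τ (P - Q) * theta τ (P + Q)) = 0 := by
    apply theta_three_term_of hτ 0 P Q γ <;> ring
  simp only [theta_neg] at t0
  have t1 : theta τ u * theta τ v
      * (theta τ (P - Q) * theta τ (u + v + P + Q)) + theta τ (u + P) * theta τ (v + P)
      * (theta τ Q * theta τ (u + v + Q)) + theta τ (u + Q) * theta τ (v + Q)
      * (theta τ (-P) * theta τ (u + v + P)) = 0 := by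
    apply theta_three_term_of hτ (v - u) u (u + P) (u + Q) <;> ring
  simp only [theta_neg] at t1
  rw [w1, w2, w3, w4, w5, w6, w7, w8, w9, w10, w11]
  field_simp
  linear_combination -theta τ γ * (theta τ u * theta τ v * theta τ (u + v + P + Q) * t0
    - theta τ γ ^ 2 * theta τ (P + Q) * t1)

/-- The dynamical Yang–Baxter equation in components: three lines with incoming colours `a₁`, `a₂`,
`a₃` and outgoing colours `c₁`, `c₂`, `c₃`. By the ice rule the outgoing colours are a permutation of
the incoming ones, and the cases are distinguished by the coincidences among the latter. -/
theorem yang_baxter {τ γ : ℂ} (hτ : 0 < τ.im) {N : ℕ} {lam : ℕ → ℂ} (hlam : IsGeneric τ γ N lam)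
    (u₁ u₂ u₃ : ℂ) {a₁ a₂ a₃ : ℕ} (h₁ : a₁ ∈ Icc 1 N) (h₂ : a₂ ∈ Icc 1 N) (h₃ : a₃ ∈ Icc 1 N)
    (c₁ c₂ c₃ : ℕ) :
    ∑ x ∈ Icc 1 N, ∑ y ∈ Icc 1 N, vertexWeight τ γ lam u₁ u₂ a₁ a₂ x y *
        ∑ s ∈ Icc 1 N, vertexWeight τ γ (stepDyn (-γ) lam y) u₁ u₃ x a₃ c₁ s *
          vertexWeight τ γ lam u₂ u₃ y s c₂ c₃
      = ∑ y ∈ Icc 1 N, ∑ s ∈ Icc 1 N,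
          vertexWeight τ γ (stepDyn (-γ) lam a₁) u₂ u₃ a₂ a₃ y s *
        ∑ x ∈ Icc 1 N, vertexWeight τ γ lam u₁ u₃ a₁ s x c₃ *
          vertexWeight τ γ (stepDyn (-γ) lam c₃) u₁ u₂ x y c₁ c₂ := by
  rw [sum_vertexWeight_mul h₁ h₂, sum_vertexWeight_mul h₂ h₃]
  simp only [sum_vertexWeight_top h₁ h₃, sum_vertexWeight_top h₂ h₃,
    sum_vertexWeight_right h₁ h₂, sum_vertexWeight_right h₁ h₃]
  rw [show u₁ - u₃ = (u₁ - u₂) + (u₂ - u₃) by ring]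
  generalize hu : u₁ - u₂ = u
  generalize hv : u₂ - u₃ = v
  have hcase : ∀ c, c = a₁ ∨ c = a₂ ∨ c = a₃ ∨ (c ≠ a₁ ∧ c ≠ a₂ ∧ c ≠ a₃) := by tauto
  by_cases h12 : a₁ = a₂
  · subst h12
    by_cases h13 : a₁ = a₃
    · subst h13
      by_cases e1 : c₁ = a₁ <;> by_cases e2 : c₂ = a₁ <;> by_cases e3 : c₃ = a₁ <;>
        simp [vertexWeight_self, *]
      ring
    · have h31 := Ne.symm h13
      have hX := hlam a₁ h₁ a₃ h₃ h13
      rcases hcase c₁ with rfl | rfl | rfl | ⟨e1, e2, e3⟩ <;>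
      rcases hcase c₂ with rfl | rfl | rfl | ⟨f1, f2, f3⟩ <;>
      rcases hcase c₃ with rfl | rfl | rfl | ⟨g1, g2, g3⟩
      all_goals (try simp [vertexWeight_self, vertexWeight_of_ne, stepDyn_sub, *])
      all_goals first
        | (simp only [alphaWeight]; ring1)
        | simpa only [neg_sub] using yangBaxter_aab_aba hτ hX u v
        | simpa only [neg_sub] using yangBaxter_aab_baa hτ hX u v
  · have h21 := Ne.symm h12
    by_cases h13 : a₁ = a₃
    · subst h13
      have hX := hlam a₁ h₁ a₂ h₂ h12
      have hY := hlam a₂ h₂ a₁ h₁ h21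
      rcases hcase c₁ with rfl | rfl | rfl | ⟨e1, e2, e3⟩ <;>
      rcases hcase c₂ with rfl | rfl | rfl | ⟨f1, f2, f3⟩ <;>
      rcases hcase c₃ with rfl | rfl | rfl | ⟨g1, g2, g3⟩
      all_goals (try simp [vertexWeight_self, vertexWeight_of_ne, stepDyn_sub, *])
      all_goals first
        | simpa only [neg_sub] using yangBaxter_aba_aab hτ hX u v
        | simpa only [neg_sub] using yangBaxter_aba_aba hτ hY u v
        | simpa only [neg_sub] using yangBaxter_aba_baa hτ hY u v
    · by_cases h23 : a₂ = a₃
      · subst h23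
        have hX := hlam a₁ h₁ a₂ h₂ h12
        have hY := hlam a₂ h₂ a₁ h₁ h21
        rcases hcase c₁ with rfl | rfl | rfl | ⟨e1, e2, e3⟩ <;>
        rcases hcase c₂ with rfl | rfl | rfl | ⟨f1, f2, f3⟩ <;>
        rcases hcase c₃ with rfl | rfl | rfl | ⟨g1, g2, g3⟩
        all_goals (try simp [vertexWeight_self, vertexWeight_of_ne, stepDyn_sub, *])
        all_goals first
          | (simp only [alphaWeight]; ring1)
          | simpa only [neg_sub] using yangBaxter_baa_aab hτ hX u v
          | simpa only [neg_sub] using yangBaxter_baa_aab hτ hY u v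
          | simpa only [neg_sub] using yangBaxter_baa_aba hτ hX u v
      · have h31 := Ne.symm h13
        have h32 := Ne.symm h23
        have hne : ∀ i ∈ Icc 1 N, ∀ j ∈ Icc 1 N, i ≠ j → theta τ (lam i - lam j) ≠ 0 :=
          fun i hi j hj hij => by simpa using hlam i hi j hj hij 0
        have e : ∀ i j k, lam i - lam k = (lam i - lam j) + (lam j - lam k) := fun i j k => by ring
        rcases hcase c₁ with rfl | rfl | rfl | ⟨e1, e2, e3⟩ <;>
        rcases hcase c₂ with rfl | rfl | rfl | ⟨f1, f2, f3⟩ <;>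
        rcases hcase c₃ with rfl | rfl | rfl | ⟨g1, g2, g3⟩
        all_goals (try simp [vertexWeight_of_ne, stepDyn_sub, *])
        · ring
        · simp only [alphaWeight]; ring
        · simp only [alphaWeight]; ring
        all_goals
          have hP := hne c₁ ‹_› c₂ ‹_› ‹_›
          have hQ := hne c₂ ‹_› c₃ ‹_› ‹_›
          have hPQ := hne c₁ ‹_› c₃ ‹_› ‹_›
          rw [e c₁ c₂ c₃] at hPQ
        · simpa [neg_sub] using yangBaxter_abc_bca hτ hP hQ hPQ u v
        · simpa [neg_sub] using yangBaxter_abc_cab hτ hP hQ hPQ u v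
        · simpa [neg_sub] using yangBaxter_abc_cba hτ hP hQ hPQ u v

/-! ### Sums over tuples of colours -/

theorem toColours_mem {n N : ℕ} (u : Fin n → Fin N) {s : ℕ} (hs : s ∈ Icc 1 n) :
    toColours u s ∈ Icc 1 N := by
  rw [mem_Icc] at hs
  have h : s - 1 < n := by omega
  simp only [toColours, h, dif_pos, mem_Icc]
  exact ⟨by omega, (u ⟨s - 1, h⟩).2⟩

theorem toColours_succ {n N : ℕ} (u : Fin n → Fin N) (i : Fin n) :
    toColours u (i + 1) = (u i : ℕ) + 1 := by
  simp [toColours]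

theorem sum_Icc_one_eq_sum_fin {β : Type*} [AddCommMonoid β] (N : ℕ) (f : ℕ → β) :
    ∑ x ∈ Icc 1 N, f x = ∑ x : Fin N, f (x + 1) := by
  rw [Fin.sum_univ_eq_sum_range fun x => f (x + 1), range_eq_Ico,
    Finset.sum_Ico_add' f 0 N 1]
  rfl

/-- A function of colourings that depends only on the colours of the indices `1, …, n`. -/
def DependsOnFirst (n : ℕ) (F : (ℕ → ℕ) → ℂ) : Prop :=
  ∀ f g : ℕ → ℕ, (∀ s ∈ Icc 1 n, f s = g s) → F f = F g

theorem sum_toColours_succ {n N : ℕ} {F : (ℕ → ℕ) → ℂ} (hF : DependsOnFirst (n + 1) F) :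
    ∑ u : Fin (n + 1) → Fin N, F (toColours u)
      = ∑ u : Fin n → Fin N, ∑ x ∈ Icc 1 N, F (Function.update (toColours u) (n + 1) x) := by
  simp only [sum_Icc_one_eq_sum_fin]
  rw [sum_comm, ← Fintype.sum_prod_type', ← (Fin.snocEquiv fun _ => Fin N).sum_comp]
  refine sum_congr rfl fun p _ => hF _ _ fun s hs => ?_
  obtain ⟨x, u⟩ := p
  rw [mem_Icc] at hs
  obtain ⟨i, rfl⟩ : ∃ i : Fin (n + 1), s = i + 1 := ⟨⟨s - 1, by omega⟩, by simp; omega⟩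
  rw [toColours_succ]
  induction i using Fin.lastCases with
  | last => simp [Fin.snocEquiv]
  | cast i =>
    have : (i : ℕ) ≠ n := i.2.ne
    simp [Fin.snocEquiv, this, toColours_succ]

/-- The function `f` with new values `x`, `y` at `m + 1`, `m + 2`. -/
def set2 {α : Type*} (f : ℕ → α) (m : ℕ) (x y : α) : ℕ → α :=
  fun s => if s = m + 1 then x else if s = m + 2 then y else f s

section set2
variable {α : Type*} (f : ℕ → α) (m : ℕ) (x y : α)

@[simp] theorem set2_fst : set2 f m x y (m + 1) = x := by simp [set2]

@[simp] theorem set2_snd : set2 f m x y (m + 2) = y := by simp [set2]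

theorem set2_of_ne {s : ℕ} (h1 : s ≠ m + 1) (h2 : s ≠ m + 2) : set2 f m x y s = f s := by
  simp [set2, h1, h2]

theorem set2_of_le {s : ℕ} (h : s ≤ m) : set2 f m x y s = f s :=
  set2_of_ne f m x y (by omega) (by omega)

@[simp] theorem set2_self : set2 f m (f (m + 1)) (f (m + 2)) = f := by
  funext s; simp only [set2]; split_ifs <;> simp_all

end set2

/-- Exchanging the two colours at `m + 1`, `m + 2` of a colouring with a pair of colours is an
involution of the colourings with a distinguished pair. -/
theorem sum_toColours_set2 {n N m : ℕ} (hm : m + 2 ≤ n) {F : (ℕ → ℕ) → ℕ → ℕ → ℂ}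
    (hF : ∀ x y, DependsOnFirst n fun f => F f x y) :
    ∑ u : Fin n → Fin N, ∑ x ∈ Icc 1 N, ∑ y ∈ Icc 1 N, F (toColours u) x y
      = ∑ u : Fin n → Fin N, ∑ x ∈ Icc 1 N, ∑ y ∈ Icc 1 N,
          F (set2 (toColours u) m x y) (toColours u (m + 1)) (toColours u (m + 2)) := by
  simp only [sum_Icc_one_eq_sum_fin, ← Fintype.sum_prod_type']
  let i : Fin n := ⟨m, by omega⟩
  let j : Fin n := ⟨m + 1, by omega⟩
  have hij : i ≠ j := by simp [i, j]
  let g : (Fin n → Fin N) × Fin N × Fin N → (Fin n → Fin N) × Fin N × Fin N :=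
    fun p => (Function.update (Function.update p.1 i p.2.1) j p.2.2, p.1 i, p.1 j)
  have hg : Function.Involutive g := by
    rintro ⟨u, x, y⟩
    simp only [g, Prod.mk.injEq]
    refine ⟨?_, by simp [hij], by simp⟩
    funext k
    by_cases hk : k = j
    · subst hk; simp
    · by_cases hk' : k = i
      · subst hk'; simp [hij]
      · simp [hk, hk']
  rw [← Equiv.sum_comp (Function.Involutive.toPerm g hg)]
  refine sum_congr rfl fun p _ => ?_
  obtain ⟨u, x, y⟩ := p
  simp only [Function.Involutive.coe_toPerm, g]
  have hi : toColours u (m + 1) = u i + 1 := toColours_succ u i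
  have hj : toColours u (m + 2) = u j + 1 := toColours_succ u j
  rw [hi, hj]
  refine hF _ _ _ _ fun s hs => ?_
  rw [mem_Icc] at hs
  obtain ⟨k, rfl⟩ : ∃ k : Fin n, s = k + 1 := ⟨⟨s - 1, by omega⟩, by simp; omega⟩
  rw [toColours_succ]
  by_cases hk : k = j
  · subst hk; simp [j]
  · by_cases hk' : k = i
    · subst hk'; simp [hij, i]
    · have h1 : (k : ℕ) ≠ m := fun h => hk' (Fin.ext h)
      have h2 : (k : ℕ) ≠ m + 1 := fun h => hk (Fin.ext h)
      rw [set2_of_ne _ _ _ _ (by omega) (by omega), toColours_succ]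
      simp [hk, hk']

/-! ### Dependence on finitely many entries, and conservation of colours -/

theorem shiftDyn_set2 (g : ℂ) (lam : ℕ → ℂ) {f : ℕ → ℕ} {m x y n : ℕ} (hm : m + 2 ≤ n)
    (h : (x = f (m + 1) ∧ y = f (m + 2)) ∨ (x = f (m + 2) ∧ y = f (m + 1))) :
    shiftDyn g lam (set2 f m x y) n = shiftDyn g lam f n := by
  induction n, hm using Nat.le_induction with
  | base =>
    rw [shiftDyn_succ, shiftDyn_succ, shiftDyn_succ, shiftDyn_succ,
      shiftDyn_congr g lam (s := set2 f m x y) (t := f)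
      fun j hj => set2_of_le f m x y (mem_Icc.mp hj).2, set2_fst, set2_snd]
    rcases h with ⟨rfl, rfl⟩ | ⟨rfl, rfl⟩
    · rfl
    · exact stepDyn_comm _ _ _ _ _
  | succ n hn ih =>
    rw [shiftDyn_succ, shiftDyn_succ, ih, set2_of_ne _ _ _ _ (by omega) (by omega)]

theorem rowWeight_congr (τ γ : ℂ) (N : ℕ) (lam : ℕ → ℂ) (z : ℂ) {w w' : ℕ → ℂ}
    {b b' t t' : ℕ → ℕ} {n : ℕ} (hw : ∀ s ∈ Icc 1 n, w s = w' s) (hb : ∀ s ∈ Icc 1 n, b s = b' s)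
    (ht : ∀ s ∈ Icc 1 n, t s = t' s) (a a' : ℕ) :
    rowWeight τ γ N lam z w b t n a a' = rowWeight τ γ N lam z w' b' t' n a a' := by
  induction n generalizing a' with
  | zero => rfl
  | succ n ih =>
    have hs : Icc 1 n ⊆ Icc 1 (n + 1) := Icc_subset_Icc_right (by omega)
    have hn : n + 1 ∈ Icc 1 (n + 1) := by simp
    simp only [rowWeight]
    rw [hw _ hn, hb _ hn, ht _ hn, shiftDyn_congr _ _ fun s h => ht s (hs h)]
    refine sum_congr rfl fun x _ => ?_
    rw [ih (fun s h => hw s (hs h)) (fun s h => hb s (hs h)) (fun s h => ht s (hs h))]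

theorem layerWeight_congr (τ γ : ℂ) (N : ℕ) (lam : ℕ → ℂ) {n m : ℕ} {z z' w w' : ℕ → ℂ}
    {l l' r r' t t' b b' : ℕ → ℕ}
    (hz : ∀ s ∈ Icc 1 m, z s = z' s) (hw : ∀ s ∈ Icc 1 n, w s = w' s)
    (hl : ∀ s ∈ Icc 1 m, l s = l' s) (hr : ∀ s ∈ Icc 1 m, r s = r' s)
    (ht : ∀ s ∈ Icc 1 n, t s = t' s) (hb : ∀ s ∈ Icc 1 n, b s = b' s) :
    layerWeight τ γ N lam n z w l r t m b = layerWeight τ γ N lam n z' w' l' r' t' m b' := by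
  induction m generalizing b b' with
  | zero => exact prod_congr rfl fun s hs => by rw [ht s hs, hb s hs]
  | succ m ih =>
    have hs : Icc 1 m ⊆ Icc 1 (m + 1) := Icc_subset_Icc_right (by omega)
    have hm : m + 1 ∈ Icc 1 (m + 1) := by simp
    simp only [layerWeight]
    rw [hz _ hm, hl _ hm, hr _ hm, shiftDyn_congr _ _ fun s h => hl s (hs h)]
    refine sum_congr rfl fun u _ => ?_
    rw [ih (fun s h => hz s (hs h)) (fun s h => hl s (hs h)) (fun s h => hr s (hs h))
      (fun _ _ => rfl), rowWeight_congr τ γ N _ _ hw hb fun _ _ => rfl]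

/-- Conservation of colours along a row: both paths around the row lead to the same dynamical
variables. -/
theorem rowWeight_conserve {τ γ : ℂ} {N : ℕ} {lam : ℕ → ℂ} {z : ℂ} {w : ℕ → ℂ} {b t : ℕ → ℕ}
    {n a a' : ℕ} (h : rowWeight τ γ N lam z w b t n a a' ≠ 0) (g : ℂ) (mu : ℕ → ℂ) :
    shiftDyn g (stepDyn g mu a) b n = stepDyn g (shiftDyn g mu t n) a' := by
  induction n generalizing a' with
  | zero =>
    by_cases e : a = a'
    · rw [shiftDyn_zero, shiftDyn_zero, e]
    · exact absurd (by simp [rowWeight, e]) h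
  | succ n ih =>
    obtain ⟨x, -, hx⟩ := exists_ne_zero_of_sum_ne_zero h
    rw [shiftDyn_succ, shiftDyn_succ, ih (left_ne_zero_of_mul hx)]
    rcases vertexWeight_ne_zero (right_ne_zero_of_mul hx) with ⟨rfl, h⟩ | ⟨h, h'⟩
    · rw [h]; exact stepDyn_comm _ _ _ _ _
    · rw [h, h']

/-- Conservation of colours in a layer: the left and bottom ends carry the same colours as the top
and right ends. It is stated as path independence of the dynamical variables. -/
theorem layerWeight_conserve {τ γ : ℂ} {N : ℕ} {lam : ℕ → ℂ} {n m : ℕ} {z w : ℕ → ℂ}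
    {l r t b : ℕ → ℕ} (h : layerWeight τ γ N lam n z w l r t m b ≠ 0) (g : ℂ) (mu : ℕ → ℂ) :
    shiftDyn g (shiftDyn g mu l m) b n = shiftDyn g (shiftDyn g mu t n) r m := by
  induction m generalizing b with
  | zero =>
    rw [shiftDyn_zero, shiftDyn_zero]
    refine shiftDyn_congr _ _ fun s hs => ?_
    by_contra hne
    exact h (prod_eq_zero hs (if_neg (Ne.symm hne)))
  | succ m ih =>
    obtain ⟨u, -, hu⟩ := exists_ne_zero_of_sum_ne_zero h
    rw [shiftDyn_succ, shiftDyn_succ, rowWeight_conserve (right_ne_zero_of_mul hu),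
      ih (left_ne_zero_of_mul hu)]

theorem dependsOnFirst_layerWeight_mul_rowWeight (τ γ : ℂ) (N : ℕ) (lam lam' : ℕ → ℂ) (n m : ℕ)
    (z w w' : ℕ → ℂ) (z' : ℂ) (l r t b : ℕ → ℕ) (a a' : ℕ) :
    DependsOnFirst n fun u => layerWeight τ γ N lam n z w l r t m u *
      rowWeight τ γ N lam' z' w' b u n a a' := fun f g h => by
  dsimp only
  rw [layerWeight_congr τ γ N lam (fun _ _ => rfl) (fun _ _ => rfl) (fun _ _ => rfl)
    (fun _ _ => rfl) (fun _ _ => rfl) h,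
    rowWeight_congr τ γ N lam' z' (fun _ _ => rfl) (fun _ _ => rfl) h]

/-! ### Exchange of neighbouring lines -/

theorem sum_last_first₃ {ι₁ ι₂ ι₃ : Type*} (s₁ : Finset ι₁) (s₂ : Finset ι₂) (s₃ : Finset ι₃)
    (f : ι₁ → ι₂ → ι₃ → ℂ) :
    ∑ a ∈ s₁, ∑ b ∈ s₂, ∑ c ∈ s₃, f a b c = ∑ c ∈ s₃, ∑ a ∈ s₁, ∑ b ∈ s₂, f a b c :=
  (sum_congr rfl fun _ _ => sum_comm).trans sum_comm

theorem sum_last_first₄ {ι₁ ι₂ ι₃ ι₄ : Type*} (s₁ : Finset ι₁) (s₂ : Finset ι₂) (s₃ : Finset ι₃)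
    (s₄ : Finset ι₄) (f : ι₁ → ι₂ → ι₃ → ι₄ → ℂ) :
    ∑ a ∈ s₁, ∑ b ∈ s₂, ∑ c ∈ s₃, ∑ d ∈ s₄, f a b c d
      = ∑ d ∈ s₄, ∑ a ∈ s₁, ∑ b ∈ s₂, ∑ c ∈ s₃, f a b c d :=
  (sum_congr rfl fun _ _ => sum_last_first₃ _ _ _ _).trans sum_comm

/-- A row crossing the columns `m + 1`, `m + 2`: the crossing of these two columns is moved from
above the row to below it. -/
theorem rowWeight_exchange {τ γ : ℂ} (hτ : 0 < τ.im) {N : ℕ} {lam : ℕ → ℂ}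
    (hlam : IsGeneric τ γ N lam) (z : ℂ) (w : ℕ → ℂ) {b : ℕ → ℕ} (t : ℕ → ℕ) {m n : ℕ}
    (hm : m + 2 ≤ n) (hb : ∀ s ∈ Icc 1 n, b s ∈ Icc 1 N) (a a' : ℕ) :
    ∑ x ∈ Icc 1 N, ∑ y ∈ Icc 1 N, rowWeight τ γ N lam z w b (set2 t m x y) n a a' *
        vertexWeight τ γ (shiftDyn (-γ) lam t m) (w (m + 1)) (w (m + 2)) x y
          (t (m + 2)) (t (m + 1))
      = ∑ y ∈ Icc 1 N, ∑ x ∈ Icc 1 N,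
        vertexWeight τ γ (shiftDyn (-γ) (stepDyn (-γ) lam a) b m) (w (m + 1)) (w (m + 2))
          (b (m + 1)) (b (m + 2)) y x *
        rowWeight τ γ N lam z (set2 w m (w (m + 2)) (w (m + 1))) (set2 b m x y) t n a a' := by
  induction n, hm using Nat.le_induction generalizing a' with
  | base =>
    have hb1 : b (m + 1) ∈ Icc 1 N := hb _ (by simp)
    have hb2 : b (m + 2) ∈ Icc 1 N := hb _ (by simp)
    -- the first `m` vertices of the row are the same on both sides
    have hrow : ∀ x y x₀, rowWeight τ γ N lam z (set2 w m (w (m + 2)) (w (m + 1))) (set2 b m x y)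
        t m a x₀ = rowWeight τ γ N lam z w b t m a x₀ := fun x y x₀ =>
      rowWeight_congr _ _ _ _ _ (fun s hs => set2_of_le _ _ _ _ (mem_Icc.mp hs).2)
        (fun s hs => set2_of_le _ _ _ _ (mem_Icc.mp hs).2) (fun _ _ => rfl) _ _
    have hrow' : ∀ x y x₀, rowWeight τ γ N lam z w b (set2 t m x y) m a x₀
        = rowWeight τ γ N lam z w b t m a x₀ := fun x y x₀ =>
      rowWeight_congr _ _ _ _ _ (fun _ _ => rfl) (fun _ _ => rfl)
        (fun s hs => set2_of_le _ _ _ _ (mem_Icc.mp hs).2) _ _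
    have hsh : ∀ x y, shiftDyn (-γ) lam (set2 t m x y) m = shiftDyn (-γ) lam t m := fun x y =>
      shiftDyn_congr _ _ fun s hs => set2_of_le _ _ _ _ (mem_Icc.mp hs).2
    have key : ∀ x₀ ∈ Icc 1 N, rowWeight τ γ N lam z w b t m a x₀ *
        ∑ x ∈ Icc 1 N, ∑ y ∈ Icc 1 N, (∑ p ∈ Icc 1 N,
          vertexWeight τ γ (shiftDyn (-γ) lam t m) z (w (m + 1)) x₀ (b (m + 1)) p x *
          vertexWeight τ γ (stepDyn (-γ) (shiftDyn (-γ) lam t m) x) z (w (m + 2)) p (b (m + 2))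
            a' y) *
          vertexWeight τ γ (shiftDyn (-γ) lam t m) (w (m + 1)) (w (m + 2)) x y
            (t (m + 2)) (t (m + 1))
        = rowWeight τ γ N lam z w b t m a x₀ *
        ∑ y ∈ Icc 1 N, ∑ x ∈ Icc 1 N,
          vertexWeight τ γ (shiftDyn (-γ) (stepDyn (-γ) lam a) b m) (w (m + 1)) (w (m + 2))
            (b (m + 1)) (b (m + 2)) y x *
          ∑ p ∈ Icc 1 N, vertexWeight τ γ (shiftDyn (-γ) lam t m) z (w (m + 2)) x₀ x p
            (t (m + 1)) *
          vertexWeight τ γ (stepDyn (-γ) (shiftDyn (-γ) lam t m) (t (m + 1))) z (w (m + 1)) p y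
            a' (t (m + 2)) := by
      intro x₀ hx₀
      by_cases h0 : rowWeight τ γ N lam z w b t m a x₀ = 0
      · rw [h0, zero_mul, zero_mul]
      rw [rowWeight_conserve h0, ← yang_baxter hτ (hlam.shiftDyn_neg t m) z (w (m + 1)) (w (m + 2))
        hx₀ hb1 hb2 a' (t (m + 2)) (t (m + 1))]
      congr 1
      simp only [sum_mul, mul_sum]
      rw [sum_last_first₃]
      refine sum_congr rfl fun p _ => sum_congr rfl fun x _ => sum_congr rfl fun y _ => ?_
      ring
    have h := sum_congr rfl key
    simp only [sum_mul, mul_sum] at h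
    have h := (sum_last_first₄ _ _ _ _ _).trans (h.trans (sum_last_first₄ _ _ _ _ _).symm)
    simp only [rowWeight, hrow, hrow', shiftDyn_succ, hsh, set2_fst, set2_snd, sum_mul, mul_sum]
    refine Eq.trans ?_ (h.trans ?_)
    · refine sum_congr rfl fun x _ => sum_congr rfl fun y _ => sum_congr rfl fun p _ =>
        sum_congr rfl fun x₀ _ => ?_
      ring
    · refine sum_congr rfl fun x _ => sum_congr rfl fun y _ => sum_congr rfl fun p _ =>
        sum_congr rfl fun x₀ _ => ?_
      ring
  | succ n hn ih =>
    have hb' : ∀ s ∈ Icc 1 n, b s ∈ Icc 1 N := fun s hs =>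
      hb s (Icc_subset_Icc_right (by omega) hs)
    simp only [rowWeight]
    rw [set2_of_ne w _ _ _ (by omega) (by omega)]
    simp only [set2_of_ne _ m _ _ (show n + 1 ≠ m + 1 by omega) (show n + 1 ≠ m + 2 by omega),
      sum_mul, mul_sum]
    refine (sum_last_first₃ _ _ _ _).trans (Eq.trans ?_ (sum_last_first₃ _ _ _ _).symm)
    refine sum_congr rfl fun q _ => ?_
    have h := congrArg (· * vertexWeight τ γ (shiftDyn (-γ) lam t n) z (w (n + 1)) q (b (n + 1)) a'
      (t (n + 1))) (ih hb' q)
    simp only [sum_mul] at h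
    refine Eq.trans ?_ (h.trans ?_)
    · refine sum_congr rfl fun x _ => sum_congr rfl fun y _ => ?_
      by_cases h0 : vertexWeight τ γ (shiftDyn (-γ) lam t m) (w (m + 1)) (w (m + 2)) x y
          (t (m + 2)) (t (m + 1)) = 0
      · rw [h0]; ring
      · rw [shiftDyn_set2 (-γ) lam hn]
        · ring
        · rcases vertexWeight_ne_zero h0 with ⟨h1, h2⟩ | ⟨h1, h2⟩
          · exact Or.inr ⟨h1.symm, h2.symm⟩
          · exact Or.inl ⟨h2.symm, h1.symm⟩
    · exact sum_congr rfl fun y _ => sum_congr rfl fun x _ => by ring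

theorem set2_set2 {α : Type*} (f : ℕ → α) (m : ℕ) (x y x' y' : α) :
    set2 (set2 f m x y) m x' y' = set2 f m x' y' := by
  funext s; simp only [set2]; split_ifs <;> rfl

theorem set2_congr {α : Type*} {f g : ℕ → α} {n : ℕ} (h : ∀ s ∈ Icc 1 n, f s = g s) (m : ℕ)
    (x y : α) : ∀ s ∈ Icc 1 n, set2 f m x y s = set2 g m x y s := fun s hs => by
  simp only [set2, h s hs]

/-- The crossing of the columns `m + 1`, `m + 2` is moved through a layer, from the top to the
bottom. -/
theorem layerWeight_exchange_columns {τ γ : ℂ} (hτ : 0 < τ.im) {N : ℕ} {lam : ℕ → ℂ}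
    (hlam : IsGeneric τ γ N lam) (z w : ℕ → ℂ) (l r : ℕ → ℕ) {t b : ℕ → ℕ} {m n : ℕ}
    (hm : m + 2 ≤ n) (ht : ∀ s ∈ Icc 1 n, t s ∈ Icc 1 N) (hb : ∀ s ∈ Icc 1 n, b s ∈ Icc 1 N)
    (R : ℕ) :
    ∑ x ∈ Icc 1 N, ∑ y ∈ Icc 1 N, layerWeight τ γ N lam n z w l r (set2 t m x y) R b *
        vertexWeight τ γ (shiftDyn (-γ) lam t m) (w (m + 1)) (w (m + 2)) x y
          (t (m + 2)) (t (m + 1))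
      = ∑ y ∈ Icc 1 N, ∑ x ∈ Icc 1 N,
        vertexWeight τ γ (shiftDyn (-γ) (shiftDyn (-γ) lam l R) b m) (w (m + 1)) (w (m + 2))
          (b (m + 1)) (b (m + 2)) y x *
        layerWeight τ γ N lam n z (set2 w m (w (m + 2)) (w (m + 1))) l r t R (set2 b m x y) := by
  induction R generalizing b with
  | zero =>
    have hm1 : m + 1 ∈ Icc 1 n := by simp; omega
    have hm2 : m + 2 ∈ Icc 1 n := by simp; omega
    have hne : m + 1 ≠ m + 2 := by omega
    have hmem : m + 2 ∈ (Icc 1 n).erase (m + 1) := mem_erase.mpr ⟨hne.symm, hm2⟩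
    have hprod : ∀ f : ℕ → ℂ, ∏ s ∈ Icc 1 n, f s
        = f (m + 1) * (f (m + 2) * ∏ s ∈ ((Icc 1 n).erase (m + 1)).erase (m + 2), f s) :=
      fun f => by rw [mul_prod_erase _ f hmem, mul_prod_erase _ f hm1]
    have hrest : ∀ s ∈ ((Icc 1 n).erase (m + 1)).erase (m + 2), s ≠ m + 1 ∧ s ≠ m + 2 := by
      intro s hs
      simp only [mem_erase] at hs
      exact ⟨hs.2.1, hs.1⟩
    have h1 : ∀ x y, ∏ s ∈ ((Icc 1 n).erase (m + 1)).erase (m + 2),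
        (if set2 t m x y s = b s then (1 : ℂ) else 0)
        = ∏ s ∈ ((Icc 1 n).erase (m + 1)).erase (m + 2), if t s = b s then (1 : ℂ) else 0 :=
      fun x y => prod_congr rfl fun s hs => by
        rw [set2_of_ne _ _ _ _ (hrest s hs).1 (hrest s hs).2]
    have h2 : ∀ x y, ∏ s ∈ ((Icc 1 n).erase (m + 1)).erase (m + 2),
        (if t s = set2 b m x y s then (1 : ℂ) else 0)
        = ∏ s ∈ ((Icc 1 n).erase (m + 1)).erase (m + 2), if t s = b s then (1 : ℂ) else 0 :=
      fun x y => prod_congr rfl fun s hs => by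
        rw [set2_of_ne _ _ _ _ (hrest s hs).1 (hrest s hs).2]
    simp only [layerWeight, hprod, set2_fst, set2_snd, h1, h2, shiftDyn_zero]
    rw [sum_eq_single_of_mem _ (hb _ hm1) fun x _ hx => by simp [hx],
      sum_eq_single_of_mem _ (hb _ hm2) fun x _ hx => by simp [hx],
      sum_eq_single_of_mem _ (ht _ hm2) fun x _ hx => by simp [Ne.symm hx],
      sum_eq_single_of_mem _ (ht _ hm1) fun x _ hx => by simp [Ne.symm hx]]
    by_cases h0 : ∏ s ∈ ((Icc 1 n).erase (m + 1)).erase (m + 2),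
        (if t s = b s then (1 : ℂ) else 0) = 0
    · simp [h0]
    · rw [shiftDyn_congr (-γ) lam (s := t) (t := b)]
      · simp [mul_comm]
      · intro s hs
        rw [mem_Icc] at hs
        by_contra hts
        exact h0 (prod_eq_zero (i := s) (by simp [mem_erase]; omega) (if_neg hts))
  | succ R ih =>
    set w' := set2 w m (w (m + 2)) (w (m + 1)) with hw'
    set mu := shiftDyn (-γ) lam l R with hmu
    have hF : ∀ x y, DependsOnFirst n fun f => vertexWeight τ γ (shiftDyn (-γ) mu f m) (w (m + 1))
        (w (m + 2)) (f (m + 1)) (f (m + 2)) y x * layerWeight τ γ N lam n z w' l r t R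
        (set2 f m x y) * rowWeight τ γ N mu (z (R + 1)) w b f n (l (R + 1)) (r (R + 1)) := by
      intro x y f g h
      have hsub : Icc 1 m ⊆ Icc 1 n := Icc_subset_Icc_right (by omega)
      dsimp only
      rw [shiftDyn_congr _ _ fun s hs => h s (hsub hs), h (m + 1) (by simp; omega),
        h (m + 2) (by simp; omega),
        layerWeight_congr τ γ N lam (fun _ _ => rfl) (fun _ _ => rfl) (fun _ _ => rfl)
          (fun _ _ => rfl) (fun _ _ => rfl) (set2_congr h m x y),
        rowWeight_congr τ γ N mu _ (fun _ _ => rfl) (fun _ _ => rfl) h]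
    calc _ = ∑ u : Fin n → Fin N, (∑ x ∈ Icc 1 N, ∑ y ∈ Icc 1 N,
          layerWeight τ γ N lam n z w l r (set2 t m x y) R (toColours u) *
          vertexWeight τ γ (shiftDyn (-γ) lam t m) (w (m + 1)) (w (m + 2)) x y
            (t (m + 2)) (t (m + 1))) *
          rowWeight τ γ N mu (z (R + 1)) w b (toColours u) n (l (R + 1)) (r (R + 1)) := by
          simp only [layerWeight, sum_mul]
          refine (sum_last_first₃ _ _ _ _).trans ?_
          exact sum_congr rfl fun u _ => sum_congr rfl fun x _ => sum_congr rfl fun y _ =>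
            mul_right_comm _ _ _
      _ = ∑ u : Fin n → Fin N, ∑ x ∈ Icc 1 N, ∑ y ∈ Icc 1 N,
          vertexWeight τ γ (shiftDyn (-γ) mu (toColours u) m) (w (m + 1)) (w (m + 2))
            (toColours u (m + 1)) (toColours u (m + 2)) y x *
          layerWeight τ γ N lam n z w' l r t R (set2 (toColours u) m x y) *
          rowWeight τ γ N mu (z (R + 1)) w b (toColours u) n (l (R + 1)) (r (R + 1)) := by
          refine sum_congr rfl fun u _ => ?_
          rw [ih fun s hs => toColours_mem u hs, sum_comm]
          simp only [sum_mul]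
      _ = ∑ u : Fin n → Fin N, layerWeight τ γ N lam n z w' l r t R (toColours u) *
          ∑ x ∈ Icc 1 N, ∑ y ∈ Icc 1 N, rowWeight τ γ N mu (z (R + 1)) w b
            (set2 (toColours u) m x y) n (l (R + 1)) (r (R + 1)) *
            vertexWeight τ γ (shiftDyn (-γ) mu (toColours u) m) (w (m + 1)) (w (m + 2)) x y
              (toColours u (m + 2)) (toColours u (m + 1)) := by
          rw [sum_toColours_set2 hm hF]
          refine sum_congr rfl fun u _ => ?_
          simp only [mul_sum, set2_fst, set2_snd, set2_set2, set2_self]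
          refine sum_congr rfl fun x _ => sum_congr rfl fun y _ => ?_
          rw [shiftDyn_congr _ mu (s := set2 (toColours u) m x y) (t := toColours u)
            fun s hs => set2_of_le _ _ _ _ (mem_Icc.mp hs).2]
          ring
      _ = _ := by
          rw [shiftDyn_succ, ← hmu]
          refine (sum_congr rfl fun u _ => by
            rw [rowWeight_exchange hτ (hlam.shiftDyn_neg l R) _ _ _ hm hb]).trans ?_
          simp only [layerWeight, mul_sum]
          refine Eq.trans ?_ (sum_last_first₃ _ _ _ _).symm
          refine sum_congr rfl fun u _ => sum_congr rfl fun y _ => sum_congr rfl fun x _ => ?_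
          ring

theorem sum_swap_pairs {ι₁ ι₂ ι₃ ι₄ : Type*} (s₁ : Finset ι₁) (s₂ : Finset ι₂) (s₃ : Finset ι₃)
    (s₄ : Finset ι₄) (f : ι₁ → ι₂ → ι₃ → ι₄ → ℂ) :
    ∑ a ∈ s₁, ∑ b ∈ s₂, ∑ c ∈ s₃, ∑ d ∈ s₄, f a b c d
      = ∑ c ∈ s₃, ∑ d ∈ s₄, ∑ a ∈ s₁, ∑ b ∈ s₂, f a b c d :=
  (sum_last_first₄ _ _ _ _ _).trans (sum_last_first₄ _ _ _ _ _)

theorem mul_sum_sum {ι₁ ι₂ : Type*} (s₁ : Finset ι₁) (s₂ : Finset ι₂) (f : ι₁ → ι₂ → ℂ) (a : ℂ) :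
    a * ∑ i ∈ s₁, ∑ j ∈ s₂, f i j = ∑ i ∈ s₁, ∑ j ∈ s₂, a * f i j := by
  simp only [mul_sum]

theorem sum_sum_mul {ι₁ ι₂ : Type*} (s₁ : Finset ι₁) (s₂ : Finset ι₂) (f : ι₁ → ι₂ → ℂ) (a : ℂ) :
    (∑ i ∈ s₁, ∑ j ∈ s₂, f i j) * a = ∑ i ∈ s₁, ∑ j ∈ s₂, f i j * a := by
  simp only [sum_mul]

/-- Two consecutive rows, with spectral parameters `z₁` (upper) and `z₂` (lower). -/
noncomputable def twoRowWeight (τ γ : ℂ) (N : ℕ) (lam : ℕ → ℂ) (z₁ z₂ : ℂ) (w : ℕ → ℂ)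
    (b t : ℕ → ℕ) (n l₁ l₂ r₁ r₂ : ℕ) : ℂ :=
  ∑ u : Fin n → Fin N, rowWeight τ γ N lam z₁ w (toColours u) t n l₁ r₁ *
    rowWeight τ γ N (stepDyn (-γ) lam l₁) z₂ w b (toColours u) n l₂ r₂

theorem twoRowWeight_zero (τ γ : ℂ) (N : ℕ) (lam : ℕ → ℂ) (z₁ z₂ : ℂ) (w : ℕ → ℂ)
    (b t : ℕ → ℕ) (l₁ l₂ r₁ r₂ : ℕ) : twoRowWeight τ γ N lam z₁ z₂ w b t 0 l₁ l₂ r₁ r₂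
      = (if l₁ = r₁ then 1 else 0) * (if l₂ = r₂ then 1 else 0) := by
  simp [twoRowWeight, rowWeight]

/-- The colour of the vertical edge between the two rows in the last column is summed over
separately. The dynamical variables of the lower row are those of the upper one by conservation of
colours. -/
theorem twoRowWeight_succ (τ γ : ℂ) (N : ℕ) (lam : ℕ → ℂ) (z₁ z₂ : ℂ) (w : ℕ → ℂ)
    (b t : ℕ → ℕ) (n l₁ l₂ r₁ r₂ : ℕ) :
    twoRowWeight τ γ N lam z₁ z₂ w b t (n + 1) l₁ l₂ r₁ r₂
      = ∑ p ∈ Icc 1 N, ∑ q ∈ Icc 1 N, twoRowWeight τ γ N lam z₁ z₂ w b t n l₁ l₂ p q *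
        ∑ c ∈ Icc 1 N, vertexWeight τ γ (shiftDyn (-γ) lam t n) z₁ (w (n + 1)) p c r₁ (t (n + 1)) *
          vertexWeight τ γ (stepDyn (-γ) (shiftDyn (-γ) lam t n) p) z₂ (w (n + 1)) q (b (n + 1))
            r₂ c := by
  rw [twoRowWeight, sum_toColours_succ (F := fun u => rowWeight τ γ N lam z₁ w u t (n + 1) l₁ r₁ *
    rowWeight τ γ N (stepDyn (-γ) lam l₁) z₂ w b u (n + 1) l₂ r₂)]
  swap
  · intro f g h
    dsimp only
    rw [rowWeight_congr τ γ N lam z₁ (fun _ _ => rfl) h (fun _ _ => rfl),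
      rowWeight_congr τ γ N _ z₂ (fun _ _ => rfl) (fun _ _ => rfl) h]
  have hup : ∀ (u : ℕ → ℕ) (c : ℕ), ∀ s ∈ Icc 1 n, Function.update u (n + 1) c s = u s :=
    fun u c s hs => Function.update_of_ne (by rw [mem_Icc] at hs; omega) _ _
  have h1 : ∀ (u : ℕ → ℕ) (c p : ℕ), rowWeight τ γ N lam z₁ w (Function.update u (n + 1) c) t n l₁ p
      = rowWeight τ γ N lam z₁ w u t n l₁ p := fun u c p =>
    rowWeight_congr τ γ N lam z₁ (fun _ _ => rfl) (hup u c) (fun _ _ => rfl) _ _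
  have h2 : ∀ (u : ℕ → ℕ) (c q : ℕ), rowWeight τ γ N (stepDyn (-γ) lam l₁) z₂ w b
      (Function.update u (n + 1) c) n l₂ q = rowWeight τ γ N (stepDyn (-γ) lam l₁) z₂ w b u n l₂ q :=
    fun u c q => rowWeight_congr τ γ N _ z₂ (fun _ _ => rfl) (fun _ _ => rfl) (hup u c) _ _
  simp only [twoRowWeight, rowWeight, h1, h2, Function.update_self, sum_mul_sum]
  refine (sum_last_first₄ _ _ _ _ _).trans ((sum_last_first₄ _ _ _ _ _).trans ?_)
  refine sum_congr rfl fun p _ => sum_congr rfl fun q _ => sum_congr rfl fun u _ =>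
    sum_congr rfl fun c _ => ?_
  by_cases h0 : rowWeight τ γ N lam z₁ w (toColours u) t n l₁ p = 0
  · simp [h0]
  · rw [shiftDyn_congr _ _ (hup _ _), rowWeight_conserve h0]
    ring

/-- The crossing of two horizontal lines is moved from the left to the right. -/
theorem twoRowWeight_exchange {τ γ : ℂ} (hτ : 0 < τ.im) {N : ℕ} {lam : ℕ → ℂ}
    (hlam : IsGeneric τ γ N lam) (z₁ z₂ : ℂ) (w : ℕ → ℂ) {b : ℕ → ℕ} (t : ℕ → ℕ) {n : ℕ}
    (hb : ∀ s ∈ Icc 1 n, b s ∈ Icc 1 N) {l₁ l₂ r₁ r₂ : ℕ} (hl₁ : l₁ ∈ Icc 1 N)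
    (hl₂ : l₂ ∈ Icc 1 N) (hr₁ : r₁ ∈ Icc 1 N) (hr₂ : r₂ ∈ Icc 1 N) :
    ∑ x ∈ Icc 1 N, ∑ y ∈ Icc 1 N, vertexWeight τ γ lam z₁ z₂ l₁ l₂ x y *
        twoRowWeight τ γ N lam z₂ z₁ w b t n y x r₁ r₂
      = ∑ x ∈ Icc 1 N, ∑ y ∈ Icc 1 N, twoRowWeight τ γ N lam z₁ z₂ w b t n l₁ l₂ x y *
        vertexWeight τ γ (shiftDyn (-γ) lam t n) z₁ z₂ x y r₂ r₁ := by
  induction n generalizing r₁ r₂ with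
  | zero =>
    simp only [twoRowWeight_zero, shiftDyn_zero]
    rw [sum_eq_single_of_mem _ hr₂ fun x _ hx => by simp [hx],
      sum_eq_single_of_mem _ hr₁ fun x _ hx => by simp [hx],
      sum_eq_single_of_mem _ hl₁ fun x _ hx => by simp [Ne.symm hx],
      sum_eq_single_of_mem _ hl₂ fun x _ hx => by simp [Ne.symm hx]]
    simp
  | succ n ih =>
    have hb' : ∀ s ∈ Icc 1 n, b s ∈ Icc 1 N := fun s hs =>
      hb s (Icc_subset_Icc_right (by omega) hs)
    have hbn : b (n + 1) ∈ Icc 1 N := hb _ (by simp)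
    set mu := shiftDyn (-γ) lam t n with hmu
    calc _ = ∑ p ∈ Icc 1 N, ∑ q ∈ Icc 1 N, (∑ x ∈ Icc 1 N, ∑ y ∈ Icc 1 N,
          vertexWeight τ γ lam z₁ z₂ l₁ l₂ x y * twoRowWeight τ γ N lam z₂ z₁ w b t n y x p q) *
          ∑ c ∈ Icc 1 N, vertexWeight τ γ mu z₂ (w (n + 1)) p c r₁ (t (n + 1)) *
          vertexWeight τ γ (stepDyn (-γ) mu p) z₁ (w (n + 1)) q (b (n + 1)) r₂ c := by
          simp only [twoRowWeight_succ, ← hmu]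
          simp only [mul_sum_sum, sum_sum_mul]
          refine (sum_swap_pairs _ _ _ _ _).trans ?_
          refine sum_congr rfl fun p _ => sum_congr rfl fun q _ => sum_congr rfl fun x _ =>
            sum_congr rfl fun y _ => ?_
          ring
      _ = ∑ x ∈ Icc 1 N, ∑ y ∈ Icc 1 N, twoRowWeight τ γ N lam z₁ z₂ w b t n l₁ l₂ x y *
          ∑ q ∈ Icc 1 N, ∑ p ∈ Icc 1 N, vertexWeight τ γ mu z₁ z₂ x y q p *
          ∑ c ∈ Icc 1 N, vertexWeight τ γ (stepDyn (-γ) mu p) z₁ (w (n + 1)) q (b (n + 1)) r₂ c *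
          vertexWeight τ γ mu z₂ (w (n + 1)) p c r₁ (t (n + 1)) := by
          refine (sum_congr rfl fun p hp => sum_congr rfl fun q hq => by
            rw [ih hb' hp hq]).trans ?_
          simp only [mul_sum_sum, sum_sum_mul]
          rw [sum_comm]
          refine (sum_swap_pairs _ _ _ _ _).trans ?_
          refine sum_congr rfl fun x _ => sum_congr rfl fun y _ => sum_congr rfl fun q _ =>
            sum_congr rfl fun p _ => ?_
          rw [mul_assoc]
          congr 2
          exact sum_congr rfl fun c _ => mul_comm _ _
      _ = _ := by
          simp only [twoRowWeight_succ, ← hmu]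
          rw [shiftDyn_succ, ← hmu]
          refine (sum_congr rfl fun x hx => sum_congr rfl fun y hy => by
            rw [yang_baxter hτ (hlam.shiftDyn_neg t n) z₁ z₂ (w (n + 1)) hx hy hbn r₂ r₁
              (t (n + 1))]).trans ?_
          have h : ∀ x y, ∑ q ∈ Icc 1 N, ∑ c ∈ Icc 1 N,
              vertexWeight τ γ (stepDyn (-γ) mu x) z₂ (w (n + 1)) y (b (n + 1)) q c *
              ∑ p ∈ Icc 1 N, vertexWeight τ γ mu z₁ (w (n + 1)) x c p (t (n + 1)) *
              vertexWeight τ γ (stepDyn (-γ) mu (t (n + 1))) z₁ z₂ p q r₂ r₁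
              = ∑ p ∈ Icc 1 N, ∑ q ∈ Icc 1 N, (∑ c ∈ Icc 1 N,
              vertexWeight τ γ mu z₁ (w (n + 1)) x c p (t (n + 1)) *
              vertexWeight τ γ (stepDyn (-γ) mu x) z₂ (w (n + 1)) y (b (n + 1)) q c) *
              vertexWeight τ γ (stepDyn (-γ) mu (t (n + 1))) z₁ z₂ p q r₂ r₁ := by
            intro x y
            simp only [mul_sum, sum_mul]
            refine (sum_last_first₃ _ _ _ _).trans ?_
            refine sum_congr rfl fun p _ => sum_congr rfl fun q _ => sum_congr rfl fun c _ => ?_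
            ring
          simp only [← hmu, h, mul_sum_sum, sum_sum_mul]
          refine (sum_swap_pairs _ _ _ _ _).trans ?_
          refine sum_congr rfl fun p _ => sum_congr rfl fun q _ => sum_congr rfl fun x _ =>
            sum_congr rfl fun y _ => ?_
          ring

/-- The crossing of the rows `m + 1`, `m + 2` is moved through a layer, from the left to the
right, where it becomes a scalar since the two right ends have the same colour. -/
theorem layerWeight_exchange_rows {τ γ : ℂ} (hτ : 0 < τ.im) {N : ℕ} {lam : ℕ → ℂ}
    (hlam : IsGeneric τ γ N lam) (z w : ℕ → ℂ) {l r : ℕ → ℕ} (t : ℕ → ℕ) {b : ℕ → ℕ} {m n R : ℕ}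
    (hm : m + 2 ≤ R) (hl : ∀ s ∈ Icc 1 R, l s ∈ Icc 1 N) (hb : ∀ s ∈ Icc 1 n, b s ∈ Icc 1 N)
    {c : ℕ} (hc : c ∈ Icc 1 N) (hr₁ : r (m + 1) = c) (hr₂ : r (m + 2) = c) :
    theta τ (z (m + 1) - z (m + 2) - γ) * layerWeight τ γ N lam n z w l r t R b
      = ∑ x ∈ Icc 1 N, ∑ y ∈ Icc 1 N,
        vertexWeight τ γ (shiftDyn (-γ) lam l m) (z (m + 1)) (z (m + 2)) (l (m + 1)) (l (m + 2)) x y *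
        layerWeight τ γ N lam n (set2 z m (z (m + 2)) (z (m + 1))) w (set2 l m y x) r t R b := by
  induction R, hm using Nat.le_induction generalizing b with
  | base =>
    have hl₁ : l (m + 1) ∈ Icc 1 N := hl _ (by simp)
    have hl₂ : l (m + 2) ∈ Icc 1 N := hl _ (by simp)
    have htwo : ∀ (z' : ℕ → ℂ) (l' : ℕ → ℕ), (∀ s ∈ Icc 1 m, z' s = z s) →
        (∀ s ∈ Icc 1 m, l' s = l s) → layerWeight τ γ N lam n z' w l' r t (m + 2) b
        = ∑ v : Fin n → Fin N, layerWeight τ γ N lam n z w l r t m (toColours v) *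
          twoRowWeight τ γ N (shiftDyn (-γ) lam l m) (z' (m + 1)) (z' (m + 2)) w b (toColours v) n
            (l' (m + 1)) (l' (m + 2)) c c := by
      intro z' l' hz' hl'
      simp only [layerWeight, twoRowWeight, mul_sum, sum_mul, hr₁, hr₂, shiftDyn_succ,
        shiftDyn_congr (-γ) lam hl']
      rw [sum_comm]
      refine sum_congr rfl fun v _ => sum_congr rfl fun u _ => ?_
      rw [layerWeight_congr τ γ N lam hz' (fun _ _ => rfl) hl' (fun _ _ => rfl) (fun _ _ => rfl)
        (fun _ _ => rfl), mul_assoc]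
    rw [htwo z l (fun _ _ => rfl) fun _ _ => rfl]
    have h2 : ∀ x y, layerWeight τ γ N lam n (set2 z m (z (m + 2)) (z (m + 1))) w (set2 l m y x) r t
        (m + 2) b = _ := fun x y => htwo (set2 z m (z (m + 2)) (z (m + 1))) (set2 l m y x)
          (fun s hs => set2_of_le _ _ _ _ (mem_Icc.mp hs).2)
          (fun s hs => set2_of_le _ _ _ _ (mem_Icc.mp hs).2)
    simp only [h2, set2_fst, set2_snd, mul_sum]
    rw [sum_last_first₃]
    refine sum_congr rfl fun v _ => ?_
    have h := twoRowWeight_exchange hτ (hlam.shiftDyn_neg l m) (z (m + 1)) (z (m + 2)) w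
      (toColours v) hb hl₁ hl₂ hc hc
    have h3 : ∀ mu : ℕ → ℂ, ∑ x ∈ Icc 1 N, ∑ y ∈ Icc 1 N,
        twoRowWeight τ γ N (shiftDyn (-γ) lam l m) (z (m + 1)) (z (m + 2)) w b (toColours v) n
          (l (m + 1)) (l (m + 2)) x y * vertexWeight τ γ mu (z (m + 1)) (z (m + 2)) x y c c
        = twoRowWeight τ γ N (shiftDyn (-γ) lam l m) (z (m + 1)) (z (m + 2)) w b (toColours v) n
          (l (m + 1)) (l (m + 2)) c c * theta τ (z (m + 1) - z (m + 2) - γ) := by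
      intro mu
      have hz : ∀ x y, ¬ (x = c ∧ y = c) →
          vertexWeight τ γ mu (z (m + 1)) (z (m + 2)) x y c c = 0 := by
        intro x y hxy
        by_contra h0
        rcases vertexWeight_ne_zero h0 with ⟨h1, h2⟩ | ⟨h1, h2⟩
        · exact hxy ⟨h1.symm, h2.symm⟩
        · exact hxy ⟨h2.symm, h1.symm⟩
      rw [sum_eq_single_of_mem c hc, sum_eq_single_of_mem c hc, vertexWeight_self]
      · simp
      · intro y _ hy; rw [hz c y fun h => hy h.2, mul_zero]
      · intro x _ hx
        exact sum_eq_zero fun y _ => by rw [hz x y fun h => hx h.1, mul_zero]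
    rw [h3] at h
    rw [mul_left_comm, mul_comm (theta _ _), ← h, mul_sum_sum]
    exact sum_congr rfl fun x _ => sum_congr rfl fun y _ => mul_left_comm _ _ _
  | succ R hR ih =>
    have hl' : ∀ s ∈ Icc 1 R, l s ∈ Icc 1 N := fun s hs =>
      hl s (Icc_subset_Icc_right (by omega) hs)
    simp only [layerWeight, mul_sum]
    rw [sum_last_first₃]
    refine sum_congr rfl fun u _ => ?_
    rw [← mul_assoc, ih hl' fun s hs => toColours_mem u hs, sum_sum_mul]
    refine sum_congr rfl fun x _ => sum_congr rfl fun y _ => ?_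
    rw [set2_of_ne z _ _ _ (by omega) (by omega), set2_of_ne l _ _ _ (by omega) (by omega)]
    by_cases h0 : vertexWeight τ γ (shiftDyn (-γ) lam l m) (z (m + 1)) (z (m + 2)) (l (m + 1))
        (l (m + 2)) x y = 0
    · simp [h0]
    · rw [shiftDyn_set2 (-γ) lam hR, mul_assoc]
      rcases vertexWeight_ne_zero h0 with ⟨h1, h2⟩ | ⟨h1, h2⟩
      · exact Or.inr ⟨h2, h1⟩
      · exact Or.inl ⟨h2, h1⟩

/-! ### The nested sum: dependence on its arguments -/

section lineUp
variable {α : Type}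

theorem lineUp_left {p q s : ℕ} {f g h : ℕ → α} (hs : s ≤ p) : lineUp p q f g h s = f s := by
  simp [lineUp, hs]

theorem lineUp_middle {p q s : ℕ} {f g h : ℕ → α} (h1 : 1 ≤ s) (hs : s ≤ q) :
    lineUp p q f g h (p + s) = g s := by
  have h2 : ¬ p + s ≤ p := by omega
  simp [lineUp, h2, hs]

theorem lineUp_right {p q s : ℕ} {f g h : ℕ → α} (h1 : 1 ≤ s) :
    lineUp p q f g h (p + q + s) = h s := by
  have h2 : ¬ p + q + s ≤ p := by omega
  have h3 : ¬ p + q + s ≤ p + q := by omega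
  simp only [lineUp, h2, h3, if_false]
  congr 1; omega

/-- The three parts of a line-up. -/
theorem lineUp_induction {p q r : ℕ} {P : ℕ → Prop} (h1 : ∀ s ∈ Icc 1 p, P s)
    (h2 : ∀ s ∈ Icc 1 q, P (p + s)) (h3 : ∀ s ∈ Icc 1 r, P (p + q + s)) :
    ∀ s ∈ Icc 1 (p + q + r), P s := by
  intro s hs
  rw [mem_Icc] at hs
  by_cases a : s ≤ p
  · exact h1 s (mem_Icc.mpr ⟨hs.1, a⟩)
  · by_cases b : s ≤ p + q
    · have := h2 (s - p) (mem_Icc.mpr ⟨by omega, by omega⟩)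
      rwa [show p + (s - p) = s by omega] at this
    · have := h3 (s - (p + q)) (mem_Icc.mpr ⟨by omega, by omega⟩)
      rwa [show p + q + (s - (p + q)) = s by omega] at this

theorem lineUp_congr {p q r : ℕ} {f f' g g' h h' : ℕ → α} (hf : ∀ s ∈ Icc 1 p, f s = f' s)
    (hg : ∀ s ∈ Icc 1 q, g s = g' s) (hh : ∀ s ∈ Icc 1 r, h s = h' s) :
    ∀ s ∈ Icc 1 (p + q + r), lineUp p q f g h s = lineUp p q f' g' h' s := by
  refine lineUp_induction (fun s hs => ?_) (fun s hs => ?_) fun s hs => ?_ <;>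
    obtain ⟨h1, h2⟩ := mem_Icc.mp hs
  · rw [lineUp_left h2, lineUp_left h2, hf s hs]
  · rw [lineUp_middle h1 h2, lineUp_middle h1 h2, hg s hs]
  · rw [lineUp_right h1, lineUp_right h1, hh s hs]

theorem lineUp_set2 {p q m : ℕ} (hm : m + 2 ≤ q) (f g h : ℕ → α) (x y : α) :
    lineUp p q f (set2 g m x y) h = set2 (lineUp p q f g h) (p + m) x y := by
  funext s
  simp only [lineUp, set2]
  split_ifs <;> first | rfl | omega

/-- Walking back along the left vertical lines of a layer cancels the shift that led to its
northwest corner. -/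
theorem shiftDyn_lineUp (γ : ℂ) (lam : ℕ → ℂ) {p q m : ℕ} (hm : m ≤ q) (f g h : ℕ → ℕ) :
    shiftDyn (-γ) (shiftDyn γ lam f p) (lineUp p q f g h) (p + m) = shiftDyn (-γ) lam g m := by
  induction m with
  | zero =>
    rw [add_zero, shiftDyn_zero, shiftDyn_congr _ _ (t := f) fun s hs =>
      lineUp_left (mem_Icc.mp hs).2]
    funext i; simp only [shiftDyn]; ring
  | succ m ih =>
    rw [← add_assoc, shiftDyn_succ, shiftDyn_succ, ih (by omega), add_assoc,
      lineUp_middle (by omega) hm]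

end lineUp

/-- The partition function depends only on the entries that belong to lines of the lattice. -/
theorem nestedSum_congr (τ γ : ℂ) {k k' LI LI' LII LII' : ℕ → ℕ} {z z' wI wI' wII wII' : ℕ → ℕ → ℂ}
    {cI cI' cII cII' : ℕ → ℕ → ℕ} {M : ℕ} (hk : ∀ p ∈ Icc 1 M, k p = k' p)
    (hLI : ∀ p ∈ Ico 1 M, LI p = LI' p) (hLII : ∀ p ∈ Ico 1 M, LII p = LII' p)
    (hz : ∀ p ∈ Icc 1 M, ∀ j ∈ Icc 1 (k p), z p j = z' p j)
    (hwI : ∀ p ∈ Ico 1 M, ∀ j ∈ Icc 1 (LI p), wI p j = wI' p j)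
    (hwII : ∀ p ∈ Ico 1 M, ∀ j ∈ Icc 1 (LII p), wII p j = wII' p j)
    (hcI : ∀ p ∈ Ico 1 M, ∀ j ∈ Icc 1 (LI p), cI p j = cI' p j)
    (hcII : ∀ p ∈ Ico 1 M, ∀ j ∈ Icc 1 (LII p), cII p j = cII' p j)
    {n : ℕ} {w w' : ℕ → ℂ} {t t' : ℕ → ℕ} (lam : ℕ → ℂ)
    (hw : ∀ s ∈ Icc 1 n, w s = w' s) (ht : ∀ s ∈ Icc 1 n, t s = t' s) :
    nestedSum τ γ k LI LII z wI wII cI cII M n w t lam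
      = nestedSum τ γ k' LI' LII' z' wI' wII' cI' cII' M n w' t' lam := by
  induction M generalizing n w w' t t' lam with
  | zero => rfl
  | succ M ih =>
    have hsub : ∀ p ∈ Icc 1 M, p ∈ Icc 1 (M + 1) := Icc_subset_Icc_right (by omega)
    have hsub' : ∀ p ∈ Ico 1 M, p ∈ Ico 1 (M + 1) := Ico_subset_Ico_right (by omega)
    have hM : M + 1 ∈ Icc 1 (M + 1) := by simp
    have hz' := hz _ hM
    simp only [nestedSum]
    rw [← hk _ hM]
    refine sum_congr rfl fun e _ => ?_
    rw [layerWeight_congr τ γ (M + 2) lam hz' hw (fun _ _ => rfl) (fun _ _ => rfl) ht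
      fun _ _ => rfl]
    congr 1
    rcases Nat.eq_zero_or_pos M with rfl | h0
    · rfl
    have hM' : M ∈ Ico 1 (M + 1) := by simp; omega
    rw [← hLI _ hM', ← hLII _ hM', shiftDyn_congr γ lam (hcI _ hM')]
    exact ih (fun p hp => hk p (hsub p hp)) (fun p hp => hLI p (hsub' p hp))
      (fun p hp => hLII p (hsub' p hp)) (fun p hp => hz p (hsub p hp))
      (fun p hp => hwI p (hsub' p hp)) (fun p hp => hwII p (hsub' p hp))
      (fun p hp => hcI p (hsub' p hp)) (fun p hp => hcII p (hsub' p hp)) _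
      (lineUp_congr (hwI _ hM') hz' (hwII _ hM'))
      (lineUp_congr (hcI _ hM') (fun _ _ => rfl) (hcII _ hM'))

section differentiable
variable {τ : ℂ}

theorem differentiable_vertexWeight (hτ : 0 < τ.im) (γ : ℂ) (lam : ℕ → ℂ) {z w : ℂ → ℂ} (hz : Differentiable ℂ z)
    (hw : Differentiable ℂ w) (a b a' b' : ℕ) :
    Differentiable ℂ fun y => vertexWeight τ γ lam (z y) (w y) a b a' b' := by
  have h : ∀ {f : ℂ → ℂ}, Differentiable ℂ f → Differentiable ℂ fun y => theta τ (f y) :=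
    fun hf => (differentiable_theta hτ).comp hf
  have h1 := h ((hz.sub hw).sub_const γ)
  have h2 := h (hz.sub hw)
  have h3 := h ((hz.sub hw).add_const (lam a' - lam a))
  simp only [vertexWeight, alphaWeight, betaWeight]
  simp only [Pi.sub_apply] at h1 h2 h3
  split_ifs <;> fun_prop

theorem differentiable_rowWeight (hτ : 0 < τ.im) (γ : ℂ) (N : ℕ) (lam : ℕ → ℂ) {z : ℂ → ℂ} {w : ℂ → ℕ → ℂ}
    (hz : Differentiable ℂ z) (hw : ∀ j, Differentiable ℂ fun y => w y j) (b t : ℕ → ℕ)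
    (n a a' : ℕ) : Differentiable ℂ fun y => rowWeight τ γ N lam (z y) (w y) b t n a a' := by
  induction n generalizing a' with
  | zero => exact differentiable_const _
  | succ n ih =>
    simp only [rowWeight]
    exact Differentiable.fun_sum fun x _ =>
      (ih x).mul (differentiable_vertexWeight hτ γ _ hz (hw _) _ _ _ _)

theorem differentiable_layerWeight (hτ : 0 < τ.im) (γ : ℂ) (N : ℕ) (lam : ℕ → ℂ) (n : ℕ) {z w : ℂ → ℕ → ℂ}
    (hz : ∀ j, Differentiable ℂ fun y => z y j) (hw : ∀ j, Differentiable ℂ fun y => w y j)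
    (l r t : ℕ → ℕ) (m : ℕ) (b : ℕ → ℕ) :
    Differentiable ℂ fun y => layerWeight τ γ N lam n (z y) (w y) l r t m b := by
  induction m generalizing b with
  | zero => exact differentiable_const _
  | succ m ih =>
    simp only [layerWeight]
    exact Differentiable.fun_sum fun u _ =>
      (ih _).mul (differentiable_rowWeight hτ γ N _ (hz _) hw _ _ _ _ _)

theorem differentiable_nestedSum (hτ : 0 < τ.im) (γ : ℂ) (k LI LII : ℕ → ℕ) {z : ℂ → ℕ → ℕ → ℂ}
    (hz : ∀ p j, Differentiable ℂ fun y => z y p j) (wI wII : ℕ → ℕ → ℂ) (cI cII : ℕ → ℕ → ℕ)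
    (M n : ℕ) {w : ℂ → ℕ → ℂ} (hw : ∀ j, Differentiable ℂ fun y => w y j) (t : ℕ → ℕ)
    (lam : ℕ → ℂ) :
    Differentiable ℂ fun y => nestedSum τ γ k LI LII (z y) wI wII cI cII M n (w y) t lam := by
  induction M generalizing n w t lam with
  | zero => exact differentiable_const _
  | succ M ih =>
    simp only [nestedSum]
    refine Differentiable.fun_sum fun e _ =>
      (differentiable_layerWeight hτ γ _ _ _ (hz _) hw _ _ _ _ _).mul (ih _ (fun j => ?_) _ _)
    simp only [lineUp]
    have := hz (M + 1)
    split_ifs <;> fun_prop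

end differentiable

/-! ### Symmetry in the horizontal parameters of the top layer -/

/-- The pair sum over the outgoing colours of a vertex does not depend on the number of colours. -/
theorem sum_vertexWeight_mul_eq {τ γ : ℂ} {lam : ℕ → ℂ} {z w : ℂ} {N N' a b : ℕ}
    (ha : a ∈ Icc 1 N) (hb : b ∈ Icc 1 N) (hN : N ≤ N') (f : ℕ → ℕ → ℂ) :
    ∑ x ∈ Icc 1 N', ∑ y ∈ Icc 1 N', vertexWeight τ γ lam z w a b x y * f x y
      = ∑ x ∈ Icc 1 N, ∑ y ∈ Icc 1 N, vertexWeight τ γ lam z w a b x y * f x y := by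
  rw [sum_vertexWeight_mul ha hb, sum_vertexWeight_mul (Icc_subset_Icc_right hN ha)
    (Icc_subset_Icc_right hN hb)]

section nested
variable {τ γ : ℂ} {k LI LII : ℕ → ℕ} {z wI wII : ℕ → ℕ → ℂ} {cI cII : ℕ → ℕ → ℕ}

/-- The crossing of two vertical lines above the top layer is moved to the bottom of that layer,
where it becomes a scalar since the two bottom ends have the same colour. -/
theorem nestedSum_exchange (hτ : 0 < τ.im) {M : ℕ} {lam : ℕ → ℂ}
    (hlam : IsGeneric τ γ (M + 1) lam) {n m : ℕ} (hm : m + 2 ≤ n) (w : ℕ → ℂ) {t : ℕ → ℕ}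
    (ht : M ≠ 0 → ∀ s ∈ Icc 1 n, t s ∈ Icc 1 (M + 1))
    (ht₁ : t (m + 1) ∈ Icc 1 (M + 1)) (ht₂ : t (m + 2) ∈ Icc 1 (M + 1)) :
    ∑ x ∈ Icc 1 (M + 1), ∑ y ∈ Icc 1 (M + 1),
        nestedSum τ γ k LI LII z wI wII cI cII M n w (set2 t m x y) lam *
        vertexWeight τ γ (shiftDyn (-γ) lam t m) (w (m + 1)) (w (m + 2)) x y
          (t (m + 2)) (t (m + 1))
      = theta τ (w (m + 1) - w (m + 2) - γ) *
        nestedSum τ γ k LI LII z wI wII cI cII M n (set2 w m (w (m + 2)) (w (m + 1))) t lam := by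
  cases M with
  | zero =>
    have h1 : t (m + 1) = 1 := by simpa using ht₁
    have h2 : t (m + 2) = 1 := by simpa using ht₂
    simp [nestedSum, h1, h2, vertexWeight_self]
  | succ M =>
    simp only [nestedSum, sum_mul, mul_sum]
    rw [sum_last_first₃]
    refine sum_congr rfl fun e _ => ?_
    have h := layerWeight_exchange_columns hτ hlam (z (M + 1)) w (toColours e) (fun _ => M + 2)
      (t := t) (b := fun _ => M + 2) hm (ht (by omega)) (fun _ _ => by simp) (k (M + 1))
    simp only [mul_right_comm _ _ (vertexWeight _ _ _ _ _ _ _ _ _)]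
    simp only [← sum_mul]
    rw [h, ← mul_assoc]
    congr 1
    have hN : M + 2 ∈ Icc 1 (M + 1 + 1) := by simp
    rw [sum_eq_single_of_mem (M + 2) hN, sum_eq_single_of_mem (M + 2) hN, vertexWeight_self]
    · rw [if_pos ⟨rfl, rfl⟩]
      congr 2
      exact set2_self (fun _ => M + 2) m
    · intro x _ hx; rw [vertexWeight_self, if_neg (fun h => hx h.2), zero_mul]
    · intro y _ hy
      exact sum_eq_zero fun x _ => by rw [vertexWeight_self, if_neg (fun h => hy h.1), zero_mul]

/-- The two sides of the exchange of adjacent horizontal lines agree up to the factor by which the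
crossing of these lines is attached on the left and removed on the right. -/
theorem theta_mul_nestedSum_swap (hτ : 0 < τ.im) {M : ℕ} {lam : ℕ → ℂ}
    (hlam : IsGeneric τ γ (M + 2) lam)
    (hcI : M ≠ 0 → ∀ s ∈ Icc 1 (LI M), cI M s ∈ Icc 1 (M + 1))
    (hcII : M ≠ 0 → ∀ s ∈ Icc 1 (LII M), cII M s ∈ Icc 1 (M + 1))
    {m : ℕ} (hm : m + 2 ≤ k (M + 1)) (n : ℕ) (w : ℕ → ℂ) (t : ℕ → ℕ) :
    theta τ (z (M + 1) (m + 1) - z (M + 1) (m + 2) - γ) *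
        nestedSum τ γ k LI LII z wI wII cI cII (M + 1) n w t lam
      = theta τ (z (M + 1) (m + 1) - z (M + 1) (m + 2) - γ) *
        nestedSum τ γ k LI LII (Function.update z (M + 1)
          (set2 (z (M + 1)) m (z (M + 1) (m + 2)) (z (M + 1) (m + 1))))
          wI wII cI cII (M + 1) n w t lam := by
  set Z := z (M + 1) with hZ
  set Z' := set2 Z m (Z (m + 2)) (Z (m + 1)) with hZ'
  have hcong : ∀ (n : ℕ) (w : ℕ → ℂ) (t : ℕ → ℕ) (lam : ℕ → ℂ),
      nestedSum τ γ k LI LII (Function.update z (M + 1) Z') wI wII cI cII M n w t lam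
        = nestedSum τ γ k LI LII z wI wII cI cII M n w t lam := by
    intro n w t lam
    refine nestedSum_congr τ γ (fun _ _ => rfl) (fun _ _ => rfl) (fun _ _ => rfl) ?_
      (fun _ _ _ _ => rfl) (fun _ _ _ _ => rfl) (fun _ _ _ _ => rfl) (fun _ _ _ _ => rfl) _
      (fun _ _ => rfl) (fun _ _ => rfl)
    intro p hp j _
    rw [Function.update_of_ne]
    rw [mem_Icc] at hp; omega
  simp only [nestedSum, hcong, Function.update_self, ← hZ]
  set lam' := shiftDyn γ lam (cI M) (LI M) with hlam'
  set W := lineUp (LI M) (k (M + 1)) (wI M) Z (wII M) with hW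
  set T := fun e => lineUp (LI M) (k (M + 1)) (cI M) e (cII M) with hT
  set G := fun (w : ℕ → ℂ) (e : ℕ → ℕ) => nestedSum τ γ k LI LII z wI wII cI cII M
    (LI M + k (M + 1) + LII M) w (T e) lam' with hG
  set K := fun l => layerWeight τ γ (M + 2) lam n Z' w l (fun _ => M + 2) t (k (M + 1))
    fun _ => M + 2 with hK
  have hWm1 : W (LI M + m + 1) = Z (m + 1) :=
    lineUp_middle (s := m + 1) (by omega) (by omega)
  have hWm2 : W (LI M + m + 2) = Z (m + 2) :=
    lineUp_middle (s := m + 2) (by omega) (by omega)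
  have hemem : ∀ (e : Fin (k (M + 1)) → Fin (M + 1)), ∀ s ∈ Icc 1 (k (M + 1)),
      toColours e s ∈ Icc 1 (M + 1) := fun e s hs => toColours_mem e hs
  have hTm1 : ∀ e : Fin (k (M + 1)) → Fin (M + 1),
      T (toColours e) (LI M + m + 1) = toColours e (m + 1) :=
    fun e => lineUp_middle (s := m + 1) (by omega) (by omega)
  have hTm2 : ∀ e : Fin (k (M + 1)) → Fin (M + 1),
      T (toColours e) (LI M + m + 2) = toColours e (m + 2) :=
    fun e => lineUp_middle (s := m + 2) (by omega) (by omega)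
  have hm1 : m + 1 ∈ Icc 1 (k (M + 1)) := by simp; omega
  have hm2 : m + 2 ∈ Icc 1 (k (M + 1)) := by simp; omega
  -- attach the crossing on the left, hand it over to the layer below, and move it out at the bottom
  calc
    _ = ∑ e : Fin (k (M + 1)) → Fin (M + 1), ∑ x ∈ Icc 1 (M + 1), ∑ y ∈ Icc 1 (M + 1),
        vertexWeight τ γ (shiftDyn (-γ) lam (toColours e) m) (Z (m + 1)) (Z (m + 2))
          (toColours e (m + 1)) (toColours e (m + 2)) y x *
          (K (set2 (toColours e) m x y) * G W (toColours e)) := by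
      rw [mul_sum]
      refine sum_congr rfl fun e _ => ?_
      rw [← mul_assoc, layerWeight_exchange_rows hτ hlam Z w t hm
        (fun s hs => Icc_subset_Icc_right (by omega) (hemem e s hs)) (fun _ _ => by simp)
        (c := M + 2) (by simp) rfl rfl,
        sum_vertexWeight_mul_eq (hemem e _ hm1) (hemem e _ hm2) (by omega), sum_comm]
      simp only [sum_mul, ← mul_assoc]
      rfl
    _ = ∑ e : Fin (k (M + 1)) → Fin (M + 1), ∑ x ∈ Icc 1 (M + 1), ∑ y ∈ Icc 1 (M + 1),
        vertexWeight τ γ (shiftDyn (-γ) lam (toColours e) m) (Z (m + 1)) (Z (m + 2)) x y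
          (toColours e (m + 2)) (toColours e (m + 1)) *
          (K (toColours e) * G W (set2 (toColours e) m x y)) := by
      rw [sum_toColours_set2 hm (F := fun f x y =>
        vertexWeight τ γ (shiftDyn (-γ) lam f m) (Z (m + 1)) (Z (m + 2))
          (f (m + 1)) (f (m + 2)) y x * (K (set2 f m x y) * G W f))]
      · refine sum_congr rfl fun e _ => sum_congr rfl fun x _ => sum_congr rfl fun y _ => ?_
        rw [set2_fst, set2_snd, set2_set2, set2_self, shiftDyn_congr (-γ) lam
          fun s hs => set2_of_le _ _ _ _ (mem_Icc.mp hs).2]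
      · intro x y f g h
        dsimp only
        rw [h _ hm1, h _ hm2, shiftDyn_congr (-γ) lam
          fun s hs => h s (Icc_subset_Icc_right (by omega) hs)]
        congr 2
        · exact layerWeight_congr _ _ _ _ (fun _ _ => rfl) (fun _ _ => rfl) (set2_congr h _ _ _)
            (fun _ _ => rfl) (fun _ _ => rfl) (fun _ _ => rfl)
        · exact nestedSum_congr τ γ (fun _ _ => rfl) (fun _ _ => rfl) (fun _ _ => rfl)
            (fun _ _ _ _ => rfl) (fun _ _ _ _ => rfl) (fun _ _ _ _ => rfl) (fun _ _ _ _ => rfl)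
            (fun _ _ _ _ => rfl) _ (fun _ _ => rfl)
            (lineUp_congr (fun _ _ => rfl) h (fun _ _ => rfl))
    _ = _ := by
      rw [mul_sum]
      refine sum_congr rfl fun e _ => ?_
      have hmem : M ≠ 0 → ∀ s ∈ Icc 1 (LI M + k (M + 1) + LII M),
          T (toColours e) s ∈ Icc 1 (M + 1) := fun h0 =>
        lineUp_induction (fun s hs => by
            rw [hT]; dsimp only; rw [lineUp_left (mem_Icc.mp hs).2]; exact hcI h0 s hs)
          (fun s hs => by
            rw [hT]; dsimp only; rw [lineUp_middle (mem_Icc.mp hs).1 (mem_Icc.mp hs).2]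
            exact hemem e s hs)
          (fun s hs => by
            rw [hT]; dsimp only; rw [lineUp_right (mem_Icc.mp hs).1]; exact hcII h0 s hs)
      have h := nestedSum_exchange (k := k) (LI := LI) (LII := LII) (z := z) (wI := wI)
        (wII := wII) (cI := cI) (cII := cII) hτ (M := M) (lam := lam')
        ((hlam.mono (by omega)).shiftDyn_pos _ _) (n := LI M + k (M + 1) + LII M) (m := LI M + m)
        (by omega) W hmem (by rw [hTm1]; exact hemem e _ hm1) (by rw [hTm2]; exact hemem e _ hm2)
      have hshift : shiftDyn (-γ) lam' (T (toColours e)) (LI M + m)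
          = shiftDyn (-γ) lam (toColours e) m := shiftDyn_lineUp γ lam (by omega) _ _ _
      rw [hshift, hTm1, hTm2, hWm1, hWm2] at h
      have hset : ∀ x y, G W (set2 (toColours e) m x y)
          = nestedSum τ γ k LI LII z wI wII cI cII M (LI M + k (M + 1) + LII M) W
            (set2 (T (toColours e)) (LI M + m) x y) lam' := by
        intro x y
        rw [hG]; dsimp only; rw [hT]; dsimp only
        rw [lineUp_set2 hm]
      rw [lineUp_set2 hm, mul_left_comm, ← h]
      simp only [mul_sum, hset]
      exact sum_congr rfl fun x _ => sum_congr rfl fun y _ => by ring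

/-- Exchanging two adjacent horizontal parameters of the top layer. Where the factor of
`theta_mul_nestedSum_swap` vanishes, the identity follows by continuity. -/
theorem nestedSum_swap (hτ : 0 < τ.im) {M : ℕ} {lam : ℕ → ℂ}
    (hlam : IsGeneric τ γ (M + 2) lam)
    (hcI : M ≠ 0 → ∀ s ∈ Icc 1 (LI M), cI M s ∈ Icc 1 (M + 1))
    (hcII : M ≠ 0 → ∀ s ∈ Icc 1 (LII M), cII M s ∈ Icc 1 (M + 1))
    {m : ℕ} (hm : m + 2 ≤ k (M + 1)) (n : ℕ) (w : ℕ → ℂ) (t : ℕ → ℕ) (Z : ℕ → ℂ) :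
    nestedSum τ γ k LI LII (Function.update z (M + 1) Z) wI wII cI cII (M + 1) n w t lam
      = nestedSum τ γ k LI LII (Function.update z (M + 1) (set2 Z m (Z (m + 2)) (Z (m + 1))))
          wI wII cI cII (M + 1) n w t lam := by
  -- vary the first of the two parameters: the factor in front is not identically zero
  let A : ℂ → ℂ := fun y => nestedSum τ γ k LI LII
    (Function.update z (M + 1) (set2 Z m (Z (m + 2) + y + γ) (Z (m + 2))))
    wI wII cI cII (M + 1) n w t lam
  let B : ℂ → ℂ := fun y => nestedSum τ γ k LI LII
    (Function.update z (M + 1) (set2 Z m (Z (m + 2)) (Z (m + 2) + y + γ)))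
    wI wII cI cII (M + 1) n w t lam
  have hdiff : ∀ f g : ℂ → ℂ, Differentiable ℂ f → Differentiable ℂ g → ∀ p j,
      Differentiable ℂ fun y => Function.update z (M + 1) (set2 Z m (f y) (g y)) p j := by
    intro f g hf hg p j
    by_cases hp : p = M + 1
    · subst hp
      simp only [Function.update_self, set2]
      split_ifs <;> fun_prop
    · simp only [Function.update_of_ne hp]
      fun_prop
  have hA : Continuous A := (differentiable_nestedSum hτ γ k LI LII
    (hdiff _ _ (by fun_prop) (by fun_prop)) wI wII cI cII (M + 1) n (fun _ => by fun_prop) t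
    lam).continuous
  have hB : Continuous B := (differentiable_nestedSum hτ γ k LI LII
    (hdiff _ _ (by fun_prop) (by fun_prop)) wI wII cI cII (M + 1) n (fun _ => by fun_prop) t
    lam).continuous
  have hne : theta τ (lam 1 - lam 2) ≠ 0 := by
    have := hlam 1 (by simp) 2 (by simp) (by omega) 0
    simpa using this
  have hAB : A = B := by
    refine hA.ext_on (dense_theta_ne_zero hτ hne) hB fun y hy => ?_
    have h := theta_mul_nestedSum_swap (z := Function.update z (M + 1)
      (set2 Z m (Z (m + 2) + y + γ) (Z (m + 2)))) (wI := wI) (wII := wII) hτ hlam hcI hcII hm n w t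
    simp only [Function.update_self, set2_fst, set2_snd, set2_set2, Function.update_idem,
      show Z (m + 2) + y + γ - Z (m + 2) - γ = y by ring]
      at h
    exact mul_left_cancel₀ hy h
  have h := congrFun hAB (Z (m + 1) - Z (m + 2) - γ)
  simp only [A, B, show Z (m + 2) + (Z (m + 1) - Z (m + 2) - γ) + γ = Z (m + 1) by ring,
    set2_self] at h
  exact h

end nested

/-- A function of sequences that is invariant under exchanging adjacent entries among the first
`k` is invariant under all permutations of the first `k` entries. -/
theorem eq_comp_perm {α β : Type*} {k : ℕ} {G : (ℕ → α) → β}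
    (hG : ∀ (Z : ℕ → α) (m : ℕ), m + 2 ≤ k → G Z = G (set2 Z m (Z (m + 2)) (Z (m + 1))))
    (σ : Equiv.Perm ℕ) (hσ : ∀ j, j ∉ Icc 1 k → σ j = j) (Z : ℕ → α) :
    G (fun j => Z (σ j)) = G Z := by
  induction k generalizing σ with
  | zero =>
    have : σ = 1 := Equiv.ext fun j => hσ j (by simp)
    subst this; rfl
  | succ k ih =>
    -- adjacent exchanges move the entry `k + 1` to its place
    obtain ⟨d, hd⟩ : ∃ d, k + 1 - σ.symm (k + 1) = d := ⟨_, rfl⟩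
    induction d generalizing σ with
    | zero =>
      have hle : σ.symm (k + 1) ≤ k + 1 := by
        by_contra h
        have := hσ (σ.symm (k + 1)) (by simp; omega)
        rw [Equiv.apply_symm_apply] at this
        omega
      have hfix : σ (k + 1) = k + 1 := ((Equiv.symm_apply_eq σ).mp (by omega)).symm
      refine ih (fun Z m hm => hG Z m (by omega)) σ fun j hj => ?_
      by_cases h : j = k + 1
      · rw [h, hfix]
      · exact hσ j (by simp at hj ⊢; omega)
    | succ d ihd =>
      obtain ⟨m, hm⟩ : ∃ m, σ.symm (k + 1) = m + 1 := by
        refine Nat.exists_eq_succ_of_ne_zero fun h => ?_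
        have h1 := (Equiv.symm_apply_eq σ).mp h
        have h2 := hσ 0 (by simp)
        omega
      have hne : ∀ j, j ∉ Icc 1 (k + 1) → Equiv.swap (m + 1) (m + 2) j = j := fun j hj =>
        Equiv.swap_apply_of_ne_of_ne (by rintro rfl; simp at hj; omega)
          (by rintro rfl; simp at hj; omega)
      rw [← ihd ((Equiv.swap (m + 1) (m + 2)).trans σ)
        (fun j hj => by rw [Equiv.trans_apply, hne j hj, hσ j hj])
        (by rw [Equiv.symm_trans_apply, hm, Equiv.symm_swap, Equiv.swap_apply_left]; omega),
        hG (fun j => Z (σ j)) m (by omega)]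
      congr 1
      funext j
      simp only [set2, Equiv.trans_apply]
      split_ifs with h1 h2
      · rw [h1, Equiv.swap_apply_left]
      · rw [h2, Equiv.swap_apply_right]
      · rw [Equiv.swap_apply_of_ne_of_ne h1 h2]

/-! ### One column of a layer -/

/-- One vertical line with parameter `w` crossing horizontal lines `1, …, m` (from top to bottom)
with parameters `z 1, …, z m`, left colours `l`, right colours `r`; `t` and the last argument are
the colours at the top and bottom end. The colours of the inner edges are summed over `{1, …, N}`;
`lam` belongs to the face at the upper left of the column. -/
noncomputable def colWeight (τ γ : ℂ) (N : ℕ) (lam : ℕ → ℂ) (z : ℕ → ℂ) (w : ℂ) (l r : ℕ → ℕ)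
    (t : ℕ) : ℕ → ℕ → ℂ
  | 0, b => if t = b then 1 else 0
  | m + 1, b => ∑ x ∈ Icc 1 N, colWeight τ γ N lam z w l r t m x *
      vertexWeight τ γ (shiftDyn (-γ) lam l m) (z (m + 1)) w (l (m + 1)) b (r (m + 1)) x

theorem colWeight_congr (τ γ : ℂ) (N : ℕ) (lam : ℕ → ℂ) (z : ℕ → ℂ) (w : ℂ) {l l' : ℕ → ℕ}
    (r : ℕ → ℕ) (t : ℕ) {m : ℕ} (hl : ∀ s ∈ Icc 1 m, l s = l' s) (b : ℕ) :
    colWeight τ γ N lam z w l r t m b = colWeight τ γ N lam z w l' r t m b := by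
  induction m generalizing b with
  | zero => rfl
  | succ m ih =>
    have hs : Icc 1 m ⊆ Icc 1 (m + 1) := Icc_subset_Icc_right (by omega)
    simp only [colWeight]
    rw [hl (m + 1) (by simp), shiftDyn_congr _ _ fun s h => hl s (hs h)]
    exact sum_congr rfl fun x _ => by rw [ih fun s h => hl s (hs h)]

/-- The last column of a layer is split off. -/
theorem layerWeight_succ_column (τ γ : ℂ) (N : ℕ) (lam : ℕ → ℂ) (n : ℕ) (z w : ℕ → ℂ)
    (l r t : ℕ → ℕ) (R : ℕ) (b : ℕ → ℕ) :
    layerWeight τ γ N lam (n + 1) z w l r t R b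
      = ∑ ρ : Fin R → Fin N, layerWeight τ γ N lam n z w l (toColours ρ) t R b *
          colWeight τ γ N (shiftDyn (-γ) lam t n) z (w (n + 1)) (toColours ρ) r (t (n + 1)) R
            (b (n + 1)) := by
  induction R generalizing b with
  | zero => simp [layerWeight, colWeight, prod_Icc_succ_top]
  | succ R ih =>
    have hL : ∀ f, DependsOnFirst (n + 1) fun u => layerWeight τ γ N lam (n + 1) z w l r t R u *
        rowWeight τ γ N (shiftDyn (-γ) lam l R) (z (R + 1)) w b u (n + 1) (l (R + 1)) f :=
      fun f => dependsOnFirst_layerWeight_mul_rowWeight _ _ _ _ _ _ _ _ _ _ _ _ _ _ _ _ _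
    have hR : DependsOnFirst (R + 1) fun ρ => layerWeight τ γ N lam n z w l ρ t (R + 1) b *
          colWeight τ γ N (shiftDyn (-γ) lam t n) z (w (n + 1)) ρ r (t (n + 1)) (R + 1)
            (b (n + 1)) := fun f g h => by
      dsimp only
      rw [colWeight_congr _ _ _ _ _ _ _ _ h, layerWeight_congr τ γ N lam (fun _ _ => rfl)
        (fun _ _ => rfl) (fun _ _ => rfl) h (fun _ _ => rfl) (fun _ _ => rfl)]
    -- the last row and the last column are split off simultaneously, in two orders
    rw [layerWeight, sum_toColours_succ (hL _), sum_toColours_succ hR]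
    have h1 : ∀ (v : Fin n → Fin N) (x : ℕ),
        ∀ s ∈ Icc 1 n, Function.update (toColours v) (n + 1) x s = toColours v s :=
      fun v x s hs => Function.update_of_ne (by rw [mem_Icc] at hs; omega) _ _
    have h2 : ∀ (v : Fin R → Fin N) (x : ℕ),
        ∀ s ∈ Icc 1 R, Function.update (toColours v) (R + 1) x s = toColours v s :=
      fun v x s hs => Function.update_of_ne (by rw [mem_Icc] at hs; omega) _ _
    have h3 : ∀ (v : Fin n → Fin N) (x : ℕ) (ρ : Fin R → Fin N),
        layerWeight τ γ N lam n z w l (toColours ρ) t R (Function.update (toColours v) (n + 1) x)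
          = layerWeight τ γ N lam n z w l (toColours ρ) t R (toColours v) := fun v x ρ =>
      layerWeight_congr τ γ N lam (fun _ _ => rfl) (fun _ _ => rfl) (fun _ _ => rfl)
        (fun _ _ => rfl) (fun _ _ => rfl) (h1 v x)
    have h4 : ∀ (v : Fin n → Fin N) (ρ : Fin R → Fin N) (y : ℕ),
        layerWeight τ γ N lam n z w l (Function.update (toColours ρ) (R + 1) y) t R (toColours v)
          = layerWeight τ γ N lam n z w l (toColours ρ) t R (toColours v) := fun v ρ y =>
      layerWeight_congr τ γ N lam (fun _ _ => rfl) (fun _ _ => rfl) (fun _ _ => rfl)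
        (h2 ρ y) (fun _ _ => rfl) (fun _ _ => rfl)
    have h5 : ∀ (v : Fin n → Fin N) (x y : ℕ),
        rowWeight τ γ N (shiftDyn (-γ) lam l R) (z (R + 1)) w b
          (Function.update (toColours v) (n + 1) x) n (l (R + 1)) y
        = rowWeight τ γ N (shiftDyn (-γ) lam l R) (z (R + 1)) w b (toColours v) n (l (R + 1)) y :=
      fun v x y => rowWeight_congr _ _ _ _ _ (fun _ _ => rfl) (fun _ _ => rfl) (h1 v x) _ _
    simp only [ih, h3, rowWeight, layerWeight, colWeight, h4, h5, Function.update_self,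
      colWeight_congr _ _ _ _ _ _ _ _ (h2 _ _), shiftDyn_congr _ _ (h1 _ _),
      shiftDyn_congr _ _ (h2 _ _)]
    calc
      _ = ∑ v : Fin n → Fin N, ∑ x ∈ Icc 1 N, ∑ ρ : Fin R → Fin N, ∑ y ∈ Icc 1 N,
          layerWeight τ γ N lam n z w l (toColours ρ) t R (toColours v) *
          rowWeight τ γ N (shiftDyn (-γ) lam l R) (z (R + 1)) w b (toColours v) n (l (R + 1)) y *
          (colWeight τ γ N (shiftDyn (-γ) lam t n) z (w (n + 1)) (toColours ρ) r (t (n + 1)) R x *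
          vertexWeight τ γ (shiftDyn (-γ) (shiftDyn (-γ) lam t n) (toColours ρ) R) (z (R + 1))
            (w (n + 1)) y (b (n + 1)) (r (R + 1)) x) := by
        refine sum_congr rfl fun v _ => sum_congr rfl fun x _ => ?_
        rw [sum_mul]
        refine sum_congr rfl fun ρ _ => ?_
        rw [mul_sum]
        refine sum_congr rfl fun y _ => ?_
        by_cases h0 : layerWeight τ γ N lam n z w l (toColours ρ) t R (toColours v) = 0
        · simp [h0]
        · rw [layerWeight_conserve h0]; ring
      _ = _ := by
        rw [sum_swap_pairs]
        simp only [sum_mul_sum]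

section column
variable {τ γ : ℂ} {N : ℕ} {lam : ℕ → ℂ} {z : ℕ → ℂ} {w : ℂ} {l : ℕ → ℕ} {m : ℕ}

theorem shiftDyn_of_const (g : ℂ) (lam : ℕ → ℂ) {t : ℕ → ℕ} {n : ℕ}
    (ht : ∀ s ∈ Icc 1 n, t s = N) (i : ℕ) :
    shiftDyn g lam t n i = if i = N then lam i + g * n else lam i := by
  simp only [shiftDyn]
  split_ifs with h
  · rw [filter_true_of_mem fun s hs => (ht s hs).trans h.symm]; simp
  · rw [filter_false_of_mem fun s hs h' => h (h'.symm.trans (ht s hs))]; simp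

theorem forall_Icc_succ {P : ℕ → Prop} :
    (∀ s ∈ Icc 1 (m + 1), P s) ↔ P (m + 1) ∧ ∀ s ∈ Icc 1 m, P s := by
  constructor
  · exact fun h => ⟨h _ (by simp), fun s hs => h s (Icc_subset_Icc_right (by omega) hs)⟩
  · rintro ⟨h1, h2⟩ s hs
    rcases eq_or_ne s (m + 1) with rfl | h
    · exact h1
    · exact h2 s (by rw [mem_Icc] at *; omega)

/-- All right ends carrying the highest colour, a column with another colour at its bottom end is
frozen. -/
theorem colWeight_bottom_ne (hl : ∀ s ∈ Icc 1 m, l s ∈ Icc 1 N) {t b : ℕ} (hb : b ∈ Icc 1 N)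
    (hbN : b ≠ N) :
    colWeight τ γ N lam z w l (fun _ => N) t m b
      = if t = b ∧ ∀ s ∈ Icc 1 m, l s = N then
          ∏ s ∈ Icc 1 m, alphaWeight τ γ (z s - w) (lam N - lam b - γ * ((s : ℂ) - 1))
        else 0 := by
  induction m with
  | zero => simp [colWeight]
  | succ m ih =>
    rw [forall_Icc_succ] at hl
    simp only [colWeight, mul_comm (colWeight _ _ _ _ _ _ _ _ _ _ _), forall_Icc_succ]
    rw [sum_vertexWeight_top hl.1 hb, ih hl.2]
    by_cases h1 : l (m + 1) = b
    · have : ¬ l (m + 1) = N := fun h => hbN (h1.symm.trans h)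
      simp [h1, hbN.symm, hbN]
    · rw [if_neg h1, if_neg (c := N = b) (Ne.symm hbN), add_zero]
      by_cases h2 : l (m + 1) = N
      · simp only [h2, true_and, if_true]
        by_cases h3 : t = b ∧ ∀ s ∈ Icc 1 m, l s = N
        · rw [if_pos h3, if_pos h3, prod_Icc_succ_top (by omega), mul_comm]
          rw [shiftDyn_of_const _ _ h3.2, shiftDyn_of_const _ _ h3.2, if_pos rfl, if_neg hbN]
          congr 2
          push_cast; ring
        · rw [if_neg h3, if_neg h3, mul_zero]
      · simp [h2, Ne.symm h2]

/-- The recursion for a column with the highest colour at its bottom end: either the last left colour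
is the highest one, or the colour of the top end leaves the column at the last vertex. -/
theorem colWeight_succ_bottom_top (hl : ∀ s ∈ Icc 1 (m + 1), l s ∈ Icc 1 N) {t : ℕ}
    (hN : 1 ≤ N) :
    colWeight τ γ N lam z w l (fun _ => N) t (m + 1) N
      = if l (m + 1) = N then
          theta τ (z (m + 1) - w - γ) * colWeight τ γ N lam z w l (fun _ => N) t m N
        else if t = l (m + 1) ∧ ∀ s ∈ Icc 1 m, l s = N then
          betaWeight τ γ (z (m + 1) - w) (lam N - lam t - γ * m) *
          ∏ s ∈ Icc 1 m, alphaWeight τ γ (z s - w) (lam N - lam t - γ * ((s : ℂ) - 1))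
        else 0 := by
  rw [forall_Icc_succ] at hl
  rw [colWeight]
  simp only [mul_comm (colWeight _ _ _ _ _ _ _ _ _ _ _)]
  rw [sum_vertexWeight_top hl.1 (by simpa using hN)]
  by_cases h1 : l (m + 1) = N
  · simp [h1]
  · rw [if_neg h1, if_neg h1, if_neg (Ne.symm h1), if_pos rfl, zero_add,
      colWeight_bottom_ne hl.2 hl.1 h1]
    by_cases h3 : t = l (m + 1) ∧ ∀ s ∈ Icc 1 m, l s = N
    · rw [if_pos h3, if_pos h3, shiftDyn_of_const _ _ h3.2, shiftDyn_of_const _ _ h3.2, if_pos rfl,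
        if_neg h1, ← h3.1]
      congr 2
      ring
    · rw [if_neg h3, if_neg h3, mul_zero]

/-- A column with the highest colour at both ends is frozen. -/
theorem colWeight_top_top (hl : ∀ s ∈ Icc 1 m, l s ∈ Icc 1 N) (hN : 1 ≤ N) :
    colWeight τ γ N lam z w l (fun _ => N) N m N
      = if ∀ s ∈ Icc 1 m, l s = N then ∏ s ∈ Icc 1 m, theta τ (z s - w - γ) else 0 := by
  induction m with
  | zero => simp [colWeight]
  | succ m ih =>
    rw [colWeight_succ_bottom_top hl hN, ih (forall_Icc_succ.mp hl).2]
    simp only [forall_Icc_succ]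
    by_cases h1 : l (m + 1) = N
    · simp only [h1, if_true, true_and]
      split_ifs with h
      · rw [prod_Icc_succ_top (by omega), mul_comm]
      · rw [mul_zero]
    · simp [h1, Ne.symm h1]

/-! ### Frozen rows and telescoping products -/

theorem prod_alphaWeight_add (Z : ℕ → ℂ) {A : ℂ} (n : ℕ) (hA : ∀ j : ℤ, theta τ (A + j * γ) ≠ 0) :
    ∏ j ∈ Icc 1 n, alphaWeight τ γ (Z j) (A + γ * ((j : ℂ) - 1))
      = (∏ j ∈ Icc 1 n, theta τ (Z j)) * (theta τ (A + γ * n) / theta τ A) := by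
  induction n with
  | zero => simp [div_self (by simpa using hA 0 : theta τ A ≠ 0)]
  | succ n ih =>
    have h1 : theta τ (A + γ * n) ≠ 0 := by simpa [mul_comm] using hA n
    have h0 : theta τ A ≠ 0 := by simpa using hA 0
    rw [prod_Icc_succ_top (by omega), prod_Icc_succ_top (by omega), ih, alphaWeight]
    push_cast
    rw [show A + γ * ((n : ℂ) + 1 - 1) = A + γ * n by ring,
      show A + γ * (n : ℂ) + γ = A + γ * (n + 1) by ring]
    field_simp

theorem prod_alphaWeight_sub (Z : ℕ → ℂ) {A : ℂ} (n : ℕ) (hA : ∀ j : ℤ, theta τ (A + j * γ) ≠ 0) :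
    ∏ j ∈ Icc 1 n, alphaWeight τ γ (Z j) (A - γ * ((j : ℂ) - 1))
      = (∏ j ∈ Icc 1 n, theta τ (Z j)) * (theta τ (A + γ) / theta τ (A + γ - γ * n)) := by
  induction n with
  | zero => simp [div_self (by simpa using hA 1 : theta τ (A + γ) ≠ 0)]
  | succ n ih =>
    have h1 : theta τ (A + γ - γ * n) ≠ 0 := by
      convert hA (1 - n) using 2; push_cast; ring
    have h0 : theta τ (A - γ * n) ≠ 0 := by
      convert hA (-n) using 2; push_cast; ring
    rw [prod_Icc_succ_top (by omega), prod_Icc_succ_top (by omega), ih, alphaWeight]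
    push_cast
    rw [show A - γ * ((n : ℂ) + 1 - 1) = A - γ * n by ring,
      show A - γ * (n : ℂ) + γ = A + γ - γ * n by ring,
      show A + γ - γ * ((n : ℂ) + 1) = A - γ * n by ring]
    field_simp

/-- All bottom ends carrying the highest colour, a row with another colour at its right end is
frozen. -/
theorem rowWeight_right_ne {z : ℂ} {w : ℕ → ℂ} {b t : ℕ → ℕ} {n a a' : ℕ}
    (hb : ∀ s ∈ Icc 1 n, b s = N) (ha' : a' ∈ Icc 1 N) (haN : a' ≠ N) :
    rowWeight τ γ N lam z w b t n a a'
      = if a = a' ∧ ∀ s ∈ Icc 1 n, t s = N then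
          ∏ j ∈ Icc 1 n, alphaWeight τ γ (z - w j) (lam a' - lam N + γ * ((j : ℂ) - 1))
        else 0 := by
  induction n with
  | zero => simp [rowWeight]
  | succ n ih =>
    rw [forall_Icc_succ] at hb
    simp only [rowWeight, hb.1, forall_Icc_succ]
    -- only the vertex with equal left and right colours contributes
    have hx : ∀ x ∈ Icc 1 N, x ≠ a' → rowWeight τ γ N lam z w b t n a x *
        vertexWeight τ γ (shiftDyn (-γ) lam t n) z (w (n + 1)) x N a' (t (n + 1)) = 0 := by
      intro x _ hxa
      by_contra h
      rcases vertexWeight_ne_zero (right_ne_zero_of_mul h) with h1 | h1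
      · exact hxa h1.1.symm
      · exact haN h1.1
    rw [sum_eq_single_of_mem a' ha' hx, ih hb.2, vertexWeight_of_ne _ _ _ _ _ haN,
      if_neg (c := a' = N ∧ _) (fun h => haN h.1), add_zero]
    by_cases h2 : t (n + 1) = N
    · simp only [h2, true_and, if_true, and_true]
      by_cases h3 : a = a' ∧ ∀ s ∈ Icc 1 n, t s = N
      · rw [if_pos h3, if_pos h3, prod_Icc_succ_top (by omega)]
        rw [shiftDyn_of_const _ _ h3.2, shiftDyn_of_const _ _ h3.2, if_pos rfl, if_neg haN]
        congr 2
        push_cast; ring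
      · rw [if_neg h3, if_neg h3, zero_mul]
    · simp [h2]

end column

/-! ### The last column of a layer -/

/-- A sum over colourings to which only the colouring `g` contributes. -/
theorem sum_toColours_single {n N : ℕ} {F : (ℕ → ℕ) → ℂ} (hF : DependsOnFirst n F) {g : ℕ → ℕ}
    (hg : ∀ s ∈ Icc 1 n, g s ∈ Icc 1 N) {G : (Fin n → Fin N) → ℂ}
    (h1 : ∀ u, (∀ s ∈ Icc 1 n, toColours u s = g s) → G u = F (toColours u))
    (h0 : ∀ u, (¬ ∀ s ∈ Icc 1 n, toColours u s = g s) → G u = 0) :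
    ∑ u, G u = F g := by
  have hgs : ∀ i : Fin n, g (i + 1) ∈ Icc 1 N := fun i => hg _ (by simp)
  let v : Fin n → Fin N := fun i => ⟨g (i + 1) - 1, by
    have := mem_Icc.mp (hgs i); omega⟩
  have hv : ∀ s ∈ Icc 1 n, toColours v s = g s := by
    intro s hs
    obtain ⟨i, rfl⟩ : ∃ i : Fin n, s = i + 1 :=
      ⟨⟨s - 1, by rw [mem_Icc] at hs; omega⟩, by rw [mem_Icc] at hs; simp; omega⟩
    rw [toColours_succ]
    have := mem_Icc.mp (hgs i)
    simp only [v]; omega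
  rw [sum_eq_single_of_mem v (mem_univ _), h1 v hv]
  · exact hF _ _ hv
  · intro u _ hu
    refine h0 u fun h => ?_
    refine hu (funext fun i => Fin.ext ?_)
    have h2 := (h (i + 1) (by simp)).trans (hv (i + 1) (by simp)).symm
    rw [toColours_succ, toColours_succ] at h2
    omega

section layer
variable {τ γ : ℂ} {N : ℕ} {lam : ℕ → ℂ}

theorem dependsOnFirst_layerWeight_right (τ γ : ℂ) (N : ℕ) (lam : ℕ → ℂ) (n : ℕ) (z w : ℕ → ℂ)
    (l t : ℕ → ℕ) (R : ℕ) (b : ℕ → ℕ) :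
    DependsOnFirst R fun r => layerWeight τ γ N lam n z w l r t R b := fun _ _ h =>
  layerWeight_congr τ γ N lam (fun _ _ => rfl) (fun _ _ => rfl) (fun _ _ => rfl) h (fun _ _ => rfl)
    (fun _ _ => rfl)

/-- A last column with the highest colour at its top splits off as a factor. -/
theorem layerWeight_last_column_top (z w : ℕ → ℂ) (l t : ℕ → ℕ) (n R : ℕ) (hN : 1 ≤ N)
    (ht : t (n + 1) = N) :
    layerWeight τ γ N lam (n + 1) z w l (fun _ => N) t R (fun _ => N)
      = (∏ s ∈ Icc 1 R, theta τ (z s - w (n + 1) - γ)) *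
        layerWeight τ γ N lam n z w l (fun _ => N) t R (fun _ => N) := by
  rw [layerWeight_succ_column]
  refine sum_toColours_single (F := fun r => _ * layerWeight τ γ N lam n z w l r t R _)
    (fun f g h => congrArg _ (dependsOnFirst_layerWeight_right _ _ _ _ _ _ _ _ _ _ _ f g h))
    (fun _ _ => by simpa using hN) (fun ρ h => ?_) fun ρ h => ?_
  · rw [ht, colWeight_top_top (fun s hs => toColours_mem ρ hs) hN, if_pos h, mul_comm]
  · rw [ht, colWeight_top_top (fun s hs => toColours_mem ρ hs) hN, if_neg h, mul_zero]

/-- A layer with one more horizontal line, whose right end does not carry the highest colour: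
this line is frozen. -/
theorem layerWeight_last_row_right_ne (hlam : IsGeneric τ γ N lam) (z w : ℕ → ℂ) {l r : ℕ → ℕ}
    (t : ℕ → ℕ) (n R : ℕ)
    {a : ℕ} (ha : a ∈ Icc 1 N) (haN : a ≠ N) (hr : r (R + 1) = a) :
    layerWeight τ γ N lam n z w l r t (R + 1) (fun _ => N)
      = if l (R + 1) = a then
          (∏ j ∈ Icc 1 n, theta τ (z (R + 1) - w j)) *
          (theta τ (shiftDyn (-γ) lam l R a - shiftDyn (-γ) lam l R N + γ * n) /
            theta τ (shiftDyn (-γ) lam l R a - shiftDyn (-γ) lam l R N)) *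
          layerWeight τ γ N lam n z w l r t R (fun _ => N)
        else 0 := by
  have hN : N ∈ Icc 1 N := by rw [mem_Icc] at *; omega
  have hF : DependsOnFirst n fun b => layerWeight τ γ N lam n z w l r t R b := fun _ _ h =>
    layerWeight_congr τ γ N lam (fun _ _ => rfl) (fun _ _ => rfl) (fun _ _ => rfl)
      (fun _ _ => rfl) (fun _ _ => rfl) h
  rw [layerWeight]
  split_ifs with h
  · refine sum_toColours_single (F := fun b => _ * layerWeight τ γ N lam n z w l r t R b)
      (fun f g h => congrArg _ (hF f g h)) (fun _ _ => hN) (fun u hu => ?_) fun u hu => ?_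
    · rw [hr, h, rowWeight_right_ne (fun _ _ => rfl) ha haN, if_pos ⟨rfl, hu⟩,
        prod_alphaWeight_add _ _ fun j => hlam.shiftDyn_neg l R a ha N hN haN j, mul_comm]
    · rw [hr, h, rowWeight_right_ne (fun _ _ => rfl) ha haN, if_neg (fun h => hu h.2), mul_zero]
  · refine sum_eq_zero fun u _ => ?_
    rw [hr, rowWeight_right_ne (fun _ _ => rfl) ha haN, if_neg fun h' => h h'.1, mul_zero]

/-- The specialisation of the last vertical parameter at which the corner vertex of a layer is
frozen: the last column and the last row split off. -/
theorem layerWeight_corner (hlam : IsGeneric τ γ N lam) (z w : ℕ → ℂ)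
    {l : ℕ → ℕ} (t : ℕ → ℕ) (n R : ℕ)
    {a : ℕ} (ha : a ∈ Icc 1 N) (haN : a ≠ N) (ht : t (n + 1) = a)
    (hw : w (n + 1) = z (R + 1) - γ) :
    layerWeight τ γ N lam (n + 1) z w l (fun _ => N) t (R + 1) (fun _ => N)
      = if l (R + 1) = a then
          -((∏ s ∈ Icc 1 R, theta τ (z s - z (R + 1) + γ)) *
            (theta τ (shiftDyn (-γ) lam t n N - shiftDyn (-γ) lam t n a + γ) * theta τ γ /
              theta τ (shiftDyn (-γ) lam t n N - shiftDyn (-γ) lam t n a - γ * R))) *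
          ((∏ j ∈ Icc 1 n, theta τ (z (R + 1) - w j)) *
          (theta τ (shiftDyn (-γ) lam l R a - shiftDyn (-γ) lam l R N + γ * n) /
            theta τ (shiftDyn (-γ) lam l R a - shiftDyn (-γ) lam l R N))) *
          layerWeight τ γ N lam n z w l (fun _ => N) t R (fun _ => N)
        else 0 := by
  have hN : N ∈ Icc 1 N := by rw [mem_Icc] at *; omega
  set D := shiftDyn (-γ) lam t n N - shiftDyn (-γ) lam t n a with hD
  have hgen : ∀ j : ℤ, theta τ (D + j * γ) ≠ 0 := fun j =>
    hlam.shiftDyn_neg t n N hN a ha (Ne.symm haN) j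
  set g : ℕ → ℕ := Function.update (fun _ => N) (R + 1) a with hg
  have hg1 : g (R + 1) = a := Function.update_self _ _ _
  have hg2 : ∀ s ∈ Icc 1 R, g s = N := fun s hs =>
    Function.update_of_ne (by rw [mem_Icc] at hs; omega) _ _
  have hgmem : ∀ s ∈ Icc 1 (R + 1), g s ∈ Icc 1 N := by
    rw [forall_Icc_succ]; exact ⟨by rwa [hg1], fun s hs => by rwa [hg2 s hs]⟩
  have hF := dependsOnFirst_layerWeight_right τ γ N lam n z w l t (R + 1) fun _ => N
  -- at this value of `w (n + 1)` the weight `[z - w - γ]` of the corner vertex vanishes, so that the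
  -- colour `a` turns to the left there
  have hcol : layerWeight τ γ N lam (n + 1) z w l (fun _ => N) t (R + 1) (fun _ => N)
      = -((∏ s ∈ Icc 1 R, theta τ (z s - z (R + 1) + γ)) *
            (theta τ (D + γ) * theta τ γ / theta τ (D - γ * R))) *
        layerWeight τ γ N lam n z w l g t (R + 1) fun _ => N := by
    rw [layerWeight_succ_column]
    have key : ∀ ρ : Fin (R + 1) → Fin N, colWeight τ γ N (shiftDyn (-γ) lam t n) z (w (n + 1))
        (toColours ρ) (fun _ => N) (t (n + 1)) (R + 1) N
        = if a = toColours ρ (R + 1) ∧ ∀ s ∈ Icc 1 R, toColours ρ s = N then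
          -((∏ s ∈ Icc 1 R, theta τ (z s - z (R + 1) + γ)) *
            (theta τ (D + γ) * theta τ γ / theta τ (D - γ * R))) else 0 := by
      intro ρ
      rw [ht, colWeight_succ_bottom_top (fun s hs => toColours_mem ρ hs)
        (by rw [mem_Icc] at hN; omega), hw]
      by_cases h1 : toColours ρ (R + 1) = N
      · rw [if_pos h1, if_neg (fun h => haN (h.1.trans h1)),
          show z (R + 1) - (z (R + 1) - γ) - γ = 0 by ring, theta_zero, zero_mul]
      · rw [if_neg h1]
        refine if_congr Iff.rfl ?_ rfl
        rw [← hD, prod_alphaWeight_sub _ _ hgen, betaWeight]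
        have e1 : theta τ (D + γ - γ * R) ≠ 0 := by
          convert hgen (1 - R) using 2; push_cast; ring
        have e2 : theta τ (D - γ * R) ≠ 0 := by
          convert hgen (-R) using 2; push_cast; ring
        rw [show z (R + 1) - (z (R + 1) - γ) + (D - γ * R) = D + γ - γ * R by ring]
        have e3 : ∀ s, z s - (z (R + 1) - γ) = z s - z (R + 1) + γ := fun s => by ring
        simp only [e3]
        field_simp
    have hiff : ∀ f : ℕ → ℕ, (∀ s ∈ Icc 1 (R + 1), f s = g s) ↔
        (a = f (R + 1) ∧ ∀ s ∈ Icc 1 R, f s = N) := fun f => by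
      rw [forall_Icc_succ, hg1]
      exact and_congr eq_comm (forall₂_congr fun s hs => by rw [hg2 s hs])
    refine sum_toColours_single (F := fun r => _ * layerWeight τ γ N lam n z w l r t (R + 1) _)
      (fun f g h => congrArg _ (hF f g h)) hgmem (fun ρ h => ?_) fun ρ h => ?_
    · rw [key, if_pos ((hiff _).mp h), mul_comm]
    · rw [key, if_neg (fun h' => h ((hiff _).mpr h')), mul_zero]
  rw [hcol, layerWeight_last_row_right_ne hlam z w t n R ha haN hg1]
  split_ifs
  · have h := dependsOnFirst_layerWeight_right τ γ N lam n z w l t R (fun _ => N) g (fun _ => N) hg2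
    dsimp only at h
    rw [h]
    ring
  · simp

/-- A layer with one horizontal line. -/
theorem layerWeight_one (hlam : IsGeneric τ γ N lam) (z w : ℕ → ℂ)
    (l t : ℕ → ℕ) (n : ℕ) {a : ℕ} (ha : a ∈ Icc 1 N) (haN : a ≠ N) (hta : t (n + 1) = a)
    (ht : ∀ s ∈ Icc 1 (n + 1), t s ∈ Icc 1 N) (htN : ∀ s ∈ Icc 1 n, t s = N) :
    layerWeight τ γ N lam (n + 1) z w l (fun _ => N) t 1 (fun _ => N)
      = if l 1 = a then
          theta τ γ * theta τ (z 1 - w (n + 1) + lam N - lam a - γ * n) / theta τ (lam a - lam N) *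
            ∏ j ∈ Icc 1 n, theta τ (z 1 - w j)
        else 0 := by
  have hN : N ∈ Icc 1 N := by rw [mem_Icc] at *; omega
  -- the tops of a single row are the tops of the layer
  have h1 : layerWeight τ γ N lam (n + 1) z w l (fun _ => N) t 1 (fun _ => N)
      = rowWeight τ γ N lam (z 1) w (fun _ => N) t (n + 1) (l 1) N := by
    rw [layerWeight]
    refine sum_toColours_single (F := fun u => rowWeight τ γ N lam (z 1) w
      (fun _ => N) u (n + 1) (l 1) N) (fun _ _ h => rowWeight_congr _ _ _ _ _ (fun _ _ => rfl)
        (fun _ _ => rfl) h _ _) ht (fun u h => ?_) fun u h => ?_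
    · simp only [layerWeight, shiftDyn_zero, zero_add]
      rw [prod_eq_one fun s hs => if_pos (h s hs).symm, one_mul]
    · push Not at h
      obtain ⟨s, hs, hne⟩ := h
      rw [layerWeight, prod_eq_zero hs (if_neg (Ne.symm hne)), zero_mul]
  have hx : ∀ x ∈ Icc 1 N, x ≠ a → rowWeight τ γ N lam (z 1) w (fun _ => N) t n (l 1) x *
      vertexWeight τ γ (shiftDyn (-γ) lam t n) (z 1) (w (n + 1)) x N N (t (n + 1)) = 0 := by
    intro x _ hxa
    by_contra h
    rcases vertexWeight_ne_zero (right_ne_zero_of_mul h) with h1 | h1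
    · exact haN (hta.symm.trans h1.2)
    · exact hxa (h1.2.symm.trans hta)
  rw [h1, rowWeight, sum_eq_single_of_mem a ha hx, rowWeight_right_ne (fun _ _ => rfl) ha haN]
  by_cases h : l 1 = a
  · rw [if_pos ⟨h, htN⟩, if_pos h, hta, vertexWeight_of_ne _ _ _ _ _ haN,
      if_neg (fun h => haN h.2), if_pos ⟨rfl, rfl⟩, zero_add,
      prod_alphaWeight_add _ _ (hlam a ha N hN haN), shiftDyn_of_const _ _ htN,
      shiftDyn_of_const _ _ htN, if_pos rfl, if_neg haN, betaWeight]
    have e0 : theta τ (lam a - lam N) ≠ 0 := by simpa using hlam a ha N hN haN 0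
    have e1 : theta τ (lam a - lam N + γ * n) ≠ 0 := by
      simpa [mul_comm] using hlam a ha N hN haN n
    rw [show lam N + -γ * n - lam a = -(lam a - lam N + γ * n) by ring, theta_neg,
      show z 1 - w (n + 1) + -(lam a - lam N + γ * n) = z 1 - w (n + 1) + lam N - lam a - γ * n
        by ring]
    field_simp
  · rw [if_neg fun h' => h h'.1, if_neg h, zero_mul]

end layer

/-! ### Quasi-periodicity -/

/-- Entire functions with the quasi-periodicity of `y ↦ ∏_{j = 1}^{n} [s_j - y]`, where
`s = s_1 + ⋯ + s_n`. -/
structure IsElliptic (τ : ℂ) (n : ℕ) (s : ℂ) (f : ℂ → ℂ) : Prop where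
  differentiable : Differentiable ℂ f
  add_one : ∀ y, f (y + 1) = (-1) ^ n * f y
  add_tau : ∀ y, f (y + τ) = (-1) ^ n * Complex.exp (-2 * Real.pi * Complex.I * (n * y - s)
    - Real.pi * Complex.I * n * τ) * f y

namespace IsElliptic
variable {τ : ℂ} {n n' : ℕ} {s s' : ℂ} {f f' : ℂ → ℂ}

theorem zero (τ : ℂ) (n : ℕ) (s : ℂ) : IsElliptic τ n s fun _ => 0 :=
  ⟨differentiable_const _, by simp, by simp⟩

theorem one (τ : ℂ) : IsElliptic τ 0 0 fun _ => 1 :=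
  ⟨differentiable_const _, by simp, by simp⟩

theorem const_mul (hf : IsElliptic τ n s f) (c : ℂ) : IsElliptic τ n s fun y => c * f y :=
  ⟨hf.differentiable.const_mul c, fun y => by rw [hf.add_one]; ring,
    fun y => by rw [hf.add_tau]; ring⟩

theorem sum {ι : Type*} {S : Finset ι} {F : ι → ℂ → ℂ} (hF : ∀ i ∈ S, IsElliptic τ n s (F i)) :
    IsElliptic τ n s fun y => ∑ i ∈ S, F i y :=
  ⟨Differentiable.fun_sum fun i hi => (hF i hi).differentiable,
    fun y => by rw [mul_sum]; exact sum_congr rfl fun i hi => (hF i hi).add_one y,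
    fun y => by rw [mul_sum]; exact sum_congr rfl fun i hi => (hF i hi).add_tau y⟩

theorem mul (hf : IsElliptic τ n s f) (hf' : IsElliptic τ n' s' f') :
    IsElliptic τ (n + n') (s + s') fun y => f y * f' y where
  differentiable := hf.differentiable.mul hf'.differentiable
  add_one y := by rw [hf.add_one, hf'.add_one, pow_add]; ring
  add_tau y := by
    rw [hf.add_tau, hf'.add_tau, pow_add]
    have : ∀ a b c d e g : ℂ, a * b * c * (d * e * g) = a * d * (b * e) * (c * g) := by
      intros; ring
    rw [this, ← Complex.exp_add]
    congr 3
    push_cast; ring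

protected theorem theta (hτ : 0 < τ.im) (s : ℂ) : IsElliptic τ 1 s fun y => theta τ (s - y) where
  differentiable := (differentiable_theta hτ).comp (by fun_prop)
  add_one y := by
    rw [show s - (y + 1) = -(y - s + 1) by ring, theta_neg, theta_add_one, ← theta_neg]
    ring_nf
  add_tau y := by
    rw [show s - (y + τ) = -(y - s + τ) by ring, theta_neg, theta_add_tau,
      show s - y = -(y - s) by ring, theta_neg]
    push_cast
    ring_nf

protected theorem alphaWeight (hτ : 0 < τ.im) (γ z l : ℂ) :
    IsElliptic τ 1 z fun y => alphaWeight τ γ (z - y) l := by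
  have h := (IsElliptic.theta hτ z).const_mul (_root_.EllipticNested.theta τ (l + γ) /
    _root_.EllipticNested.theta τ l)
  convert h using 2
  rw [EllipticNested.alphaWeight]; ring

protected theorem betaWeight (hτ : 0 < τ.im) (γ z l : ℂ) :
    IsElliptic τ 1 (z + l) fun y => betaWeight τ γ (z - y) l := by
  have h := (IsElliptic.theta hτ (z + l)).const_mul (-(_root_.EllipticNested.theta τ γ /
    _root_.EllipticNested.theta τ l))
  convert h using 2
  rw [EllipticNested.betaWeight, sub_add_eq_add_sub]; ring

theorem prod_alphaWeight (hτ : 0 < τ.im) (γ : ℂ) (z l : ℕ → ℂ) (m : ℕ) :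
    IsElliptic τ m (∑ j ∈ Icc 1 m, z j)
      fun y => ∏ j ∈ Icc 1 m, EllipticNested.alphaWeight τ γ (z j - y) (l j) := by
  induction m with
  | zero => simpa using IsElliptic.one τ
  | succ m ih =>
    simp only [prod_Icc_succ_top (Nat.le_add_left 1 m), sum_Icc_succ_top (Nat.le_add_left 1 m)]
    exact ih.mul (IsElliptic.alphaWeight hτ _ _ _)

end IsElliptic

variable {τ γ : ℂ} {N : ℕ}

/-- A column with the highest colour `N` at its right and bottom ends and another colour at its top
is elliptic in its parameter. Each summand contains exactly one factor of type `β`; the shifts of the dynamical variables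
compensate, so that all summands have the same quasi-periodicity. -/
theorem isElliptic_colWeight (hτ : 0 < τ.im) (lam : ℕ → ℂ) (z : ℕ → ℂ) {l : ℕ → ℕ} {t m : ℕ}
    (hN : 1 ≤ N) (htN : t ≠ N) (hl : ∀ s ∈ Icc 1 m, l s ∈ Icc 1 N) :
    IsElliptic τ m (∑ j ∈ Icc 1 m, z j + (lam N - lam t) - γ * ((m : ℂ) - 1))
      fun y => colWeight τ γ N lam z y l (fun _ => N) t m N := by
  induction m with
  | zero => simpa [colWeight, htN] using IsElliptic.zero τ 0 _
  | succ m ih =>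
    simp only [colWeight_succ_bottom_top hl hN]
    rw [forall_Icc_succ] at hl
    split_ifs with h1 h2
    · convert (IsElliptic.theta hτ (z (m + 1) - γ)).mul (ih hl.2) using 1
      · ring
      · rw [sum_Icc_succ_top (Nat.le_add_left 1 m)]; push_cast; ring
      · funext y; rw [sub_right_comm]
    · convert (IsElliptic.betaWeight hτ γ (z (m + 1)) (lam N - lam t - γ * m)).mul
        (IsElliptic.prod_alphaWeight hτ γ z (fun s => lam N - lam t - γ * ((s : ℂ) - 1)) m) using 1
      · ring
      · rw [sum_Icc_succ_top (Nat.le_add_left 1 m)]; push_cast; ring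
    · exact IsElliptic.zero _ _ _

theorem isElliptic_layerWeight (hτ : 0 < τ.im) (lam : ℕ → ℂ) (z w : ℕ → ℂ) (l : ℕ → ℕ)
    {t : ℕ → ℕ} {n m : ℕ} (hN : 1 ≤ N) (htN : t (n + 1) ≠ N) :
    IsElliptic τ m (∑ j ∈ Icc 1 m, z j
        + (shiftDyn (-γ) lam t n N - shiftDyn (-γ) lam t n (t (n + 1))) - γ * ((m : ℂ) - 1))
      fun y => layerWeight τ γ N lam (n + 1) z (Function.update w (n + 1) y) l (fun _ => N) t m
        fun _ => N := by
  simp only [layerWeight_succ_column, Function.update_self]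
  refine IsElliptic.sum fun ρ _ => ?_
  have h : ∀ y, layerWeight τ γ N lam n z (Function.update w (n + 1) y) l (toColours ρ) t m
      (fun _ => N) = layerWeight τ γ N lam n z w l (toColours ρ) t m (fun _ => N) := fun y =>
    layerWeight_congr _ _ _ _ (fun _ _ => rfl)
      (fun s hs => Function.update_of_ne (by rw [mem_Icc] at hs; omega) _ _)
      (fun _ _ => rfl) (fun _ _ => rfl) (fun _ _ => rfl) (fun _ _ => rfl)
  simp only [h]
  exact (isElliptic_colWeight hτ _ z hN htN fun s hs => toColours_mem ρ hs).const_mul _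

/-- A character of the period lattice with prescribed values `exp a`, `exp b` on the periods. -/
theorem exists_periodCharacter (hτ : 0 < τ.im) (a b : ℂ) : ∃ χ : PeriodCharacter τ,
    (χ (Multiplicative.ofAdd (periodOne τ)) : ℂ) = Complex.exp a ∧
    (χ (Multiplicative.ofAdd (periodTau τ)) : ℂ) = Complex.exp b := by
  -- `e x = m a + n b` for `x = m + n τ`, the coordinates `m`, `n` being real
  let e : ℂ → ℂ := fun x => a * ((x.re - x.im / τ.im * τ.re : ℝ) : ℂ)
    + b * ((x.im / τ.im : ℝ) : ℂ)
  have he : ∀ x y, e (x + y) = e x + e y := by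
    intro x y
    simp only [e, Complex.add_re, Complex.add_im]
    push_cast; ring
  have he0 : e 0 = 0 := by simp [e]
  refine ⟨{ toFun := fun x => Units.mk0 (Complex.exp (e (Multiplicative.toAdd x : periodLattice τ)))
              (Complex.exp_ne_zero _)
            map_one' := ?_
            map_mul' := ?_ }, ?_, ?_⟩
  · ext; simp [he0]
  · intro x y; ext; simp [he, Complex.exp_add]
  · simp [e, periodOne]
  · have : τ.im ≠ 0 := hτ.ne'
    simp [e, periodTau, this]

/-- Functions with the quasi-periodicity of a product of theta functions are elliptic polynomials. -/
theorem IsElliptic.exists_character (hτ : 0 < τ.im) {n : ℕ} {s : ℂ} {f : ℂ → ℂ}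
    (hf : IsElliptic τ n s f) : ∃ χ : PeriodCharacter τ,
      (χ (Multiplicative.ofAdd (periodOne τ)) : ℂ) = (-1) ^ n ∧
      (χ (Multiplicative.ofAdd (periodTau τ)) : ℂ)
        = (-1) ^ n * Complex.exp (2 * Real.pi * Complex.I * s) ∧ f ∈ thetaSpace τ n χ := by
  have hpow : (-1 : ℂ) ^ n = Complex.exp (n * (Real.pi * Complex.I)) := by
    rw [Complex.exp_nat_mul, Complex.exp_pi_mul_I]
  obtain ⟨χ, h1, h2⟩ := exists_periodCharacter hτ (n * (Real.pi * Complex.I))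
    (n * (Real.pi * Complex.I) + 2 * Real.pi * Complex.I * s)
  rw [Complex.exp_add] at h2
  rw [← hpow] at h1 h2
  refine ⟨χ, h1, h2, hf.differentiable, fun y => by rw [h1, hf.add_one], fun y => ?_⟩
  rw [h2, hf.add_tau, mul_assoc ((-1) ^ n) (Complex.exp _) (Complex.exp _), ← Complex.exp_add]
  ring_nf

/-! ### The nested sum: reductions of the top layer -/

section nested
variable {τ γ : ℂ} {k LI LII : ℕ → ℕ} {z wI wII : ℕ → ℕ → ℂ} {cI cII : ℕ → ℕ → ℕ} {M : ℕ}
  {lam : ℕ → ℂ}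

theorem lineUp_cons {α : Type} (p q : ℕ) (f g h : ℕ → α) :
    lineUp p (q + 1) f g h = lineUp p q f g fun j => if j = 1 then g (q + 1) else h (j - 1) := by
  funext s
  simp only [lineUp]
  split_ifs with h1 h2 h3 h4 h5 <;> first | rfl | omega | (congr 1; omega)

theorem nestedSum_perm (hτ : 0 < τ.im) (hlam : IsGeneric τ γ (M + 2) lam)
    (hcI : M ≠ 0 → ∀ s ∈ Icc 1 (LI M), cI M s ∈ Icc 1 (M + 1))
    (hcII : M ≠ 0 → ∀ s ∈ Icc 1 (LII M), cII M s ∈ Icc 1 (M + 1))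
    (n : ℕ) (w : ℕ → ℂ) (t : ℕ → ℕ) (σ : Equiv.Perm ℕ)
    (hσ : ∀ j, j ∉ Icc 1 (k (M + 1)) → σ j = j) :
    nestedSum τ γ k LI LII (Function.update z (M + 1) fun j => z (M + 1) (σ j)) wI wII cI cII
        (M + 1) n w t lam
      = nestedSum τ γ k LI LII z wI wII cI cII (M + 1) n w t lam := by
  have h := eq_comp_perm (G := fun Z => nestedSum τ γ k LI LII (Function.update z (M + 1) Z) wI wII
    cI cII (M + 1) n w t lam) (fun Z m hm => nestedSum_swap hτ hlam hcI hcII hm n w t Z) σ hσ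
    (z (M + 1))
  simpa using h

theorem isElliptic_nestedSum (hτ : 0 < τ.im) {n : ℕ} (w : ℕ → ℂ) {t : ℕ → ℕ}
    (ht : t (n + 1) ≠ M + 2) :
    IsElliptic τ (k (M + 1)) (∑ j ∈ Icc 1 (k (M + 1)), z (M + 1) j
        + (shiftDyn (-γ) lam t n (M + 2) - shiftDyn (-γ) lam t n (t (n + 1)))
        - γ * ((k (M + 1) : ℂ) - 1))
      fun y => nestedSum τ γ k LI LII z wI wII cI cII (M + 1) (n + 1)
        (Function.update w (n + 1) y) t lam := by
  simp only [nestedSum, mul_comm (layerWeight _ _ _ _ _ _ _ _ _ _ _ _)]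
  exact IsElliptic.sum fun e _ =>
    (isElliptic_layerWeight hτ lam _ w _ (by omega) ht).const_mul _

/-- A last column of the top layer with the highest colour at its top end is frozen. -/
theorem nestedSum_last_column_top (n : ℕ) (w : ℕ → ℂ) {t : ℕ → ℕ} (ht : t (n + 1) = M + 2) :
    nestedSum τ γ k LI LII z wI wII cI cII (M + 1) (n + 1) w t lam
      = (∏ j ∈ Icc 1 (k (M + 1)), theta τ (z (M + 1) j - w (n + 1) - γ)) *
        nestedSum τ γ k LI LII z wI wII cI cII (M + 1) n w t lam := by
  simp only [nestedSum, layerWeight_last_column_top _ _ _ t n _ (Nat.le_add_left 1 (M + 1)) ht,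
    mul_sum, mul_assoc]

theorem dependsOnFirst_nestedSum_lineUp (τ γ : ℂ) (k LI LII : ℕ → ℕ) (z wI wII : ℕ → ℕ → ℂ)
    (cI cII : ℕ → ℕ → ℕ) (M p q r : ℕ) (w : ℕ → ℂ) (f h : ℕ → ℕ) (lam : ℕ → ℂ) :
    DependsOnFirst q fun e => nestedSum τ γ k LI LII z wI wII cI cII M (p + q + r) w
      (lineUp p q f e h) lam := fun _ _ he =>
  nestedSum_congr τ γ (fun _ _ => rfl) (fun _ _ => rfl) (fun _ _ => rfl) (fun _ _ _ _ => rfl)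
    (fun _ _ _ _ => rfl) (fun _ _ _ _ => rfl) (fun _ _ _ _ => rfl) (fun _ _ _ _ => rfl) _
    (fun _ _ => rfl) (lineUp_congr (fun _ _ => rfl) he fun _ _ => rfl)

/-- Deleting the frozen corner vertex together with its row and its column; the line of this row
becomes a vertical line of the layer below, with prescribed colour. -/
theorem nestedSum_corner (hlam : IsGeneric τ γ (M + 2) lam) {K n : ℕ} (hk : k (M + 1) = K + 1)
    (w : ℕ → ℂ) (t : ℕ → ℕ) {a : ℕ} (ha : a ∈ Icc 1 (M + 1)) (ht : t (n + 1) = a)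
    (hw : w (n + 1) = z (M + 1) (K + 1) - γ) :
    nestedSum τ γ k LI LII z wI wII cI cII (M + 1) (n + 1) w t lam
      = (∏ j ∈ Icc 1 n, theta τ (z (M + 1) (K + 1) - w j)) *
        (∏ j ∈ Icc 1 K, theta τ (z (M + 1) j - z (M + 1) (K + 1) + γ)) *
        (theta τ γ *
          theta τ (shiftDyn (-γ) lam t n (M + 2) - shiftDyn (-γ) lam t n a + γ) /
          theta τ (shiftDyn (-γ) lam t n a - lam (M + 2))) *
        nestedSum τ γ (Function.update k (M + 1) K) LI (Function.update LII M (LII M + 1)) z wI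
          (Function.update wII M fun j => if j = 1 then z (M + 1) (K + 1) else wII M (j - 1)) cI
          (Function.update cII M fun j => if j = 1 then a else cII M (j - 1))
          (M + 1) n w t lam := by
  have haN : a ≠ M + 2 := by rw [mem_Icc] at ha; omega
  have ha' : a ∈ Icc 1 (M + 2) := Icc_subset_Icc_right (by omega) ha
  have hN : M + 2 ∈ Icc 1 (M + 2) := by simp
  simp only [nestedSum]
  rw [show Function.update k (M + 1) K (M + 1) = K from Function.update_self _ _ _]
  simp only [Function.update_self]
  rw [hk, mul_sum]
  set p := LI M
  set r := LII M
  set lam' := shiftDyn γ lam (cI M) p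
  have hF1 : DependsOnFirst (K + 1) fun e => layerWeight τ γ (M + 2) lam (n + 1) (z (M + 1)) w e
      (fun _ => M + 2) t (K + 1) fun _ => M + 2 := fun _ _ h =>
    layerWeight_congr _ _ _ _ (fun _ _ => rfl) (fun _ _ => rfl) h (fun _ _ => rfl)
      (fun _ _ => rfl) (fun _ _ => rfl)
  have hF2 := dependsOnFirst_nestedSum_lineUp τ γ k LI LII z wI wII cI cII M p (K + 1) r
    (lineUp p (K + 1) (wI M) (z (M + 1)) (wII M)) (cI M) (cII M) lam'
  rw [sum_toColours_succ (F := fun e => layerWeight τ γ (M + 2) lam (n + 1) (z (M + 1)) w e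
      (fun _ => M + 2) t (K + 1) (fun _ => M + 2) * nestedSum τ γ k LI LII z wI wII cI cII M
        (p + (K + 1) + r) (lineUp p (K + 1) (wI M) (z (M + 1)) (wII M))
        (lineUp p (K + 1) (cI M) e (cII M)) lam')
    fun f g h => congrArg₂ (· * ·) (hF1 f g h) (hF2 f g h)]
  refine sum_congr rfl fun e _ => ?_
  have he : ∀ x, ∀ s ∈ Icc 1 K, Function.update (toColours e) (K + 1) x s = toColours e s :=
    fun x s hs => Function.update_of_ne (by rw [mem_Icc] at hs; omega) _ _
  rw [sum_eq_single_of_mem a ha]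
  · rw [layerWeight_corner hlam _ w t n K ha' haN ht hw, Function.update_self, if_pos rfl,
      shiftDyn_congr _ _ (he a), lineUp_cons, lineUp_cons, Function.update_self]
    have h1 : layerWeight τ γ (M + 2) lam n (z (M + 1)) w (Function.update (toColours e) (K + 1) a)
        (fun _ => M + 2) t K (fun _ => M + 2)
        = layerWeight τ γ (M + 2) lam n (z (M + 1)) w (toColours e) (fun _ => M + 2) t K
          fun _ => M + 2 := layerWeight_congr _ _ _ _ (fun _ _ => rfl) (fun _ _ => rfl) (he a)
      (fun _ _ => rfl) (fun _ _ => rfl) (fun _ _ => rfl)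
    have h2 : nestedSum τ γ k LI LII z wI wII cI cII M (p + (K + 1) + r)
        (lineUp p K (wI M) (z (M + 1)) fun j => if j = 1 then z (M + 1) (K + 1) else wII M (j - 1))
        (lineUp p K (cI M) (Function.update (toColours e) (K + 1) a)
          fun j => if j = 1 then a else cII M (j - 1)) lam'
        = nestedSum τ γ (Function.update k (M + 1) K) LI (Function.update LII M (r + 1)) z wI
          (Function.update wII M fun j => if j = 1 then z (M + 1) (K + 1) else wII M (j - 1)) cI
          (Function.update cII M fun j => if j = 1 then a else cII M (j - 1)) M (p + K + (r + 1))
        (lineUp p K (wI M) (z (M + 1)) fun j => if j = 1 then z (M + 1) (K + 1) else wII M (j - 1))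
        (lineUp p K (cI M) (toColours e) fun j => if j = 1 then a else cII M (j - 1)) lam' := by
      rw [show p + (K + 1) + r = p + K + (r + 1) by ring]
      have hne : ∀ q ∈ Ico 1 M, q ≠ M := fun q hq => by rw [mem_Ico] at hq; omega
      refine nestedSum_congr τ γ (fun q hq => ?_) (fun _ _ => rfl) (fun q hq => ?_)
        (fun _ _ _ _ => rfl) (fun _ _ _ _ => rfl) (fun q hq _ _ => ?_) (fun _ _ _ _ => rfl)
        (fun q hq _ _ => ?_) _ (fun _ _ => rfl) (lineUp_congr (fun _ _ => rfl) (he a) fun _ _ => rfl)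
      · rw [Function.update_of_ne (by rw [mem_Icc] at hq; omega)]
      all_goals rw [Function.update_of_ne (hne q hq)]
    rw [h1, h2]
    by_cases h0 : layerWeight τ γ (M + 2) lam n (z (M + 1)) w (toColours e) (fun _ => M + 2) t K
        (fun _ => M + 2) = 0
    · rw [h0]; simp
    -- conservation of colours determines the dynamical variables below the frozen row
    have hcons := layerWeight_conserve h0 (-γ) lam
    have hca := congrFun hcons a
    have hcN := congrFun hcons (M + 2)
    rw [shiftDyn_of_const _ _ (fun _ _ => rfl), shiftDyn_of_const _ _ (fun _ _ => rfl), if_neg haN,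
      if_neg haN] at hca
    rw [shiftDyn_of_const _ _ (fun _ _ => rfl), shiftDyn_of_const _ _ (fun _ _ => rfl), if_pos rfl,
      if_pos rfl] at hcN
    have heN : shiftDyn (-γ) lam (toColours e) K (M + 2) = lam (M + 2) := by
      simp only [shiftDyn]
      rw [filter_false_of_mem]
      · simp
      · intro s hs h
        have := mem_Icc.mp (toColours_mem e hs)
        omega
    rw [heN] at hcN
    rw [heN, hca]
    set A := shiftDyn (-γ) lam t n a
    set B := shiftDyn (-γ) lam t n (M + 2)
    have hden : theta τ (A - lam (M + 2)) ≠ 0 := by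
      have := hlam.shiftDyn_neg (toColours e) K a ha' _ hN haN 0
      rw [hca, heN] at this
      simpa using this
    have hden2 : theta τ (A - lam (M + 2) + γ * n) ≠ 0 := by
      have := hlam.shiftDyn_neg (toColours e) K a ha' _ hN haN n
      rw [hca, heN] at this
      simpa [mul_comm] using this
    rw [show B - A - γ * K = -(A - lam (M + 2) + γ * n) by linear_combination -hcN, theta_neg]
    field_simp
  · intro x _ hx
    rw [layerWeight_corner hlam _ w t n K ha' haN ht hw, Function.update_self, if_neg hx, zero_mul]

/-- A top layer with one horizontal line, all of whose top ends but the last carry the highest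
colour: its weight is a product, and the colour of the last top end enters the layer below. -/
theorem nestedSum_one (hlam : IsGeneric τ γ (M + 2) lam) {n : ℕ} (hk : k (M + 1) = 1)
    (w : ℕ → ℂ) {t : ℕ → ℕ} {a : ℕ} (ha : a ∈ Icc 1 (M + 1)) (ht : t (n + 1) = a)
    (htN : ∀ s ∈ Icc 1 n, t s = M + 2) :
    nestedSum τ γ k LI LII z wI wII cI cII (M + 1) (n + 1) w t lam
      = theta τ γ * theta τ (z (M + 1) 1 - w (n + 1) + lam (M + 2) - lam a - γ * n) /
          theta τ (lam a - lam (M + 2)) *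
        (∏ j ∈ Icc 1 n, theta τ (z (M + 1) 1 - w j)) *
        nestedSum τ γ k LI LII z wI wII cI cII M (LI M + 1 + LII M)
          (lineUp (LI M) 1 (wI M) (z (M + 1)) (wII M))
          (lineUp (LI M) 1 (cI M) (fun _ => a) (cII M)) (shiftDyn γ lam (cI M) (LI M)) := by
  have haN : a ≠ M + 2 := by rw [mem_Icc] at ha; omega
  have ha' : a ∈ Icc 1 (M + 2) := Icc_subset_Icc_right (by omega) ha
  have htm : ∀ s ∈ Icc 1 (n + 1), t s ∈ Icc 1 (M + 2) :=
    forall_Icc_succ.mpr ⟨ht ▸ ha', fun s hs => by rw [htN s hs]; simp⟩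
  simp only [nestedSum]
  rw [hk]
  refine sum_toColours_single (F := fun e => _ * nestedSum τ γ k LI LII z wI wII cI cII M
      (LI M + 1 + LII M) _ (lineUp (LI M) 1 (cI M) e (cII M)) _)
    (fun f g h => congrArg _ (dependsOnFirst_nestedSum_lineUp _ _ _ _ _ _ _ _ _ _ _ _ _ _ _ _ _ _
      f g h)) (fun _ _ => ha) (fun e h => ?_) fun e h => ?_
  · rw [layerWeight_one hlam _ w _ t n ha' haN ht htm htN, if_pos (h 1 (by simp))]
  · rw [layerWeight_one hlam _ w _ t n ha' haN ht htm htN, if_neg, zero_mul]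
    intro h1
    exact h fun s hs => by
      rw [show s = 1 by rw [mem_Icc] at hs; omega, h1]

end nested

/-! ### Coordinates and labels -/

namespace Shape
variable {S S' : Shape} {c J : ℕ → ℕ}

/-- The last coordinate of the layers `p, …, M`. -/
def last (S : Shape) (p : ℕ) : ℕ := S.LTop + ∑ q ∈ Ico p S.M, S.LII q

theorem mem_hatSet {p x : ℕ} : x ∈ S.hatSet p ↔ S.offI p < x ∧ x ≤ S.last p := mem_Icc

theorem last_top (S : Shape) : S.last S.M = S.LTop := by simp [last]

theorem last_eq {p : ℕ} (hp : p < S.M) : S.last p = S.last (p + 1) + S.LII p := by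
  rw [last, last, sum_eq_sum_Ico_succ_bot hp]; ring

theorem offI_succ {p : ℕ} (hp : 1 ≤ p) : S.offI (p + 1) = S.offI p + S.LI p := by
  rw [offI, offI, sum_Ico_succ_top hp]

theorem offI_mono {p q : ℕ} (h : p ≤ q) : S.offI p ≤ S.offI q :=
  sum_le_sum_of_subset (Ico_subset_Ico_right h)

theorem last_anti {p q : ℕ} (h : p ≤ q) : S.last q ≤ S.last p :=
  Nat.add_le_add_left (sum_le_sum_of_subset (Ico_subset_Ico_left h)) _

theorem LTop_le_last (p : ℕ) : S.LTop ≤ S.last p := Nat.le_add_right _ _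

theorem offI_lt_LTop {p : ℕ} (hp : p ≤ S.M) (hL : 1 ≤ S.L) : S.offI p < S.LTop := by
  have := S.offI_mono hp
  rw [LTop]; omega

theorem hatSet_anti {p q : ℕ} (h : p ≤ q) : S.hatSet q ⊆ S.hatSet p := by
  intro x hx
  rw [mem_hatSet] at *
  exact ⟨(S.offI_mono h).trans_lt hx.1, hx.2.trans (S.last_anti h)⟩

/-- Admissibility in terms of the sets of coordinates: a coordinate whose layer is `p` has a colour
in `{1, …, p + 1}`. -/
theorem isAdmissible_iff (hM : 1 ≤ S.M) : S.IsAdmissible c ↔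
    (∀ p ∈ Icc 1 S.M, ∀ x ∈ S.hatSet p, (p < S.M → x ∉ S.hatSet (p + 1)) → c x ∈ Icc 1 (p + 1)) ∧
      ∀ p ∈ Icc 1 S.M, #(S.labelSet c p) = S.k p := by
  constructor
  · refine fun h => ⟨fun p hp x hx hx' => ?_, h.card⟩
    rw [mem_hatSet] at hx
    rw [mem_Icc] at hp
    rcases eq_or_lt_of_le hp.2 with rfl | hlt
    · rw [last_top, LTop] at hx
      have := h.top (x - S.offI S.M) (by rw [mem_Icc]; omega)
      rwa [show S.offI S.M + (x - S.offI S.M) = x by omega] at this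
    · specialize hx' hlt
      rw [mem_hatSet, offI_succ hp.1] at hx'
      rw [last_eq hlt] at hx
      by_cases hle : x ≤ S.offI p + S.LI p
      · have := h.left p (by rw [mem_Ico]; omega) (x - S.offI p) (by rw [mem_Icc]; omega)
        rwa [show S.offI p + (x - S.offI p) = x by omega] at this
      · have := h.right p (by rw [mem_Ico]; omega) (x - S.last (p + 1)) (by rw [mem_Icc]; omega)
        rwa [show S.offII p + (x - S.last (p + 1)) = x by
          rw [show S.offII p = S.last (p + 1) from rfl]; omega] at this
  · rintro ⟨h, hcard⟩
    refine ⟨fun j hj => ?_, fun p hp j hj => ?_, fun p hp j hj => ?_, hcard⟩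
    · rw [mem_Icc] at hj
      refine h S.M (by rw [mem_Icc]; omega) _ ?_ fun h => absurd h (lt_irrefl _)
      rw [mem_hatSet, last_top, LTop]; omega
    · rw [mem_Ico] at hp
      rw [mem_Icc] at hj
      have h1 := S.LTop_le_last p
      have h2 := S.offI_succ hp.1
      have h3 := S.offI_mono (show p + 1 ≤ S.M by omega)
      refine h p (by rw [mem_Icc]; omega) _ ?_ fun _ h => ?_
      · rw [mem_hatSet]; rw [LTop] at h1; omega
      · rw [mem_hatSet] at h; omega
    · rw [mem_Ico] at hp
      rw [mem_Icc] at hj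
      have h1 := S.LTop_le_last (p + 1)
      have h2 := S.offI_mono (show p ≤ S.M by omega)
      have h3 := S.last_eq hp.2
      have h4 : S.offII p = S.last (p + 1) := rfl
      refine h p (by rw [mem_Icc]; omega) _ ?_ fun _ h => ?_
      · rw [mem_hatSet]; rw [LTop] at h1; omega
      · rw [mem_hatSet] at h; omega

theorem exists_layer {p x : ℕ} (hp : p ∈ Icc 1 S.M) (hx : x ∈ S.hatSet p) :
    ∃ q ∈ Icc p S.M, x ∈ S.hatSet q ∧ (q < S.M → x ∉ S.hatSet (q + 1)) := by
  rw [mem_Icc] at hp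
  obtain ⟨d, hd⟩ : ∃ d, S.M - p = d := ⟨_, rfl⟩
  induction d generalizing p with
  | zero => exact ⟨p, by rw [mem_Icc]; omega, hx, fun h => by omega⟩
  | succ d ih =>
    by_cases h : x ∈ S.hatSet (p + 1)
    · obtain ⟨q, hq, h'⟩ := ih (by omega) h (by omega)
      exact ⟨q, by rw [mem_Icc] at *; omega, h'⟩
    · exact ⟨p, by rw [mem_Icc]; omega, hx, fun _ => h⟩

theorem IsAdmissible.mem_Icc_of_mem_hatSet (hM : 1 ≤ S.M) (hc : S.IsAdmissible c) {x : ℕ}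
    (hx : x ∈ S.hatSet 1) : c x ∈ Icc 1 (S.M + 1) := by
  obtain ⟨q, hq, h1, h2⟩ := exists_layer (by rw [mem_Icc]; omega) hx
  have := ((isAdmissible_iff hM).mp hc).1 q hq x h1 h2
  rw [mem_Icc] at *; omega

/-- The label determines the colours: a colour `c x ≤ p + 1` in layer `p` is known as soon as it is
known for which `q ≤ p` it is `≤ q`. -/
theorem IsAdmissible.eqOn (hc : S.IsAdmissible c) (hJ : S.IsAdmissible J)
    (h : ∀ p ∈ Icc 1 S.M, S.labelSet c p = S.labelSet J p) (hM : 1 ≤ S.M) :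
    ∀ x ∈ S.hatSet 1, c x = J x := by
  intro x hx
  obtain ⟨q, hq, h1, h2⟩ := exists_layer (by rw [mem_Icc]; omega) hx
  rw [mem_Icc] at hq
  have hcx := mem_Icc.mp (((isAdmissible_iff hM).mp hc).1 q (by rw [mem_Icc]; omega) x h1 h2)
  have hJx := mem_Icc.mp (((isAdmissible_iff hM).mp hJ).1 q (by rw [mem_Icc]; omega) x h1 h2)
  have key : ∀ p, 1 ≤ p → p ≤ q → (c x ≤ p ↔ J x ≤ p) := by
    intro p h3 h4
    have h5 := congrArg (x ∈ ·) (h p (by rw [mem_Icc]; omega))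
    have h6 := S.hatSet_anti h4 h1
    simpa [labelSet, h6] using h5
  apply le_antisymm
  · by_cases h' : J x ≤ q
    · exact (key _ hJx.1 h').mpr le_rfl
    · omega
  · by_cases h' : c x ≤ q
    · exact (key _ hcx.1 h').mp le_rfl
    · omega

theorem labelSet_congr {p : ℕ} (h : ∀ x ∈ S.hatSet p, c x = J x) :
    S.labelSet c p = S.labelSet J p :=
  filter_congr fun x hx => by rw [h x hx]

theorem inducedSet_congr {p : ℕ} (h : ∀ x ∈ S.hatSet p, c x = J x) :
    S.inducedSet c p = S.inducedSet J p := by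
  rw [inducedSet, inducedSet, labelSet_congr h]
  refine image_congr fun x _ => ?_
  congr 1
  exact filter_congr fun y hy => by rw [h y hy]

/-- A relabelling of the coordinates that only drops coordinates of high colour induces a surjection
of the labels. -/
theorem labelSet_eq_image {f : ℕ → ℕ} {p : ℕ}
    (hmaps : ∀ x ∈ S'.hatSet p, f x ∈ S.hatSet p)
    (hsurj : ∀ y ∈ S.hatSet p, c y ≤ p → ∃ x ∈ S'.hatSet p, f x = y) :
    S.labelSet c p = (S'.labelSet (c ∘ f) p).image f := by
  ext y
  simp only [labelSet, mem_filter, mem_image, Function.comp]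
  constructor
  · rintro ⟨h1, h2⟩
    obtain ⟨x, hx, rfl⟩ := hsurj y h1 h2
    exact ⟨x, ⟨hx, h2⟩, rfl⟩
  · rintro ⟨x, ⟨h1, h2⟩, rfl⟩
    exact ⟨hmaps x h1, h2⟩

theorem card_labelSet_comp {f : ℕ → ℕ} (hf : StrictMono f) {p : ℕ}
    (hmaps : ∀ x ∈ S'.hatSet p, f x ∈ S.hatSet p)
    (hsurj : ∀ y ∈ S.hatSet p, c y ≤ p → ∃ x ∈ S'.hatSet p, f x = y) :
    #(S'.labelSet (c ∘ f) p) = #(S.labelSet c p) := by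
  rw [labelSet_eq_image hmaps hsurj, card_image_of_injective _ hf.injective]

/-- Dropping coordinates of colour at least `p + 2` does not change the induced label. -/
theorem inducedSet_comp {f : ℕ → ℕ} (hf : StrictMono f) {p : ℕ}
    (hmaps : ∀ x ∈ S'.hatSet p, f x ∈ S.hatSet p)
    (hsurj : ∀ y ∈ S.hatSet p, c y ≤ p + 1 → ∃ x ∈ S'.hatSet p, f x = y) :
    S'.inducedSet (c ∘ f) p = S.inducedSet c p := by
  rw [inducedSet, inducedSet,
    labelSet_eq_image hmaps fun y hy h => hsurj y hy (h.trans (Nat.le_succ p)), image_image]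
  refine image_congr fun x _ => ?_
  dsimp only [Function.comp]
  rw [← card_image_of_injective _ hf.injective]
  congr 1
  ext y
  simp only [mem_filter, mem_image]
  constructor
  · rintro ⟨a, ⟨h1, h2, h3⟩, rfl⟩
    exact ⟨hmaps a h1, h2, hf.monotone h3⟩
  · rintro ⟨h1, h2, h3⟩
    obtain ⟨a, ha, rfl⟩ := hsurj y h1 h2
    exact ⟨a, ⟨ha, h2, hf.le_iff_le.mp h3⟩, rfl⟩

theorem hatSet_top (S : Shape) : S.hatSet S.M = (Icc 1 S.L).image (S.offI S.M + ·) := by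
  ext x
  rw [mem_hatSet, last_top, LTop, mem_image]
  constructor
  · intro h; exact ⟨x - S.offI S.M, by rw [mem_Icc]; omega, by omega⟩
  · rintro ⟨j, hj, rfl⟩; rw [mem_Icc] at hj; omega

theorem card_filter_hatSet_top (S : Shape) (P : ℕ → Prop) [DecidablePred P] :
    #{x ∈ S.hatSet S.M | P x} = #{j ∈ Icc 1 S.L | P (S.offI S.M + j)} := by
  rw [hatSet_top, filter_image, card_image_of_injective _ (add_right_injective _)]

theorem count_top (S : Shape) (c : ℕ → ℕ) (l : ℕ) :
    S.count c S.M S.LTop l = #{j ∈ Icc 1 S.L | c (S.offI S.M + j) = l} := by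
  rw [← card_filter_hatSet_top S fun x => c x = l, count]
  congr 1
  refine filter_congr fun x hx => ?_
  rw [mem_hatSet, last_top] at hx
  simp [hx.2]

/-- The top layer has as many horizontal lines as top ends whose colour is not the highest one. -/
theorem IsAdmissible.k_add_card_highest (hM : 1 ≤ S.M) (hc : S.IsAdmissible c) :
    S.k S.M + #{j ∈ Icc 1 S.L | c (S.offI S.M + j) = S.M + 1} = S.L := by
  have h1 : S.k S.M = #{j ∈ Icc 1 S.L | c (S.offI S.M + j) ≤ S.M} := by
    rw [← hc.card S.M (by rw [mem_Icc]; omega), labelSet,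
      card_filter_hatSet_top S fun x => c x ≤ S.M]
  have h2 : #{j ∈ Icc 1 S.L | c (S.offI S.M + j) = S.M + 1}
      = #{j ∈ Icc 1 S.L | ¬ c (S.offI S.M + j) ≤ S.M} := by
    congr 1
    refine filter_congr fun j hj => ?_
    have := mem_Icc.mp (hc.top j hj)
    omega
  rw [h1, h2, card_filter_add_card_filter_not, Nat.card_Icc]
  omega

end Shape

theorem psi_congr (τ γ : ℂ) (S : Shape) (X : Spectral) {c J : ℕ → ℕ} (lam : ℕ → ℂ) (hM : 1 ≤ S.M)
    (h : ∀ x ∈ S.hatSet 1, c x = J x) : psi τ γ S X c lam = psi τ γ S X J lam := by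
  refine nestedSum_congr τ γ (fun _ _ => rfl) (fun _ _ => rfl) (fun _ _ => rfl) (fun _ _ _ _ => rfl)
    (fun _ _ _ _ => rfl) (fun _ _ _ _ => rfl) (fun p hp j hj => h _ ?_) (fun p hp j hj => h _ ?_) _
    (fun _ _ => rfl) fun j hj => h _ ?_
  · rw [mem_Icc] at hj
    rw [mem_Ico] at hp
    refine Shape.hatSet_anti hp.1 ?_
    have h1 := S.LTop_le_last p
    have h2 := S.offI_succ hp.1
    have h3 := S.offI_mono (show p + 1 ≤ S.M by omega)
    rw [Shape.mem_hatSet]; rw [Shape.LTop] at h1; omega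
  · rw [mem_Icc] at hj
    rw [mem_Ico] at hp
    refine Shape.hatSet_anti hp.1 ?_
    have h1 := S.LTop_le_last (p + 1)
    have h2 := S.offI_mono (show p ≤ S.M by omega)
    have h3 := S.last_eq hp.2
    have h4 : S.offII p = S.last (p + 1) := rfl
    rw [Shape.mem_hatSet]; rw [Shape.LTop] at h1; omega
  · refine Shape.hatSet_anti hM ?_
    rw [mem_Icc] at hj
    rw [Shape.mem_hatSet, Shape.last_top, Shape.LTop]; omega

/-! ### Labels of the reduced lattices

The colours of each reduced lattice are the old ones, read off through an increasing map of the
coordinates: the identity for `dropCorner`, `skipColumn` for `dropColumn` and `skipLayer` for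
`dropLayer`. -/

namespace Shape
variable {S : Shape} {c : ℕ → ℕ}

theorem last_dropCorner {p : ℕ} (hL : 1 ≤ S.L) (hp : p < S.M) :
    S.dropCorner.last p = S.last p := by
  have hm : S.M - 1 ∈ Ico p S.M := by rw [mem_Ico]; omega
  have h1 : S.dropCorner.LTop + 1 = S.LTop := by
    change S.offI S.M + (S.L - 1) + 1 = S.offI S.M + S.L
    omega
  have h2 : ∑ q ∈ Ico p S.M, S.dropCorner.LII q = ∑ q ∈ Ico p S.M, S.LII q + 1 := by
    rw [dropCorner, sum_update_of_mem hm, sum_eq_add_sum_sdiff_singleton_of_mem hm]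
    ring
  change S.dropCorner.LTop + ∑ q ∈ Ico p S.M, S.dropCorner.LII q = _
  rw [h2, last, ← h1]; ring

theorem hatSet_dropCorner {p : ℕ} (hL : 1 ≤ S.L) (hp : p < S.M) :
    S.dropCorner.hatSet p = S.hatSet p := by
  ext x
  rw [mem_hatSet, mem_hatSet, last_dropCorner hL hp]
  rfl

theorem labelSet_dropCorner {p : ℕ} (hL : 1 ≤ S.L) (hp : p < S.M) :
    S.dropCorner.labelSet c p = S.labelSet c p := by
  rw [labelSet, labelSet, hatSet_dropCorner hL hp]

theorem inducedSet_dropCorner {p : ℕ} (hL : 1 ≤ S.L) (hp : p < S.M) :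
    S.dropCorner.inducedSet c p = S.inducedSet c p := by
  rw [inducedSet, inducedSet, labelSet_dropCorner hL hp, hatSet_dropCorner hL hp]

theorem mem_hatSet_dropCorner_top {x : ℕ} :
    x ∈ S.dropCorner.hatSet S.M ↔ S.offI S.M < x ∧ x ≤ S.offI S.M + (S.L - 1) := by
  rw [mem_hatSet, show S.dropCorner.last S.M = S.dropCorner.LTop from last_top S.dropCorner]
  rfl

theorem LTop_mem_labelSet (hL : 1 ≤ S.L) (hι : c S.LTop ≤ S.M) : S.LTop ∈ S.labelSet c S.M := by
  rw [labelSet, mem_filter, mem_hatSet, last_top]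
  exact ⟨⟨S.offI_lt_LTop le_rfl hL, le_rfl⟩, hι⟩

theorem labelSet_dropCorner_top (hL : 1 ≤ S.L) :
    S.dropCorner.labelSet c S.M = S.labelSet c S.M \ {S.LTop} := by
  ext x
  simp only [labelSet, mem_filter, mem_sdiff, mem_singleton, mem_hatSet_dropCorner_top]
  rw [mem_hatSet, last_top, LTop]
  omega

theorem IsAdmissible.dropCorner (hM : 1 ≤ S.M) (hc : S.IsAdmissible c) (hL : 1 ≤ S.L)
    (hι : c S.LTop ≤ S.M) : S.dropCorner.IsAdmissible c := by
  have hcol := ((isAdmissible_iff hM).mp hc).1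
  refine (isAdmissible_iff (S := S.dropCorner) hM).mpr ⟨fun p hp x hx hx' => ?_, fun p hp => ?_⟩ <;>
    change p ∈ Icc 1 S.M at hp
  · change p < S.M → _ at hx'
    rcases eq_or_lt_of_le (mem_Icc.mp hp).2 with rfl | hlt
    · refine hcol _ hp x ?_ fun h => absurd h (lt_irrefl _)
      rw [mem_hatSet_dropCorner_top] at hx
      rw [mem_hatSet, last_top, LTop]; omega
    · rw [hatSet_dropCorner hL hlt] at hx
      rcases eq_or_lt_of_le (Nat.succ_le_of_lt hlt) with heq | hlt'
      · -- the new vertical line of layer `M - 1` is at the coordinate `LTop`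
        by_cases hxL : x = S.LTop
        · have h0 : S.LTop ∈ S.hatSet 1 := by
            refine hatSet_anti hM ?_
            rw [mem_hatSet, last_top]
            exact ⟨S.offI_lt_LTop le_rfl hL, le_rfl⟩
          have := mem_Icc.mp (hc.mem_Icc_of_mem_hatSet hM h0)
          rw [hxL, mem_Icc]
          omega
        · refine hcol p hp x hx fun _ h => hx' hlt ?_
          rw [Nat.succ_eq_add_one] at heq
          rw [heq, mem_hatSet, last_top, LTop] at h
          rw [LTop] at hxL
          rw [heq, mem_hatSet_dropCorner_top]
          omega
      · refine hcol p hp x hx fun _ => ?_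
        rw [← hatSet_dropCorner hL hlt']
        exact hx' hlt
  · rcases eq_or_lt_of_le (mem_Icc.mp hp).2 with rfl | hlt
    · change _ = Function.update S.k S.M (S.k S.M - 1) S.M
      rw [Function.update_self, labelSet_dropCorner_top hL,
        card_sdiff_of_subset (singleton_subset_iff.mpr (LTop_mem_labelSet hL hι)), card_singleton,
        hc.card _ hp]
    · change _ = Function.update S.k S.M (S.k S.M - 1) p
      rw [Function.update_of_ne hlt.ne, labelSet_dropCorner hL hlt, hc.card _ hp]

/-- The coordinates of the lattice with the last vertical line of the top layer removed, as
coordinates of the original lattice. -/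
def skipColumn (S : Shape) (x : ℕ) : ℕ := if x < S.LTop then x else x + 1

theorem strictMono_skipColumn (S : Shape) : StrictMono S.skipColumn := by
  intro x y h
  simp only [skipColumn]
  split_ifs <;> omega

theorem last_dropColumn (hL : 1 ≤ S.L) (p : ℕ) : S.dropColumn.last p + 1 = S.last p := by
  change S.offI S.M + (S.L - 1) + ∑ q ∈ Ico p S.M, S.LII q + 1
    = S.offI S.M + S.L + ∑ q ∈ Ico p S.M, S.LII q
  omega

theorem mem_hatSet_dropColumn {p x : ℕ} (hL : 1 ≤ S.L) (hp : p ≤ S.M) :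
    x ∈ S.dropColumn.hatSet p ↔ S.skipColumn x ∈ S.hatSet p ∧ S.skipColumn x ≠ S.LTop := by
  have h1 := last_dropColumn hL p
  have h2 := S.LTop_le_last p
  have h3 := S.offI_lt_LTop hp hL
  rw [mem_hatSet, mem_hatSet, show S.dropColumn.offI p = S.offI p from rfl, skipColumn]
  split_ifs <;> omega

theorem exists_skipColumn {p y : ℕ} (hL : 1 ≤ S.L) (hp : p ≤ S.M) (hy : y ∈ S.hatSet p)
    (hne : y ≠ S.LTop) : ∃ x ∈ S.dropColumn.hatSet p, S.skipColumn x = y := by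
  have h : ∃ x, S.skipColumn x = y := by
    by_cases h : y < S.LTop
    · exact ⟨y, by simp [skipColumn, h]⟩
    · refine ⟨y - 1, ?_⟩
      rw [skipColumn, if_neg (by omega)]
      omega
  obtain ⟨x, rfl⟩ := h
  exact ⟨x, (mem_hatSet_dropColumn hL hp).mpr ⟨hy, hne⟩, rfl⟩

theorem IsAdmissible.dropColumn (hM : 1 ≤ S.M) (hc : S.IsAdmissible c) (hL : 1 ≤ S.L)
    (hι : c S.LTop = S.M + 1) : S.dropColumn.IsAdmissible (c ∘ S.skipColumn) := by
  refine (isAdmissible_iff (S := S.dropColumn) hM).mpr ⟨fun p hp x hx hx' => ?_, fun p hp => ?_⟩ <;>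
    change p ∈ Icc 1 S.M at hp
  · have h := (mem_hatSet_dropColumn hL (mem_Icc.mp hp).2).mp hx
    refine ((isAdmissible_iff hM).mp hc).1 p hp _ h.1 fun hlt hmem => hx' hlt ?_
    exact (mem_hatSet_dropColumn hL hlt).mpr ⟨hmem, h.2⟩
  · have hp' := (mem_Icc.mp hp).2
    rw [card_labelSet_comp (S.strictMono_skipColumn)
      (fun x hx => ((mem_hatSet_dropColumn hL hp').mp hx).1)
      (fun y hy hcy => exists_skipColumn hL hp' hy ?_)]
    · exact hc.card p hp
    · rintro rfl; omega

theorem inducedSet_dropColumn {p : ℕ} (hL : 1 ≤ S.L) (hι : c S.LTop = S.M + 1) (hp : p < S.M) :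
    S.dropColumn.inducedSet (c ∘ S.skipColumn) p = S.inducedSet c p :=
  inducedSet_comp S.strictMono_skipColumn
    (fun x hx => ((mem_hatSet_dropColumn hL hp.le).mp hx).1)
    fun y hy hcy => exists_skipColumn hL hp.le hy (by rintro rfl; omega)

theorem labelSet_dropColumn {p : ℕ} (hL : 1 ≤ S.L) (hι : c S.LTop = S.M + 1) (hp : p < S.M) :
    S.dropColumn.labelSet (c ∘ S.skipColumn) p =
      {j ∈ S.labelSet c p | j ≤ S.LTop}
        ∪ {j ∈ S.labelSet c p | S.LTop < j}.image (fun j => j - 1) := by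
  ext x
  simp only [labelSet, mem_filter, mem_union, mem_image, mem_hatSet_dropColumn hL hp.le,
    Function.comp]
  constructor
  · rintro ⟨⟨h1, h2⟩, h3⟩
    by_cases hx : x < S.LTop
    · rw [skipColumn, if_pos hx] at *
      exact Or.inl ⟨⟨h1, h3⟩, hx.le⟩
    · rw [skipColumn, if_neg hx] at *
      exact Or.inr ⟨x + 1, ⟨⟨h1, h3⟩, by omega⟩, rfl⟩
  · rintro (⟨⟨h1, h2⟩, h3⟩ | ⟨j, ⟨⟨h1, h2⟩, h3⟩, rfl⟩)
    · have hx : x ≠ S.LTop := by rintro rfl; omega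
      rw [skipColumn, if_pos (lt_of_le_of_ne h3 hx)]
      exact ⟨⟨h1, hx⟩, h2⟩
    · rw [skipColumn, if_neg (by omega), Nat.sub_add_cancel (by omega)]
      exact ⟨⟨h1, by omega⟩, h2⟩

theorem labelSet_dropColumn_top (hL : 1 ≤ S.L) (hι : c S.LTop = S.M + 1) :
    S.dropColumn.labelSet (c ∘ S.skipColumn) S.M = S.labelSet c S.M := by
  ext x
  simp only [labelSet, mem_filter, mem_hatSet_dropColumn hL le_rfl, Function.comp]
  simp only [mem_hatSet, last_top, skipColumn]
  split_ifs with hx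
  · constructor
    · rintro ⟨⟨h1, -⟩, h2⟩; exact ⟨h1, h2⟩
    · rintro ⟨h1, h2⟩; exact ⟨⟨h1, by omega⟩, h2⟩
  · constructor
    · rintro ⟨⟨h1, -⟩, h2⟩; omega
    · rintro ⟨h1, h2⟩
      have : x = S.LTop := by omega
      rw [this] at h2; omega

/-- The coordinates of the lattice with the top layer removed, as coordinates of the original
lattice: the line joining the two layers is at the last coordinate of the top layer. -/
def skipLayer (S : Shape) (x : ℕ) : ℕ := if x ≤ S.offI S.M then x else x + (S.L - 1)

theorem strictMono_skipLayer (S : Shape) : StrictMono S.skipLayer := by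
  intro x y h
  simp only [skipLayer]
  split_ifs <;> omega

theorem last_dropLayer {p : ℕ} (hL : 1 ≤ S.L) (hM : 2 ≤ S.M) (hp : p < S.M) :
    S.dropLayer.last p + (S.L - 1) = S.last p := by
  have h1 := S.offI_succ (p := S.M - 1) (by omega)
  rw [Nat.sub_add_cancel (by omega)] at h1
  have h2 : ∑ q ∈ Ico p S.M, S.LII q = ∑ q ∈ Ico p (S.M - 1), S.LII q + S.LII (S.M - 1) := by
    rw [← sum_Ico_succ_top (by omega), Nat.sub_add_cancel (by omega)]
  change S.offI (S.M - 1) + (S.LI (S.M - 1) + 1 + S.LII (S.M - 1))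
    + ∑ q ∈ Ico p (S.M - 1), S.LII q + (S.L - 1) = S.offI S.M + S.L + ∑ q ∈ Ico p S.M, S.LII q
  rw [h2, h1]
  omega

theorem mem_hatSet_dropLayer {p x : ℕ} (hL : 1 ≤ S.L) (hM : 2 ≤ S.M) (hp : p < S.M) :
    x ∈ S.dropLayer.hatSet p ↔
      S.skipLayer x ∈ S.hatSet p ∧ (S.skipLayer x ≤ S.offI S.M ∨ S.LTop ≤ S.skipLayer x) := by
  have h1 := last_dropLayer hL hM hp
  have h2 := S.LTop_le_last p
  have h3 := S.offI_mono hp.le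
  rw [mem_hatSet, mem_hatSet, show S.dropLayer.offI p = S.offI p from rfl, skipLayer]
  rw [LTop] at *
  split_ifs <;> omega

theorem exists_skipLayer {p y : ℕ} (hL : 1 ≤ S.L) (hM : 2 ≤ S.M) (hp : p < S.M)
    (hy : y ∈ S.hatSet p) (h : y ≤ S.offI S.M ∨ S.LTop ≤ y) :
    ∃ x ∈ S.dropLayer.hatSet p, S.skipLayer x = y := by
  have h' : ∃ x, S.skipLayer x = y := by
    rcases h with h | h
    · exact ⟨y, by simp [skipLayer, h]⟩
    · refine ⟨y - (S.L - 1), ?_⟩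
      rw [LTop] at h
      rw [skipLayer, if_neg (by omega)]
      omega
  obtain ⟨x, rfl⟩ := h'
  exact ⟨x, (mem_hatSet_dropLayer hL hM hp).mpr ⟨hy, h⟩, rfl⟩

/-- If the top layer has one horizontal line, then all but one of its top ends have the highest
colour. -/
theorem IsAdmissible.eq_of_k_eq_one (hM : 1 ≤ S.M) (hc : S.IsAdmissible c) (hk : S.k S.M = 1)
    (hL : 1 ≤ S.L) (hι : c S.LTop ≤ S.M) {x : ℕ} (h1 : S.offI S.M < x) (h2 : x < S.LTop) :
    c x = S.M + 1 := by
  have hx : x ∈ S.hatSet S.M := by rw [mem_hatSet, last_top]; omega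
  have hle := mem_Icc.mp (hc.mem_Icc_of_mem_hatSet hM (hatSet_anti hM hx))
  by_contra hne
  have hmem : x ∈ S.labelSet c S.M := by rw [labelSet, mem_filter]; exact ⟨hx, by omega⟩
  have hcard := hc.card S.M (by rw [mem_Icc]; omega)
  rw [hk] at hcard
  have := card_le_one.mp hcard.le _ hmem _ (LTop_mem_labelSet hL hι)
  omega

theorem IsAdmissible.le_or_LTop_le (hc : S.IsAdmissible c) (hk : S.k S.M = 1)
    (hL : 1 ≤ S.L) (hι : c S.LTop ≤ S.M) {p x : ℕ} (hp : p < S.M) (h : c x ≤ p + 1) :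
    x ≤ S.offI S.M ∨ S.LTop ≤ x := by
  by_contra hn
  have := hc.eq_of_k_eq_one (by omega) hk hL hι (x := x) (by omega) (by omega)
  omega

theorem IsAdmissible.dropLayer (hM : 2 ≤ S.M) (hc : S.IsAdmissible c) (hk : S.k S.M = 1)
    (hL : 1 ≤ S.L) (hι : c S.LTop ≤ S.M) : S.dropLayer.IsAdmissible (c ∘ S.skipLayer) := by
  have hM1 : 1 ≤ S.M := by omega
  have hM' : 1 ≤ S.dropLayer.M := by change 1 ≤ S.M - 1; omega
  refine (isAdmissible_iff hM').mpr ⟨fun p hp x hx hx' => ?_, fun p hp => ?_⟩ <;>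
    change p ∈ Icc 1 (S.M - 1) at hp <;> rw [mem_Icc] at hp
  · change p < S.M - 1 → _ at hx'
    have h := (mem_hatSet_dropLayer hL hM (by omega)).mp hx
    by_cases hx0 : S.skipLayer x = S.LTop ∧ p + 1 = S.M
    · have h0 : S.LTop ∈ S.hatSet 1 := hatSet_anti (by omega) (hx0.1 ▸ h.1)
      have := mem_Icc.mp (hc.mem_Icc_of_mem_hatSet hM1 h0)
      rw [Function.comp, hx0.1, mem_Icc]
      omega
    · refine ((isAdmissible_iff hM1).mp hc).1 p (by rw [mem_Icc]; omega) _ h.1 fun hlt hmem => ?_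
      by_cases hp' : p < S.M - 1
      · exact hx' hp' ((mem_hatSet_dropLayer hL hM (by omega)).mpr ⟨hmem, h.2⟩)
      · have hpM : p + 1 = S.M := by omega
        rw [hpM, mem_hatSet, last_top] at hmem
        omega
  · rw [card_labelSet_comp S.strictMono_skipLayer
      (fun x hx => ((mem_hatSet_dropLayer hL hM (by omega)).mp hx).1)
      (fun y hy hcy => exists_skipLayer hL hM (by omega) hy
        (hc.le_or_LTop_le hk hL hι (p := p) (by omega) (by omega)))]
    exact hc.card p (by rw [mem_Icc]; omega)

theorem inducedSet_dropLayer {p : ℕ} (hc : S.IsAdmissible c) (hk : S.k S.M = 1)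
    (hL : 1 ≤ S.L) (hι : c S.LTop ≤ S.M) (hp1 : 1 ≤ p) (hp : p < S.M) :
    S.dropLayer.inducedSet (c ∘ S.skipLayer) p = S.inducedSet c p :=
  inducedSet_comp S.strictMono_skipLayer
    (fun x hx => ((mem_hatSet_dropLayer hL (by omega) hp).mp hx).1)
    fun y hy hcy => exists_skipLayer hL (by omega) hp hy (hc.le_or_LTop_le hk hL hι hp hcy)

theorem labelSet_dropLayer {p : ℕ} (hc : S.IsAdmissible c) (hk : S.k S.M = 1)
    (hL : 1 ≤ S.L) (hι : c S.LTop ≤ S.M) (hp1 : 1 ≤ p) (hp : p < S.M) :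
    S.dropLayer.labelSet (c ∘ S.skipLayer) p =
      {j ∈ S.labelSet c p | j < S.LTop}
        ∪ {j ∈ S.labelSet c p | S.LTop ≤ j}.image (fun j => j - S.L + 1) := by
  have hT : S.LTop = S.offI S.M + S.L := rfl
  ext x
  simp only [labelSet, mem_filter, mem_union, mem_image,
    mem_hatSet_dropLayer hL (show 2 ≤ S.M by omega) hp, Function.comp]
  constructor
  · rintro ⟨⟨h1, h2⟩, h3⟩
    by_cases hx : x ≤ S.offI S.M
    · rw [skipLayer, if_pos hx] at *
      exact Or.inl ⟨⟨h1, h3⟩, by omega⟩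
    · rw [skipLayer, if_neg hx] at *
      exact Or.inr ⟨x + (S.L - 1), ⟨⟨h1, h3⟩, by omega⟩, by omega⟩
  · rintro (⟨⟨h1, h2⟩, h3⟩ | ⟨j, ⟨⟨h1, h2⟩, h3⟩, rfl⟩)
    · have h4 := hc.le_or_LTop_le hk hL hι hp (h2.trans (Nat.le_succ p))
      have h5 : x ≤ S.offI S.M := by omega
      rw [skipLayer, if_pos h5]
      exact ⟨⟨h1, Or.inl h5⟩, h2⟩
    · rw [skipLayer, if_neg (by omega), show j - S.L + 1 + (S.L - 1) = j by omega]
      exact ⟨⟨h1, Or.inr h3⟩, h2⟩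

end Shape

/-! ### The partition function -/

theorem card_filter_Icc_succ (n : ℕ) (P : ℕ → Prop) [DecidablePred P] :
    #{j ∈ Icc 1 (n + 1) | P j} = #{j ∈ Icc 1 n | P j} + if P (n + 1) then 1 else 0 := by
  rw [card_filter, card_filter, sum_Icc_succ_top (Nat.le_add_left 1 n)]

section psi
variable {τ γ : ℂ} {S : Shape} {c : ℕ → ℕ} {lam : ℕ → ℂ}

/-- The dynamical variable of the highest colour above the last column of the top layer. -/
theorem shiftDyn_top_highest (γ : ℂ) (lam : ℕ → ℂ) (hM : 1 ≤ S.M) (hc : S.IsAdmissible c)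
    (hL : 1 ≤ S.L) (hι : c S.LTop ≠ S.M + 1) :
    shiftDyn (-γ) lam (fun j => c (S.offI S.M + j)) (S.L - 1) (S.M + 1)
      = lam (S.M + 1) - γ * ((S.L : ℂ) - S.k S.M) := by
  obtain ⟨n, hn⟩ : ∃ n, S.L = n + 1 := ⟨S.L - 1, by omega⟩
  have h := hc.k_add_card_highest hM
  rw [hn, card_filter_Icc_succ, ← hn, show S.offI S.M + S.L = S.LTop from rfl, if_neg hι,
    add_zero] at h
  have hR : (S.L : ℂ) = S.k S.M + (#{j ∈ Icc 1 n | c (S.offI S.M + j) = S.M + 1} : ℂ) := by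
    exact_mod_cast h.symm
  rw [hR, hn, Nat.add_sub_cancel, shiftDyn]
  ring

/-- The dynamical variable of the colour of the last column above that column. -/
theorem shiftDyn_top_self (γ : ℂ) (lam : ℕ → ℂ) (hL : 1 ≤ S.L) :
    shiftDyn (-γ) lam (fun j => c (S.offI S.M + j)) (S.L - 1) (c S.LTop)
      = lam (c S.LTop) - γ * ((S.count c S.M S.LTop (c S.LTop) : ℂ) - 1) := by
  obtain ⟨n, hn⟩ : ∃ n, S.L = n + 1 := ⟨S.L - 1, by omega⟩
  rw [Shape.count_top, hn, card_filter_Icc_succ, ← hn, show S.offI S.M + S.L = S.LTop from rfl,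
    if_pos rfl, hn, Nat.add_sub_cancel, shiftDyn]
  push_cast
  ring

theorem isElliptic_psi (hτ : 0 < τ.im) (hM : 1 ≤ S.M) (hc : S.IsAdmissible c) (X : Spectral)
    (lam : ℕ → ℂ) (hL : 1 ≤ S.L) (hι : c S.LTop ≠ S.M + 1) :
    IsElliptic τ (S.k S.M) (∑ j ∈ Icc 1 (S.k S.M), X.z S.M j
        - (lam (c S.LTop) - lam (S.M + 1))
        - γ * ((S.L : ℂ) - S.count c S.M S.LTop (c S.LTop)))
      fun y => psi τ γ S (X.setW S.L y) c lam := by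
  have h1 := shiftDyn_top_highest γ lam hM hc hL hι
  have h2 := shiftDyn_top_self (c := c) γ lam hL
  generalize S.count c S.M S.LTop (c S.LTop) = C at *
  obtain ⟨M, k, LI, LII, L⟩ := S
  obtain ⟨M, rfl⟩ : ∃ m, M = m + 1 := ⟨M - 1, (Nat.sub_add_cancel hM).symm⟩
  obtain ⟨n, rfl⟩ : ∃ n, L = n + 1 := ⟨L - 1, (Nat.sub_add_cancel hL).symm⟩
  set S : Shape := ⟨M + 1, k, LI, LII, n + 1⟩ with hS
  have h := isElliptic_nestedSum (γ := γ) (k := k) (LI := LI) (LII := LII) (z := X.z) (wI := X.wI)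
    (wII := X.wII) (cI := fun p j => c (S.offI p + j)) (cII := fun p j => c (S.offII p + j))
    (lam := lam) hτ (n := n) X.w (t := fun j => c (S.offI (M + 1) + j)) hι
  change shiftDyn (-γ) lam (fun j => c (S.offI (M + 1) + j)) n (M + 2)
    = lam (M + 2) - γ * (((n + 1 : ℕ) : ℂ) - k (M + 1)) at h1
  change shiftDyn (-γ) lam (fun j => c (S.offI (M + 1) + j)) n (c S.LTop) = _ at h2
  rw [show c (S.offI (M + 1) + (n + 1)) = c S.LTop from rfl, h1, h2] at h
  convert h using 1
  swap
  · rfl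
  change ∑ j ∈ Icc 1 (k (M + 1)), X.z (M + 1) j - (lam (c S.LTop) - lam (M + 2))
    - γ * (((n + 1 : ℕ) : ℂ) - C) = _
  ring

theorem psi_permZ (hτ : 0 < τ.im) (hM : 1 ≤ S.M) (hc : S.IsAdmissible c) (X : Spectral)
    (hlam : IsGeneric τ γ (S.M + 1) lam) (σ : Equiv.Perm ℕ)
    (hσ : ∀ j, j ∉ Icc 1 (S.k S.M) → σ j = j) :
    psi τ γ S (X.permZ S.M σ) c lam = psi τ γ S X c lam := by
  obtain ⟨M, k, LI, LII, L⟩ := S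
  obtain ⟨M, rfl⟩ : ∃ m, M = m + 1 := ⟨M - 1, (Nat.sub_add_cancel hM).symm⟩
  unfold psi
  refine nestedSum_perm hτ hlam (fun h => ?_) (fun h => ?_) _ _ _ σ hσ
  · exact hc.left M (by rw [mem_Ico]; exact ⟨by omega, by simp⟩)
  · exact hc.right M (by rw [mem_Ico]; exact ⟨by omega, by simp⟩)

/-- The specialisation of the last vertical parameter of the top layer at which the corner vertex is
frozen. -/
theorem psi_corner (hM : 1 ≤ S.M) (hc : S.IsAdmissible c) (X : Spectral)
    (hlam : IsGeneric τ γ (S.M + 1) lam) (hL : 1 ≤ S.L) (hι : c S.LTop ≤ S.M) :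
    psi τ γ S (X.setW S.L (X.z S.M (S.k S.M) - γ)) c lam
      = (∏ j ∈ Icc 1 (S.L - 1), theta τ (X.z S.M (S.k S.M) - X.w j))
        * (∏ j ∈ Icc 1 (S.k S.M - 1), theta τ (X.z S.M j - X.z S.M (S.k S.M) + γ))
        * (theta τ γ * theta τ (lam (S.M + 1) - lam (c S.LTop)
              + γ * ((S.k S.M : ℂ) - S.L + S.count c S.M S.LTop (c S.LTop)))
            / theta τ (lam (c S.LTop) - lam (S.M + 1)
              + γ * (1 - (S.count c S.M S.LTop (c S.LTop) : ℂ))))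
        * psi τ γ S.dropCorner (X.consWII (S.M - 1) (X.z S.M (S.k S.M))) c lam := by
  have hk : 1 ≤ S.k S.M := by
    rw [← hc.card S.M (by rw [mem_Icc]; omega)]
    exact card_pos.mpr ⟨_, Shape.LTop_mem_labelSet hL hι⟩
  have ha : c S.LTop ∈ Icc 1 S.M := by
    have := mem_Icc.mp (hc.top S.L (by rw [mem_Icc]; omega))
    rw [mem_Icc]
    exact ⟨this.1, hι⟩
  have h1 := shiftDyn_top_highest γ lam hM hc hL (by omega)
  have h2 := shiftDyn_top_self (c := c) γ lam hL
  generalize S.count c S.M S.LTop (c S.LTop) = C at *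
  obtain ⟨M, k, LI, LII, L⟩ := S
  obtain ⟨M, rfl⟩ : ∃ m, M = m + 1 := ⟨M - 1, (Nat.sub_add_cancel hM).symm⟩
  obtain ⟨n, rfl⟩ : ∃ n, L = n + 1 := ⟨L - 1, (Nat.sub_add_cancel hL).symm⟩
  obtain ⟨K, hK⟩ : ∃ K, k (M + 1) = K + 1 := ⟨k (M + 1) - 1, (Nat.sub_add_cancel hk).symm⟩
  set S : Shape := ⟨M + 1, k, LI, LII, n + 1⟩ with hS
  change shiftDyn (-γ) lam (fun j => c (S.offI (M + 1) + j)) n (M + 2)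
    = lam (M + 2) - γ * (((n + 1 : ℕ) : ℂ) - k (M + 1)) at h1
  change shiftDyn (-γ) lam (fun j => c (S.offI (M + 1) + j)) n (c S.LTop) = _ at h2
  change nestedSum τ γ k LI LII X.z X.wI X.wII (fun p j => c (S.offI p + j))
      (fun p j => c (S.offII p + j)) (M + 1) (n + 1)
      (Function.update X.w (n + 1) (X.z (M + 1) (k (M + 1)) - γ)) (fun j => c (S.offI (M + 1) + j))
      lam
    = (∏ j ∈ Icc 1 n, theta τ (X.z (M + 1) (k (M + 1)) - X.w j))
        * (∏ j ∈ Icc 1 (k (M + 1) - 1), theta τ (X.z (M + 1) j - X.z (M + 1) (k (M + 1)) + γ))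
        * (theta τ γ * theta τ (lam (M + 2) - lam (c S.LTop)
              + γ * ((k (M + 1) : ℂ) - (n + 1 : ℕ) + C))
            / theta τ (lam (c S.LTop) - lam (M + 2) + γ * (1 - (C : ℂ))))
        * psi τ γ S.dropCorner (X.consWII M (X.z (M + 1) (k (M + 1)))) c lam
  rw [hK] at h1 ⊢
  have hcor := nestedSum_corner (LI := LI) (LII := LII) (z := X.z) (wI := X.wI) (wII := X.wII)
    (cI := fun p j => c (S.offI p + j)) (cII := fun p j => c (S.offII p + j)) hlam hK
    (Function.update X.w (n + 1) (X.z (M + 1) (K + 1) - γ)) (fun j => c (S.offI (M + 1) + j)) ha rfl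
    (Function.update_self _ _ _)
  rw [h1, h2] at hcor
  refine Eq.trans hcor ?_
  have hw : ∀ j ∈ Icc 1 n, Function.update X.w (n + 1) (X.z (M + 1) (K + 1) - γ) j = X.w j :=
    fun j hj => Function.update_of_ne (by rw [mem_Icc] at hj; omega) _ _
  congr 1
  · congr 1
    · congr 1
      exact prod_congr rfl fun j hj => by rw [hw j hj]
    · congr 2
      · congr 1; push_cast; ring
      · ring
  · refine nestedSum_congr τ γ (fun p hp => ?_) (fun _ _ => rfl) (fun _ _ => rfl)
      (fun _ _ _ _ => rfl) (fun _ _ _ _ => rfl) (fun _ _ _ _ => rfl) (fun _ _ _ _ => rfl)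
      (fun p hp j hj => ?_) lam hw fun _ _ => rfl
    · change _ = Function.update k (M + 1) (k (M + 1) - 1) p
      rw [hK, Nat.add_sub_cancel]
    · rw [mem_Ico] at hp
      rw [mem_Icc] at hj
      have h3 : S.offII p = S.last (p + 1) := rfl
      have h4 : S.dropCorner.offII p = S.dropCorner.last (p + 1) := rfl
      by_cases hpM : p = M
      · have h5 : S.last (M + 1) = S.LTop := S.last_top
        have h6 : S.dropCorner.last (M + 1) + 1 = S.LTop := by
          rw [show S.dropCorner.last (M + 1) = S.dropCorner.LTop from S.dropCorner.last_top]
          rfl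
        rw [hpM, Function.update_self]
        rw [hpM] at h3 h4
        split_ifs with hj1
        · congr 1; omega
        · congr 1; omega
      · have h5 : S.dropCorner.last (p + 1) = S.last (p + 1) :=
          Shape.last_dropCorner hL (show p + 1 < M + 1 by omega)
        rw [Function.update_of_ne hpM, h3, h4, h5]

/-- The highest colour at the last top end of the top layer. -/
theorem psi_last_column (hM : 1 ≤ S.M) (X : Spectral) (hL : 1 ≤ S.L)
    (hι : c S.LTop = S.M + 1) :
    psi τ γ S X c lam
      = (∏ j ∈ Icc 1 (S.k S.M), theta τ (X.z S.M j - X.w S.L - γ))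
        * psi τ γ S.dropColumn X (c ∘ S.skipColumn) lam := by
  obtain ⟨M, k, LI, LII, L⟩ := S
  obtain ⟨M, rfl⟩ : ∃ m, M = m + 1 := ⟨M - 1, (Nat.sub_add_cancel hM).symm⟩
  obtain ⟨n, rfl⟩ : ∃ n, L = n + 1 := ⟨L - 1, (Nat.sub_add_cancel hL).symm⟩
  set S : Shape := ⟨M + 1, k, LI, LII, n + 1⟩ with hS
  refine (nestedSum_last_column_top n X.w hι).trans ?_
  congr 1
  refine nestedSum_congr τ γ (fun _ _ => rfl) (fun _ _ => rfl) (fun _ _ => rfl)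
    (fun _ _ _ _ => rfl) (fun _ _ _ _ => rfl) (fun _ _ _ _ => rfl) (fun p hp j hj => ?_)
    (fun p hp j hj => ?_) lam (fun _ _ => rfl) fun j hj => ?_
  · rw [mem_Ico] at hp
    rw [mem_Icc] at hj
    have h1 := S.offI_succ hp.1
    have h2 := S.offI_lt_LTop (p := p + 1) hp.2 hL
    change c (S.offI p + j) = c (S.skipColumn (S.offI p + j))
    rw [Shape.skipColumn, if_pos]
    have h3 : S.LI p = LI p := rfl
    omega
  · rw [mem_Icc] at hj
    change c (S.last (p + 1) + j) = c (S.skipColumn (S.dropColumn.last (p + 1) + j))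
    have h1 := Shape.last_dropColumn hL (p + 1)
    have h2 := S.LTop_le_last (p + 1)
    rw [Shape.skipColumn, if_neg (by omega)]
    congr 1; omega
  · rw [mem_Icc] at hj
    change c (S.offI (M + 1) + j) = c (S.skipColumn (S.offI (M + 1) + j))
    rw [Shape.skipColumn, if_pos]
    change _ < S.offI (M + 1) + (n + 1)
    have : j ≤ n := hj.2
    omega

/-- The dynamical variables at the northwest corner of the layer below the top. -/
theorem dyn_pred_top (γ : ℂ) (c : ℕ → ℕ) (lam : ℕ → ℂ) (hM : 1 ≤ S.M) :
    S.dyn γ c lam (S.M - 1)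
      = shiftDyn γ lam (fun j => c (S.offI (S.M - 1) + j)) (S.LI (S.M - 1)) := by
  funext i
  have : Ico (S.M - 1) S.M = {S.M - 1} := by
    ext x; rw [mem_Ico, mem_singleton]; omega
  rw [Shape.dyn, shiftDyn, this, sum_singleton, sum_boole]

/-- The partition function when the top layer has one horizontal line. The colours `J` of the
remaining lattice matter only if there are layers left. -/
theorem psi_one (hM : 1 ≤ S.M) (hc : S.IsAdmissible c) (X : Spectral)
    (hlam : IsGeneric τ γ (S.M + 1) lam) (hk : S.k S.M = 1) (hL : 1 ≤ S.L) (hι : c S.LTop ≤ S.M)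
    {J : ℕ → ℕ} (hJ : 2 ≤ S.M → ∀ x ∈ S.dropLayer.hatSet 1, c (S.skipLayer x) = J x) :
    psi τ γ S X c lam
      = theta τ γ * theta τ (X.z S.M 1 - X.w S.L + lam (S.M + 1) - lam (c S.LTop)
            - γ * ((S.L : ℂ) - 1))
          / theta τ (lam (c S.LTop) - lam (S.M + 1))
        * (∏ j ∈ Icc 1 (S.L - 1), theta τ (X.z S.M 1 - X.w j))
        * psi τ γ S.dropLayer (X.dropLayer (S.M - 1) (S.LI (S.M - 1))) J
            (S.dyn γ c lam (S.M - 1)) := by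
  have ha : c S.LTop ∈ Icc 1 S.M := by
    have := mem_Icc.mp (hc.top S.L (by rw [mem_Icc]; omega))
    rw [mem_Icc]
    exact ⟨this.1, hι⟩
  have htN : ∀ s ∈ Icc 1 (S.L - 1), c (S.offI S.M + s) = S.M + 1 := fun s hs => by
    rw [mem_Icc] at hs
    exact hc.eq_of_k_eq_one hM hk hL hι (by omega) (by rw [Shape.LTop]; omega)
  rw [dyn_pred_top γ c lam hM]
  obtain ⟨M, k, LI, LII, L⟩ := S
  obtain ⟨M, rfl⟩ : ∃ m, M = m + 1 := ⟨M - 1, (Nat.sub_add_cancel hM).symm⟩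
  obtain ⟨n, rfl⟩ : ∃ n, L = n + 1 := ⟨L - 1, (Nat.sub_add_cancel hL).symm⟩
  set S : Shape := ⟨M + 1, k, LI, LII, n + 1⟩ with hS
  refine (nestedSum_one hlam hk X.w (t := fun j => c (S.offI (M + 1) + j)) ha rfl htN).trans ?_
  congr 1
  · congr 2
    congr 2
    change _ = _ - γ * (((n + 1 : ℕ) : ℂ) - 1)
    push_cast
    rw [add_sub_cancel_right]
  · rcases Nat.eq_zero_or_pos M with rfl | h0
    · rfl
    have hJ' : ∀ p ≤ M, ∀ x ∈ S.dropLayer.hatSet p, 1 ≤ p → c (S.skipLayer x) = J x :=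
      fun p _ x hx hp => hJ (show 2 ≤ M + 1 by omega) x (Shape.hatSet_anti hp hx)
    have hM2 : 2 ≤ S.M := show 2 ≤ M + 1 by omega
    have hlast : ∀ p < M + 1, S.dropLayer.last p + n = S.last p := fun p hp =>
      Shape.last_dropLayer hL hM2 hp
    have hoff : ∀ p, S.dropLayer.offI p = S.offI p := fun _ => rfl
    have hLT : S.LTop = S.offI (M + 1) + (n + 1) := rfl
    have hskip1 : ∀ x, x ≤ S.offI (M + 1) → S.skipLayer x = x := fun x hx => if_pos hx
    have hskip2 : ∀ x, S.offI (M + 1) < x → S.skipLayer x = x + n := fun x hx =>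
      if_neg (not_le.mpr hx)
    have hlastM : S.last (M + 1) = S.LTop := S.last_top
    refine nestedSum_congr τ γ (fun _ _ => rfl) (fun _ _ => rfl) (fun _ _ => rfl)
      (fun _ _ _ _ => rfl) (fun _ _ _ _ => rfl) (fun _ _ _ _ => rfl) (fun p hp j hj => ?_)
      (fun p hp j hj => ?_) _ (fun _ _ => rfl) (lineUp_induction (fun j hj => ?_) (fun j hj => ?_)
        fun j hj => ?_) <;> rw [mem_Icc] at hj
    · rw [mem_Ico] at hp
      have h1 := S.offI_succ hp.1
      have h2 := S.offI_mono (show p + 1 ≤ M + 1 by omega)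
      have h3 := hlast p (by omega)
      have h4 := S.LTop_le_last p
      rw [← hskip1 (S.offI p + j) (by omega)]
      refine hJ' p hp.2.le _ ?_ hp.1
      rw [Shape.mem_hatSet, hoff]
      omega
    · rw [mem_Ico] at hp
      have h1 : S.offII p = S.last (p + 1) := rfl
      have h2 : S.dropLayer.offII p = S.dropLayer.last (p + 1) := rfl
      have h3 := hlast (p + 1) (by omega)
      have h4 := S.LTop_le_last (p + 1)
      have h5 := S.last_eq (p := p) (show p < M + 1 by omega)
      have h6 := hlast p (by omega)
      have h7 := S.offI_mono (show p ≤ M + 1 by omega)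
      rw [show S.offII p + j = S.skipLayer (S.dropLayer.offII p + j) by
        rw [hskip2 _ (by omega)]; omega]
      refine hJ' p hp.2.le _ ?_ hp.1
      rw [Shape.mem_hatSet, hoff]
      omega
    all_goals
      have h1 := S.offI_succ (p := M) h0
      have h3 := hlast M (by omega)
      have h5 := S.last_eq (p := M) (show M < M + 1 by omega)
    · rw [lineUp_left hj.2, ← hskip1 (S.offI M + j) (by omega)]
      refine hJ' M le_rfl _ ?_ h0
      rw [Shape.mem_hatSet, hoff]
      omega
    · rw [lineUp_middle hj.1 hj.2]
      have h6 : S.LTop = S.skipLayer (S.offI M + (S.LI M + j)) := by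
        rw [hskip2 _ (by omega)]; omega
      rw [h6]
      refine hJ' M le_rfl _ ?_ h0
      rw [Shape.mem_hatSet, hoff]
      omega
    · rw [lineUp_right hj.1]
      have h6 : S.offII M + j = S.skipLayer (S.offI M + (S.LI M + 1 + j)) := by
        rw [hskip2 _ (by omega), show S.offII M = S.last (M + 1) from rfl]; omega
      rw [h6]
      refine hJ' M le_rfl _ ?_ h0
      rw [Shape.mem_hatSet, hoff]
      omega

end psi

end EllipticNested

theorem mainTheorem6 (τ γ : ℂ) (hτ : 0 < τ.im) (hγ : γ ≠ 0)
    (S : Shape) (hM : 1 ≤ S.M) (X : Spectral)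
    (c : ℕ → ℕ) (hc : S.IsAdmissible c)
    (lam : ℕ → ℂ)
    (hlam : ∀ i ∈ Finset.Icc 1 (S.M + 1), ∀ j ∈ Finset.Icc 1 (S.M + 1), i ≠ j →
      ∀ n : ℤ, theta τ (lam i - lam j + n * γ) ≠ 0) :
    -- quasi-periodicity in the last variable of the top layer
    (1 ≤ S.L → c S.LTop ≠ S.M + 1 →
      0 < S.k S.M ∧
      (∃ χ : PeriodCharacter τ,
        (χ (Multiplicative.ofAdd (periodOne τ)) : ℂ) = (-1) ^ S.k S.M ∧
        (χ (Multiplicative.ofAdd (periodTau τ)) : ℂ) = (-1) ^ S.k S.M *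
          Complex.exp (2 * Real.pi * Complex.I * (∑ j ∈ Finset.Icc 1 (S.k S.M), X.z S.M j
            - (lam (c S.LTop) - lam (S.M + 1))
            - γ * ((S.L : ℂ) - S.count c S.M S.LTop (c S.LTop)))) ∧
        (fun y => psi τ γ S (X.setW S.L y) c lam) ∈ thetaSpace τ (S.k S.M) χ) ∧
      (∀ y : ℂ, psi τ γ S (X.setW S.L (y + 1)) c lam
        = (-1) ^ S.k S.M * psi τ γ S (X.setW S.L y) c lam) ∧
      (∀ y : ℂ, psi τ γ S (X.setW S.L (y + τ)) c lam
        = (-1) ^ S.k S.M * Complex.exp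
            (-2 * Real.pi * Complex.I * (S.k S.M * y - ∑ j ∈ Finset.Icc 1 (S.k S.M), X.z S.M j
              + lam (c S.LTop) - lam (S.M + 1)
              + γ * ((S.L : ℂ) - S.count c S.M S.LTop (c S.LTop)))
              - Real.pi * Complex.I * S.k S.M * τ)
          * psi τ γ S (X.setW S.L y) c lam)) ∧
    -- symmetry in the horizontal variables of the top layer
    (∀ σ : Equiv.Perm ℕ, (∀ j, j ∉ Finset.Icc 1 (S.k S.M) → σ j = j) →
      psi τ γ S (X.permZ S.M σ) c lam = psi τ γ S X c lam) ∧
    -- recursion, Case A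
    (1 ≤ S.L → c S.LTop ≠ S.M + 1 →
      (∃ J : ℕ → ℕ, S.dropCorner.IsAdmissible J ∧
        (∀ p ∈ Finset.Ico 1 S.M, S.dropCorner.labelSet J p = S.labelSet c p) ∧
        S.dropCorner.labelSet J S.M = S.labelSet c S.M \ {S.LTop}) ∧
      ∀ J : ℕ → ℕ, S.dropCorner.IsAdmissible J →
        (∀ p ∈ Finset.Ico 1 S.M, S.dropCorner.labelSet J p = S.labelSet c p) →
        S.dropCorner.labelSet J S.M = S.labelSet c S.M \ {S.LTop} →
        (∀ p ∈ Finset.Ico 1 S.M, S.dropCorner.inducedSet J p = S.inducedSet c p) ∧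
        psi τ γ S (X.setW S.L (X.z S.M (S.k S.M) - γ)) c lam
          = (∏ j ∈ Finset.Icc 1 (S.L - 1), theta τ (X.z S.M (S.k S.M) - X.w j))
            * (∏ j ∈ Finset.Icc 1 (S.k S.M - 1), theta τ (X.z S.M j - X.z S.M (S.k S.M) + γ))
            * (theta τ γ * theta τ (lam (S.M + 1) - lam (c S.LTop)
                  + γ * ((S.k S.M : ℂ) - S.L + S.count c S.M S.LTop (c S.LTop)))
                / theta τ (lam (c S.LTop) - lam (S.M + 1)
                  + γ * (1 - (S.count c S.M S.LTop (c S.LTop) : ℂ))))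
            * psi τ γ S.dropCorner (X.consWII (S.M - 1) (X.z S.M (S.k S.M))) J lam) ∧
    -- factorisation, Case B
    (1 ≤ S.L → c S.LTop = S.M + 1 →
      (∃ J : ℕ → ℕ, S.dropColumn.IsAdmissible J ∧
        (∀ p ∈ Finset.Ico 1 S.M, S.dropColumn.labelSet J p =
          {j ∈ S.labelSet c p | j ≤ S.LTop}
            ∪ {j ∈ S.labelSet c p | S.LTop < j}.image (fun j => j - 1)) ∧
        S.dropColumn.labelSet J S.M = S.labelSet c S.M) ∧
      ∀ J : ℕ → ℕ, S.dropColumn.IsAdmissible J →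
        (∀ p ∈ Finset.Ico 1 S.M, S.dropColumn.labelSet J p =
          {j ∈ S.labelSet c p | j ≤ S.LTop}
            ∪ {j ∈ S.labelSet c p | S.LTop < j}.image (fun j => j - 1)) →
        S.dropColumn.labelSet J S.M = S.labelSet c S.M →
        (∀ p ∈ Finset.Ico 1 S.M, S.dropColumn.inducedSet J p = S.inducedSet c p) ∧
        psi τ γ S X c lam
          = (∏ j ∈ Finset.Icc 1 (S.k S.M), theta τ (X.z S.M j - X.w S.L - γ))
            * psi τ γ S.dropColumn X J lam) ∧
    -- initial condition
    (1 ≤ S.L → S.k S.M = 1 → c S.LTop ≠ S.M + 1 →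
      (∃ J : ℕ → ℕ, S.dropLayer.IsAdmissible J ∧
        ∀ p ∈ Finset.Ico 1 S.M, S.dropLayer.labelSet J p =
          {j ∈ S.labelSet c p | j < S.LTop}
            ∪ {j ∈ S.labelSet c p | S.LTop ≤ j}.image (fun j => j - S.L + 1)) ∧
      ∀ J : ℕ → ℕ, S.dropLayer.IsAdmissible J →
        (∀ p ∈ Finset.Ico 1 S.M, S.dropLayer.labelSet J p =
          {j ∈ S.labelSet c p | j < S.LTop}
            ∪ {j ∈ S.labelSet c p | S.LTop ≤ j}.image (fun j => j - S.L + 1)) →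
        (∀ p ∈ Finset.Ico 1 S.M, S.dropLayer.inducedSet J p = S.inducedSet c p) ∧
        psi τ γ S X c lam
          = theta τ γ * theta τ (X.z S.M 1 - X.w S.L + lam (S.M + 1) - lam (c S.LTop)
                - γ * ((S.L : ℂ) - 1))
              / theta τ (lam (c S.LTop) - lam (S.M + 1))
            * (∏ j ∈ Finset.Icc 1 (S.L - 1), theta τ (X.z S.M 1 - X.w j))
            * psi τ γ S.dropLayer
                (X.dropLayer (S.M - 1) (S.LI (S.M - 1)))
                J (S.dyn γ c lam (S.M - 1))) := by
  have hle : 1 ≤ S.L → c S.LTop ≠ S.M + 1 → c S.LTop ≤ S.M := fun hL hι => by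
    have := mem_Icc.mp (hc.top S.L (by rw [mem_Icc]; omega))
    change 1 ≤ c S.LTop ∧ c S.LTop ≤ S.M + 1 at this
    omega
  refine ⟨fun hL hι => ?_, psi_permZ hτ hM hc X hlam, fun hL hι => ?_, fun hL hι => ?_,
    fun hL hk hι => ?_⟩
  · have h := isElliptic_psi (γ := γ) hτ hM hc X lam hL hι
    refine ⟨?_, h.exists_character hτ, h.add_one, fun y => ?_⟩
    · rw [← hc.card S.M (by rw [mem_Icc]; omega)]
      exact card_pos.mpr ⟨_, Shape.LTop_mem_labelSet hL (hle hL hι)⟩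
    · rw [h.add_tau]
      ring_nf
  · have hcJ := hc.dropCorner hM hL (hle hL hι)
    have hlab : ∀ p ∈ Ico 1 S.M, S.dropCorner.labelSet c p = S.labelSet c p := fun p hp =>
      Shape.labelSet_dropCorner hL (mem_Ico.mp hp).2
    refine ⟨⟨c, hcJ, hlab, Shape.labelSet_dropCorner_top hL⟩, fun J hJ h1 h2 => ?_⟩
    have heq : ∀ x ∈ S.dropCorner.hatSet 1, c x = J x := by
      refine hcJ.eqOn hJ (fun p hp => ?_) hM
      change p ∈ Icc 1 S.M at hp
      rw [mem_Icc] at hp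
      rcases eq_or_lt_of_le hp.2 with rfl | hlt
      · rw [h2, Shape.labelSet_dropCorner_top hL]
      · rw [h1 p (by rw [mem_Ico]; omega), hlab p (by rw [mem_Ico]; omega)]
    refine ⟨fun p hp => ?_, ?_⟩
    · rw [mem_Ico] at hp
      rw [← Shape.inducedSet_congr fun x hx => heq x (Shape.hatSet_anti hp.1 hx),
        Shape.inducedSet_dropCorner hL hp.2]
    · rw [psi_corner hM hc X hlam hL (hle hL hι), psi_congr τ γ S.dropCorner _ lam hM heq]
  · have hcJ := hc.dropColumn hM hL hι
    refine ⟨⟨_, hcJ, fun p hp => Shape.labelSet_dropColumn hL hι (mem_Ico.mp hp).2,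
      Shape.labelSet_dropColumn_top hL hι⟩, fun J hJ h1 h2 => ?_⟩
    have heq : ∀ x ∈ S.dropColumn.hatSet 1, (c ∘ S.skipColumn) x = J x := by
      refine hcJ.eqOn hJ (fun p hp => ?_) hM
      change p ∈ Icc 1 S.M at hp
      rw [mem_Icc] at hp
      rcases eq_or_lt_of_le hp.2 with rfl | hlt
      · rw [h2, Shape.labelSet_dropColumn_top hL hι]
      · rw [h1 p (by rw [mem_Ico]; omega), Shape.labelSet_dropColumn hL hι hlt]
    refine ⟨fun p hp => ?_, ?_⟩
    · rw [mem_Ico] at hp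
      rw [← Shape.inducedSet_congr fun x hx => heq x (Shape.hatSet_anti hp.1 hx),
        Shape.inducedSet_dropColumn hL hι hp.2]
    · rw [psi_last_column hM X hL hι, psi_congr τ γ S.dropColumn _ lam hM heq]
  · have hι' := hle hL hι
    have hex : ∃ J : ℕ → ℕ, S.dropLayer.IsAdmissible J ∧ (2 ≤ S.M → J = c ∘ S.skipLayer) := by
      by_cases hM2 : 2 ≤ S.M
      · exact ⟨_, hc.dropLayer hM2 hk hL hι', fun _ => rfl⟩
      · -- there are no layers left
        have h0 : S.dropLayer.M = 0 := by change S.M - 1 = 0; omega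
        refine ⟨fun _ => 1, ⟨fun _ _ => by simp, fun p hp => ?_, fun p hp => ?_, fun p hp => ?_⟩,
          fun h => absurd h hM2⟩ <;> simp [h0] at hp
    obtain ⟨J₀, hJ₀, hJ₀'⟩ := hex
    have hlab : ∀ p ∈ Ico 1 S.M, S.dropLayer.labelSet J₀ p =
          {j ∈ S.labelSet c p | j < S.LTop}
            ∪ {j ∈ S.labelSet c p | S.LTop ≤ j}.image (fun j => j - S.L + 1) := fun p hp => by
      rw [mem_Ico] at hp
      rw [hJ₀' (by omega), Shape.labelSet_dropLayer hc hk hL hι' hp.1 hp.2]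
    refine ⟨⟨J₀, hJ₀, hlab⟩, fun J hJ h1 => ?_⟩
    have heq : 2 ≤ S.M → ∀ x ∈ S.dropLayer.hatSet 1, c (S.skipLayer x) = J x := fun hM2 => by
      have h := hJ₀.eqOn hJ (fun p hp => ?_) (show 1 ≤ S.M - 1 by omega)
      · rwa [hJ₀' hM2] at h
      · change p ∈ Icc 1 (S.M - 1) at hp
        rw [mem_Icc] at hp
        rw [h1 p (by rw [mem_Ico]; omega), hlab p (by rw [mem_Ico]; omega)]
    refine ⟨fun p hp => ?_, psi_one hM hc X hlam hk hL hι' heq⟩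
    rw [mem_Ico] at hp
    rw [← Shape.inducedSet_congr fun x hx => heq (by omega) x (Shape.hatSet_anti hp.1 hx)]
    exact Shape.inducedSet_dropLayer hc hk hL hι' hp.1 hp.2
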